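/- \textbf{Setting.} Let $R$ be a nonzero commutative $\mathbb C$-algebra of coefficients and let $z\in R$ (for example $R=\mathbb C$ and $z$ a number, or $R=\mathbb C[z]$ or $\mathbb C(z)$ with $z$ the independent variable, which plays the role of a parameter). Let $\mathcal A=R\langle u,v\rangle$ be the free associative unital algebra, $[a,b]=ab-ba$, let $[\mathcal A,\mathcal A]$ be the linear span of all commutators, and let $\operatorname{trace} a$ be the class of $a$ in $\mathcal A/[\mathcal A,\mathcal A]$. For $x\in\{u,v\}$ the non-abelian partial derivative $\partial/\partial x:\mathcal A\to\mathcal A$ is the $R$-linear map that sends a word $w$ to $\sum sp$, the sum over all factorizations $w=p\,x\,s$. Put $$\{\operatorname{trace} a,\operatorname{trace} b\}=\operatorname{trace}\Big(\frac{\partial a}{\partial u}\frac{\partial b}{\partial v}-\frac{\partial a}{\partial v}\frac{\partial b}{\partial u}\Big).$$ The scalar reduction is the homomorphism $\mathcal A\to R[u,v]$ onto commutative polynomials. Let $\alpha,\beta,\gamma,\kappa_1,\dots,\kappa_4\in\mathbb C$. The ansatzes of types $\mathrm{P}_1,\mathrm P_2,\mathrm P_3',\mathrm P_4,\mathrm P_5,\mathrm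 P_6$ are $$\begin{aligned} H_6&=\alpha u^3v^2+(1-\alpha)u^2vuv+\beta u^2v^2-(1+\beta)uvuv-\kappa_1u^2v+\kappa_2uv-\kappa_3u\\ &\quad+z\big(\gamma u^2v^2-(1+\gamma)uvuv+uv^2+\kappa_4uv+(\kappa_1-\kappa_2-\kappa_4)v\big),\\ H_5&=\alpha u^3v^2+(1-\alpha)u^2vuv+\beta u^2v^2-(2+\beta)uvuv+uv^2-\kappa_1u^2v+(\kappa_1+\kappa_2)uv-\kappa_2v-\kappa_3u+z\kappa_4uv,\\ H_4&=uv^2-u^2v+\kappa_2v-\kappa_3u-2zuv,\\ H_3'&=\beta u^2v^2+(1-\beta)uvuv+\kappa_2u^2v+\kappa_1uv+\kappa_3u+z\kappa_4v,\\ H_2&=-u^2v+\tfrac12v^2-\kappa_3u-\tfrac12zv,\\ H_1&=-2u^3+\tfrac12v^2-zu. \end{aligned}$$ The corresponding scalar polynomials (Okamoto's Hamiltonians multiplied by $f_k(z)$) in $R[u,v]$ are $$\begin{aligned} h_6&=u^3v^2-u^2v^2-\kappa_1u^2v+\kappa_2uv-\kappa_3u+z\big(-u^2v^2+uv^2+\kappa_4uv+(\kappa_1-\kappa_2-\kappa_4)v\big),\\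 h_5&=u^3v^2-2u^2v^2+uv^2-\kappa_1u^2v+(\kappa_1+\kappa_2)uv-\kappa_2v-\kappa_3u+\kappa_4zuv,\\ h_4&=uv^2-u^2v+\kappa_2v-\kappa_3u-2zuv,\qquad h_3'=u^2v^2+\kappa_2u^2v+\kappa_1uv+\kappa_3u+\kappa_4zv,\\ h_2&=-u^2v+\tfrac12v^2-\kappa_3u-\tfrac12zv,\qquad h_1=-2u^3+\tfrac12v^2-zu, \end{aligned}$$ with $f_6=z(z-1)$, $f_5=f_3=z$, $f_4=f_2=f_1=1$. Say that $H_k$ \emph{admits a second polynomial} if there is $S^{(2)}\in\mathcal A$ such that the scalar reductions of $H_k$ and $S^{(2)}$ are $h_k$ and $h_k^2$ and $\{\operatorname{trace}H_k,\operatorname{trace}S^{(2)}\}=0$. \textbf{Proposition.} (1) For all constants $\alpha,\beta,\gamma,\kappa_i\in\mathbb C$: $H_5$ admits a second polynomial if and only if $\alpha=0$; $H_6$ admits a second polynomial if and only if $\alpha=0$; each of $H_1,H_2,H_3',H_4$ always admits one. Thus $\beta,\gamma,\kappa_i$ remain arbitrary. (2) For each type, the systems $u'=F$, $v'=G$ ($F,G\in\mathcal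 A$) with $f_k(z)F=\partial H_k/\partial v$, $f_k(z)G=-\partial H_k/\partial u$, for some constants such that $H_k$ admits a second polynomial, are exactly the following ones of the same type, with arbitrary constants $\beta,\gamma,\kappa_i\in\mathbb C$: $$\begin{aligned} \mathrm P_6:\quad z(z-1)u'&=u^2vu+uvu^2-2uvu+\beta[u,[u,v]]-\kappa_1u^2+\kappa_2u\\ &\quad+z\big(-2uvu+\gamma[u,[u,v]]+uv+vu+\kappa_4u+(\kappa_1-\kappa_2-\kappa_4)\big),\\ z(z-1)v'&=-uvuv-vu^2v-vuvu+2vuv+\beta[v,[u,v]]+\kappa_1(uv+vu)-\kappa_2v+\kappa_3\\ &\quad+z\big(2vuv+\gamma[v,[u,v]]-v^2-\kappa_4v\big);\\ \mathrm P_5:\quad zu'&=u^2vu+uvu^2-4uvu+\beta[u,[u,v]]-\kappa_1u^2+uv+vu+(\kappa_1+\kappa_2)u-\kappa_2+\kappa_4zu,\\ zv'&=-uvuv-vu^2v-vuvu+4vuv+\beta[v,[u,v]]+\kappa_1uv+\kappa_1vu-v^2-(\kappa_1+\kappa_2)v+\kappa_3-\kappa_4zv;\\ \mathrm P_4:\quad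 u'&=-u^2+uv+vu-2zu+\kappa_2,\qquad v'=-v^2+vu+uv+2zv+\kappa_3;\\ \mathrm P_3':\quad zu'&=2uvu+\beta[u,[u,v]]+\kappa_1u+\kappa_2u^2+\kappa_4z,\\ zv'&=-2vuv+\beta[v,[u,v]]-\kappa_1v-\kappa_2uv-\kappa_2vu-\kappa_3;\\ \mathrm P_2:\quad u'&=-u^2+v-\tfrac12z,\qquad v'=vu+uv+\kappa_3;\\ \mathrm P_1:\quad u'&=v,\qquad v'=6u^2+z. \end{aligned}$$ (3) The parameters $\beta,\gamma$ enter $\operatorname{trace}H_k$ only through a multiple of $\operatorname{trace}[u,v]^2$: for all constants, $$\operatorname{trace}H_k=\operatorname{trace}H_k\big|_{\beta=\gamma=0}-\tfrac12\,e_k\operatorname{trace}[u,v]^2,\qquad e_6=\beta+\gamma z,\quad e_5=e_3=\beta,\quad e_1=e_2=e_4=0.$$ -/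

import Mathlib

namespace NCPainleve

open FreeAlgebra

/-- The types `P1`, `P2`, `P3'`, `P4`, `P5`, `P6` of Painlevé systems. -/
inductive PType where
  | P1 | P2 | P3' | P4 | P5 | P6

/-- The scalar constants that occur in the non-commutative ansatzes. -/
structure Consts where
  α : ℂ
  β : ℂ
  γ : ℂ
  κ₁ : ℂ
  κ₂ : ℂ
  κ₃ : ℂ
  κ₄ : ℂ

/-- The free associative unital algebra on the generators `u` and `v` over a commutative
ring `R` of coefficients. -/
abbrev NC (R : Type*) [CommRing R] := FreeAlgebra R (Fin 2)

section Calculus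

variable {R : Type*} [CommRing R]

/-- The generator `u`. -/
def U : NC R := ι R 0

/-- The generator `v`. -/
def V : NC R := ι R 1

/-- The scalar reduction: the algebra homomorphism onto commutative polynomials in `u` and `v`
(the variables `0` and `1`). -/
noncomputable def scalarReduction : NC R →ₐ[R] MvPolynomial (Fin 2) R :=
  FreeAlgebra.lift R MvPolynomial.X

/-- The linear span `[A, A]` of all commutators. -/
def commutators (R : Type*) [CommRing R] : Submodule R (NC R) :=
  Submodule.span R {x | ∃ a b : NC R, x = a * b - b * a}

/-- The class of `a` in the quotient space `A / [A, A]`. -/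
def trace (a : NC R) : NC R ⧸ commutators R := (commutators R).mkQ a

/-- The non-commutative monomial spelled by a word in the generators. -/
def word (l : List (Fin 2)) : NC R := (l.map (ι R)).prod

/-- The non-abelian partial derivative of a word: each occurrence of the generator `i`, in a
factorization `p * x_i * s` of the word, contributes the word `s * p` (the symbol `d x_i` is
moved to the right end by a cyclic permutation, and then removed). -/
def wordDeriv (i : Fin 2) (l : List (Fin 2)) : NC R :=
  ∑ k ∈ Finset.range l.length,
    if l[k]? = some i then word (l.drop (k + 1) ++ l.take k) else 0

/-- The non-abelian partial derivative with respect to the generator `i`: the linear extension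
of `wordDeriv` from the basis of words. -/
noncomputable def ncDeriv (i : Fin 2) : NC R →ₗ[R] NC R :=
  (FreeAlgebra.basisFreeMonoid R (Fin 2)).constr R fun w => wordDeriv i w.toList

/-- The non-abelian partial derivative `∂ / ∂ u`. -/
noncomputable def dU : NC R →ₗ[R] NC R := ncDeriv 0

/-- The non-abelian partial derivative `∂ / ∂ v`. -/
noncomputable def dV : NC R →ₗ[R] NC R := ncDeriv 1

/-- The canonical Poisson bracket of `trace a` and `trace b`, an element of `A / [A, A]`. -/
noncomputable def bracket (a b : NC R) : NC R ⧸ commutators R :=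
  trace (dU a * dV b - dV a * dU b)

/-- The commutator in the free algebra. -/
def comm (a b : NC R) : NC R := a * b - b * a

end Calculus

section Painleve

variable {R : Type*} [CommRing R] [Algebra ℂ R]

/-- The scalar factors `f_k(z)`. -/
def factor (k : PType) (z : R) : R :=
  match k with
  | .P1 => 1
  | .P2 => 1
  | .P3' => z
  | .P4 => 1
  | .P5 => z
  | .P6 => z * (z - 1)

/-- The scalar polynomials `h_k` (the Okamoto Hamiltonians multiplied by `f_k(z)`), with
`x = u` and `y = v`. -/
noncomputable def scalarHam (k : PType) (c : Consts) (z : R) : MvPolynomial (Fin 2) R :=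
  let x : MvPolynomial (Fin 2) R := MvPolynomial.X 0
  let y : MvPolynomial (Fin 2) R := MvPolynomial.X 1
  match k with
  | .P1 => -2 * x ^ 3 + (1 / 2 : ℂ) • y ^ 2 - z • x
  | .P2 => -(x ^ 2 * y) + (1 / 2 : ℂ) • y ^ 2 - c.κ₃ • x - (1 / 2 : ℂ) • z • y
  | .P3' => x ^ 2 * y ^ 2 + c.κ₂ • (x ^ 2 * y) + c.κ₁ • (x * y) + c.κ₃ • x
      + z • c.κ₄ • y
  | .P4 => x * y ^ 2 - x ^ 2 * y + c.κ₂ • y - c.κ₃ • x - 2 * z • (x * y)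
  | .P5 => x ^ 3 * y ^ 2 - 2 * (x ^ 2 * y ^ 2) + x * y ^ 2 - c.κ₁ • (x ^ 2 * y)
      + (c.κ₁ + c.κ₂) • (x * y) - c.κ₂ • y - c.κ₃ • x + z • c.κ₄ • (x * y)
  | .P6 => x ^ 3 * y ^ 2 - x ^ 2 * y ^ 2 - c.κ₁ • (x ^ 2 * y) + c.κ₂ • (x * y) - c.κ₃ • x
      + z • (-(x ^ 2 * y ^ 2) + x * y ^ 2 + c.κ₄ • (x * y) + (c.κ₁ - c.κ₂ - c.κ₄) • y)

/-- The non-commutative ansatzes `H_k`. -/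
noncomputable def ham (k : PType) (c : Consts) (z : R) : NC R :=
  let u : NC R := U
  let v : NC R := V
  match k with
  | .P1 => -2 * u ^ 3 + (1 / 2 : ℂ) • v ^ 2 - z • u
  | .P2 => -(u ^ 2 * v) + (1 / 2 : ℂ) • v ^ 2 - c.κ₃ • u - (1 / 2 : ℂ) • z • v
  | .P3' => c.β • (u ^ 2 * v ^ 2) + (1 - c.β) • (u * v * u * v) + c.κ₂ • (u ^ 2 * v)
      + c.κ₁ • (u * v) + c.κ₃ • u + z • c.κ₄ • v
  | .P4 => u * v ^ 2 - u ^ 2 * v + c.κ₂ • v - c.κ₃ • u - 2 * z • (u * v)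
  | .P5 => c.α • (u ^ 3 * v ^ 2) + (1 - c.α) • (u ^ 2 * v * u * v) + c.β • (u ^ 2 * v ^ 2)
      - (2 + c.β) • (u * v * u * v) + u * v ^ 2 - c.κ₁ • (u ^ 2 * v)
      + (c.κ₁ + c.κ₂) • (u * v) - c.κ₂ • v - c.κ₃ • u + z • c.κ₄ • (u * v)
  | .P6 => c.α • (u ^ 3 * v ^ 2) + (1 - c.α) • (u ^ 2 * v * u * v) + c.β • (u ^ 2 * v ^ 2)
      - (1 + c.β) • (u * v * u * v) - c.κ₁ • (u ^ 2 * v) + c.κ₂ • (u * v) - c.κ₃ • u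
      + z • (c.γ • (u ^ 2 * v ^ 2) - (1 + c.γ) • (u * v * u * v) + u * v ^ 2
        + c.κ₄ • (u * v) + (c.κ₁ - c.κ₂ - c.κ₄) • v)

/-- `S₁` and `S₂` are the first two members of a commuting family of type `k`: their scalar
reductions are `h_k` and `h_k ^ 2`, and their traces commute. -/
structure IsCommutingPair (k : PType) (c : Consts) (z : R) (S₁ S₂ : NC R) : Prop where
  scalar_one : scalarReduction S₁ = scalarHam k c z
  scalar_two : scalarReduction S₂ = scalarHam k c z ^ 2
  bracket_eq_zero : bracket S₁ S₂ = 0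

/-- There is a second polynomial `S₂` for the ansatz `H_k`. -/
def HasSecond (k : PType) (c : Consts) (z : R) : Prop :=
  ∃ S₂ : NC R, IsCommutingPair k c z (ham k c z) S₂

/-- The system `u' = F`, `v' = G` is the Hamiltonian system with the Hamiltonian
`(1 / f_k(z)) trace H`, that is, `f_k(z) u' = ∂H/∂v` and `f_k(z) v' = -∂H/∂u`. -/
def IsHamiltonianSystem (k : PType) (z : R) (H F G : NC R) : Prop :=
  factor k z • F = dV H ∧ factor k z • G = -dU H

/-- The right-hand side of `f_k(z) u' = …` in the list of Hamiltonian systems. -/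
noncomputable def listU (k : PType) (c : Consts) (z : R) : NC R :=
  let u : NC R := U
  let v : NC R := V
  match k with
  | .P1 => v
  | .P2 => -u ^ 2 + v - algebraMap R (NC R) ((1 / 2 : ℂ) • z)
  | .P3' => 2 * (u * v * u) + c.β • comm u (comm u v) + c.κ₁ • u + c.κ₂ • u ^ 2
      + algebraMap R (NC R) (c.κ₄ • z)
  | .P4 => -u ^ 2 + u * v + v * u - 2 * z • u + algebraMap ℂ (NC R) c.κ₂
  | .P5 => u ^ 2 * v * u + u * v * u ^ 2 - 4 * (u * v * u) + c.β • comm u (comm u v)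
      - c.κ₁ • u ^ 2 + u * v + v * u + (c.κ₁ + c.κ₂) • u - algebraMap ℂ (NC R) c.κ₂
      + c.κ₄ • z • u
  | .P6 => u ^ 2 * v * u + u * v * u ^ 2 - 2 * (u * v * u) + c.β • comm u (comm u v)
      - c.κ₁ • u ^ 2 + c.κ₂ • u
      + z • (-2 * (u * v * u) + c.γ • comm u (comm u v) + u * v + v * u + c.κ₄ • u
        + algebraMap ℂ (NC R) (c.κ₁ - c.κ₂ - c.κ₄))

/-- The right-hand side of `f_k(z) v' = …` in the list of Hamiltonian systems. -/
noncomputable def listV (k : PType) (c : Consts) (z : R) : NC R :=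
  let u : NC R := U
  let v : NC R := V
  match k with
  | .P1 => 6 * u ^ 2 + algebraMap R (NC R) z
  | .P2 => v * u + u * v + algebraMap ℂ (NC R) c.κ₃
  | .P3' => -2 * (v * u * v) + c.β • comm v (comm u v) - c.κ₁ • v - c.κ₂ • (u * v)
      - c.κ₂ • (v * u) - algebraMap ℂ (NC R) c.κ₃
  | .P4 => -v ^ 2 + v * u + u * v + 2 * z • v + algebraMap ℂ (NC R) c.κ₃
  | .P5 => -(u * v * u * v) - v * u ^ 2 * v - v * u * v * u + 4 * (v * u * v)
      + c.β • comm v (comm u v) + c.κ₁ • (u * v) + c.κ₁ • (v * u) - v ^ 2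
      - (c.κ₁ + c.κ₂) • v + algebraMap ℂ (NC R) c.κ₃ - c.κ₄ • z • v
  | .P6 => -(u * v * u * v) - v * u ^ 2 * v - v * u * v * u + 2 * (v * u * v)
      + c.β • comm v (comm u v) + c.κ₁ • (u * v + v * u) - c.κ₂ • v
      + algebraMap ℂ (NC R) c.κ₃
      + z • (2 * (v * u * v) + c.γ • comm v (comm u v) - v ^ 2 - c.κ₄ • v)

/-- The coefficient through which the extra parameters `β` and `γ` enter `trace H_k`. -/
def extra (k : PType) (c : Consts) (z : R) : R :=
  match k with
  | .P1 => 0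
  | .P2 => 0
  | .P3' => algebraMap ℂ R c.β
  | .P4 => 0
  | .P5 => algebraMap ℂ R c.β
  | .P6 => algebraMap ℂ R c.β + z * algebraMap ℂ R c.γ

end Painleve

end NCPainleve

namespace NCPainleve

open FreeAlgebra

set_option linter.unusedSimpArgs false
set_option linter.unusedSectionVars false

/-! ### Words, cyclic functionals and the non-abelian partial derivatives -/

section Words

variable {R : Type*} [CommRing R]

/-! Existence. For α = 0 and the types P3', P4, P5, P6, trace H equals trace (L + g (u²v² - uvuv)).
Here L (`lax`) orders the letters so that the Hamiltonian flow of L moves L itself by a commutator,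
whence trace L² is conserved (`bracket_lax_sq`). The other term is a Casimir: its partial
derivatives are the commutators of [u,v] with the generators (`bracket_casimir`). This is why β and
γ stay free, and L² is a second polynomial. For P2 the ansatz H is its own Lax operator; for P1 the
square H² needs the correction 2u[u,v]².

Non-existence. Let α ≠ 0 and grade by the bidegree (i, j) in u and v. Among the components of S with
i ≥ j + 2 and nonzero ∂/∂v, take i - j maximal, then j maximal. Every term of H except its part of
bidegree (3, 2) then pairs only with components that are sums of commutators, so the chosen
component commutes with `leadHam`. Such components exist, because u⁶v⁴ has coefficient 1 in h². The
contradiction is the rigidity theorem `dV_eq_zero_of_bracket_leadHam_eq_zero`: a homogeneous a that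
commutes with `leadHam` and has i ≥ j + 2 satisfies ∂a/∂v = 0.

Rigidity. A word with n letters v is the same as a monomial in commuting y_0, ..., y_n, where y_t
stands for the letters u after the t-th v. Evaluating the bracket on a closed cycle of points and
eliminating ∂a/∂u gives a linear equation for p = ∂a/∂v alone, each term omitting one point of the
cycle (`sum_ev_dV_eq_zero`). After division by consecutive differences its coefficients become
differences of the pair potential W(x, y) = (x + y)(xy/(x - y)² + α).

At the points 1, w_0 X, w_1 X, ... the equation is expanded in X. Since α ≠ 0, the lowest
coefficient is shift invariant, hence constant. It vanishes by the scaling w ↦ 2w, except in one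
order, where the next coefficients, summed over all windows of the cycle 0, 1, ..., N + 1, kill it
(`leading_eq_zero`). So p at these points is divisible by a high power of X, which bounds the
exponent of the first variable in p by 1. By cyclic symmetry every exponent is at most 1, but the
degree of p exceeds the number of its variables; thus p = 0. -/

theorem basisFreeMonoid_apply (w : FreeMonoid (Fin 2)) :
    FreeAlgebra.basisFreeMonoid R (Fin 2) w = word w.toList := by
  simp [FreeAlgebra.basisFreeMonoid, FreeAlgebra.equivMonoidAlgebraFreeMonoid, word,
    FreeMonoid.lift_apply]

@[simp] theorem word_nil : (word [] : NC R) = 1 := rfl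

theorem word_cons (i : Fin 2) (l : List (Fin 2)) : (word (i :: l) : NC R) = ι R i * word l := by
  simp [word]

theorem word_append (l m : List (Fin 2)) : (word (l ++ m) : NC R) = word l * word m := by
  simp [word]

/-- The linear extension to the free algebra of a function on words. -/
noncomputable def wordLin {M : Type*} [AddCommGroup M] [Module R M] (f : List (Fin 2) → M) :
    NC R →ₗ[R] M :=
  (FreeAlgebra.basisFreeMonoid R (Fin 2)).constr R fun w => f w.toList

@[simp] theorem wordLin_word {M : Type*} [AddCommGroup M] [Module R M] (f : List (Fin 2) → M)
    (l : List (Fin 2)) : wordLin (R := R) f (word l) = f l := by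
  have h := (FreeAlgebra.basisFreeMonoid R (Fin 2)).constr_basis R (fun w => f w.toList)
    (FreeMonoid.ofList l)
  rw [basisFreeMonoid_apply] at h
  simpa [wordLin] using h

theorem ncDeriv_word (i : Fin 2) (l : List (Fin 2)) :
    ncDeriv i (word l : NC R) = wordDeriv i l :=
  wordLin_word (wordDeriv i) l

theorem span_word : Submodule.span R (Set.range (word : List (Fin 2) → NC R)) = ⊤ := by
  rw [← (FreeAlgebra.basisFreeMonoid R (Fin 2)).span_eq]
  congr 1
  ext x
  constructor
  · rintro ⟨l, rfl⟩
    exact ⟨FreeMonoid.ofList l, basisFreeMonoid_apply _⟩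
  · rintro ⟨w, rfl⟩
    exact ⟨w.toList, (basisFreeMonoid_apply _).symm⟩

theorem word_induction {p : NC R → Prop} (hw : ∀ l, p (word l)) (h0 : p 0)
    (hadd : ∀ a b, p a → p b → p (a + b)) (hsmul : ∀ (r : R) a, p a → p (r • a)) (a : NC R) :
    p a := by
  have ha : a ∈ Submodule.span R (Set.range (word : List (Fin 2) → NC R)) := by
    rw [span_word]; trivial
  induction ha using Submodule.span_induction with
  | mem x hx => obtain ⟨l, rfl⟩ := hx; exact hw l
  | zero => exact h0
  | add x y _ _ hx hy => exact hadd x y hx hy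
  | smul r x _ hx => exact hsmul r x hx

theorem commutator_mem (a b : NC R) : a * b - b * a ∈ commutators R :=
  Submodule.subset_span ⟨a, b, rfl⟩

/-- A linear map that is cyclic on words annihilates the commutators. -/
theorem apply_eq_zero_of_mem_commutators {M : Type*} [AddCommGroup M] [Module R M]
    (f : NC R →ₗ[R] M) (hf : ∀ l m, f (word (l ++ m)) = f (word (m ++ l))) {x : NC R}
    (hx : x ∈ commutators R) : f x = 0 := by
  have key : ∀ a b : NC R, f (a * b) = f (b * a) := by
    intro a b
    induction a using word_induction with
    | hw l =>
      induction b using word_induction with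
      | hw m => rw [← word_append, ← word_append, hf]
      | h0 => simp
      | hadd a b ha hb => rw [mul_add, add_mul, map_add, map_add, ha, hb]
      | hsmul r a ha => rw [mul_smul_comm, smul_mul_assoc, map_smul, map_smul, ha]
    | h0 => simp
    | hadd a b ha hb => rw [mul_add, add_mul, map_add, map_add, ha, hb]
    | hsmul r a ha => rw [mul_smul_comm, smul_mul_assoc, map_smul, map_smul, ha]
  induction hx using Submodule.span_induction with
  | mem x hx => obtain ⟨a, b, rfl⟩ := hx; rw [map_sub, key, sub_self]
  | zero => exact map_zero f
  | add x y _ _ hx hy => rw [map_add, hx, hy, add_zero]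
  | smul r x _ hx => rw [map_smul, hx, smul_zero]

theorem cyclic_of_rotate {M : Type*} (f : List (Fin 2) → M)
    (hf : ∀ i l, f (i :: l) = f (l ++ [i])) (l m : List (Fin 2)) : f (l ++ m) = f (m ++ l) := by
  induction l generalizing m with
  | nil => simp
  | cons i l ih =>
    rw [List.cons_append, hf, List.append_assoc, ih, List.append_assoc]
    rfl

/-- An occurrence contributes the rest of the word read cyclically from that place, and this does
not see where the cyclic word is cut. -/
theorem wordDeriv_rotate (i a : Fin 2) (l : List (Fin 2)) :
    (wordDeriv i (a :: l) : NC R) = wordDeriv i (l ++ [a]) := by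
  have h1 : (wordDeriv i (a :: l) : NC R) = (∑ k ∈ Finset.range l.length,
      if l[k]? = some i then word (l.drop (k + 1) ++ a :: l.take k) else 0) +
      if a = i then word l else 0 := by
    simp [wordDeriv, Finset.sum_range_succ']
  have h2 : (wordDeriv i (l ++ [a]) : NC R) = (∑ k ∈ Finset.range l.length,
      if l[k]? = some i then word (l.drop (k + 1) ++ a :: l.take k) else 0) +
      if a = i then word l else 0 := by
    rw [wordDeriv, List.length_append, List.length_singleton, Finset.sum_range_succ]
    congr 1
    · refine Finset.sum_congr rfl fun k hk => ?_
      have hk := Finset.mem_range.1 hk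
      rw [List.getElem?_append_left hk, List.drop_append_of_le_length (by omega),
        List.take_append_of_le_length (by omega)]
      simp
    · simp
  rw [h1, h2]

theorem ncDeriv_eq_zero_of_mem_commutators (i : Fin 2) {x : NC R} (hx : x ∈ commutators R) :
    ncDeriv i x = 0 :=
  apply_eq_zero_of_mem_commutators _ (fun l m => by
    rw [ncDeriv_word, ncDeriv_word]
    exact cyclic_of_rotate (wordDeriv i) (wordDeriv_rotate i) l m) hx

/-- The sum of the commutators of the generators with the corresponding partial derivatives
vanishes. -/
theorem sum_generator_commutator_ncDeriv (a : NC R) :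
    U * dU a - dU a * U + (V * dV a - dV a * V) = 0 := by
  induction a using word_induction with
  | hw l =>
    have h : ∀ i : Fin 2, ι R i * (wordDeriv i l : NC R) - wordDeriv i l * ι R i =
        ∑ k ∈ Finset.range l.length, if l[k]? = some i then
          (word (l.drop k ++ l.take k) - word (l.drop (k + 1) ++ l.take (k + 1)) : NC R)
          else 0 := by
      intro i
      rw [wordDeriv, Finset.mul_sum, Finset.sum_mul, ← Finset.sum_sub_distrib]
      refine Finset.sum_congr rfl fun k hk => ?_
      have hk := Finset.mem_range.1 hk
      split_ifs with hi
      · have hi' : l[k] = i := by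
          rw [List.getElem?_eq_getElem hk] at hi
          exact Option.some.inj hi
        rw [List.drop_eq_getElem_cons hk, ← List.take_concat_get' l k hk, hi']
        simp [word_append, word_cons, mul_assoc]
      · simp
    rw [dU, dV, ncDeriv_word, ncDeriv_word]
    change ι R 0 * _ - _ * ι R 0 + (ι R 1 * _ - _ * ι R 1) = _
    rw [h, h, ← Finset.sum_add_distrib]
    -- Each letter is u or v, so the two conditional sums merge into a full telescoping sum of
    -- consecutive rotations of the word; both ends are the word itself.
    have h2 : ∀ k ∈ Finset.range l.length,
        ((if l[k]? = some 0 then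
          (word (l.drop k ++ l.take k) - word (l.drop (k + 1) ++ l.take (k + 1)) : NC R)
          else 0) + if l[k]? = some 1 then
          (word (l.drop k ++ l.take k) - word (l.drop (k + 1) ++ l.take (k + 1)) : NC R)
          else 0) =
        word (l.drop k ++ l.take k) - word (l.drop (k + 1) ++ l.take (k + 1)) := by
      intro k hk
      rw [List.getElem?_eq_getElem (Finset.mem_range.1 hk)]
      generalize l[k]'_ = t
      fin_cases t <;> simp
    rw [Finset.sum_congr rfl h2,
      Finset.sum_range_sub' (fun k => (word (l.drop k ++ l.take k) : NC R))]
    simp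
  | h0 => simp
  | hadd a b ha hb =>
    have h : U * dU a - dU a * U + (V * dV a - dV a * V) +
        (U * dU b - dU b * U + (V * dV b - dV b * V)) = 0 := by rw [ha, hb, add_zero]
    rw [map_add, map_add, ← h]
    noncomm_ring
  | hsmul r a ha =>
    rw [map_smul, map_smul, ← smul_zero r, ← ha]
    simp [smul_sub, smul_add]

end Words

/-! ### Derivations, the chain rule and criteria for vanishing brackets -/

section Derivations

variable {R : Type*} [CommRing R]

/-- The value on a word of the derivation that sends the generators to the entries of `X`. -/
def wordSubst (X : Fin 2 → NC R) : List (Fin 2) → NC R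
  | [] => 0
  | i :: l => X i * word l + ι R i * wordSubst X l

/-- The derivation of the free algebra that sends the generators to the entries of `X`. -/
noncomputable def derivation (X : Fin 2 → NC R) : NC R →ₗ[R] NC R :=
  wordLin (wordSubst X)

theorem wordSubst_append (X : Fin 2 → NC R) (l m : List (Fin 2)) :
    wordSubst X (l ++ m) = wordSubst X l * word m + word l * wordSubst X m := by
  induction l with
  | nil => simp [wordSubst]
  | cons i l ih =>
    simp only [List.cons_append, wordSubst, ih, word_append, word_cons]
    noncomm_ring

theorem derivation_mul (X : Fin 2 → NC R) (a b : NC R) :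
    derivation X (a * b) = derivation X a * b + a * derivation X b := by
  induction a using word_induction with
  | hw l =>
    induction b using word_induction with
    | hw m => simp [derivation, ← word_append, wordSubst_append]
    | h0 => simp
    | hadd a b ha hb => simp only [mul_add, map_add, ha, hb]; abel
    | hsmul r a ha => simp only [mul_smul_comm, map_smul, ha, smul_add]
  | h0 => simp
  | hadd a b ha hb => simp only [add_mul, map_add, ha, hb]; abel
  | hsmul r a ha => simp only [smul_mul_assoc, map_smul, ha, smul_add]

theorem derivation_U (X : Fin 2 → NC R) : derivation X U = X 0 := by
  have h : (U : NC R) = word [0] := by simp [word, U]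
  rw [h, derivation, wordLin_word]
  simp [wordSubst]

theorem derivation_V (X : Fin 2 → NC R) : derivation X V = X 1 := by
  have h : (V : NC R) = word [1] := by simp [word, V]
  rw [h, derivation, wordLin_word]
  simp [wordSubst]

theorem trace_eq_trace_iff {a b : NC R} : trace a = trace b ↔ a - b ∈ commutators R :=
  Submodule.Quotient.eq _

theorem trace_mul_comm (a b : NC R) : trace (a * b) = trace (b * a) :=
  trace_eq_trace_iff.2 (commutator_mem a b)

theorem trace_add (a b : NC R) : trace (a + b) = trace a + trace b := map_add _ _ _

theorem trace_sub (a b : NC R) : trace (a - b) = trace a - trace b := map_sub _ _ _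

theorem trace_neg (a : NC R) : trace (-a) = -trace a := map_neg _ _

theorem trace_zero : trace (0 : NC R) = 0 := map_zero _

theorem trace_smul (r : R) (a : NC R) : trace (r • a) = r • trace a := map_smul _ _ _

theorem trace_sum {κ : Type*} (s : Finset κ) (f : κ → NC R) :
    trace (∑ k ∈ s, f k) = ∑ k ∈ s, trace (f k) := map_sum (commutators R).mkQ _ _

theorem wordSubst_eq_sum (X : Fin 2 → NC R) (l : List (Fin 2)) :
    wordSubst X l = ∑ k ∈ Finset.range l.length,
      word (l.take k) * X (l[k]?.getD 0) * word (l.drop (k + 1)) := by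
  induction l with
  | nil => simp [wordSubst]
  | cons i l ih =>
    rw [wordSubst, List.length_cons, Finset.sum_range_succ', add_comm, ih, Finset.mul_sum]
    simp [word_cons, mul_assoc]

/-- The chain rule: the trace of a derivation is computed by the partial derivatives. -/
theorem trace_derivation (X : Fin 2 → NC R) (a : NC R) :
    trace (derivation X a) = trace (dU a * X 0 + dV a * X 1) := by
  induction a using word_induction with
  | hw l =>
    rw [derivation, wordLin_word, dU, dV, ncDeriv_word, ncDeriv_word, wordSubst_eq_sum, wordDeriv,
      wordDeriv, Finset.sum_mul, Finset.sum_mul, ← Finset.sum_add_distrib, trace_sum, trace_sum]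
    refine Finset.sum_congr rfl fun k hk => ?_
    rw [List.getElem?_eq_getElem (Finset.mem_range.1 hk)]
    generalize l[k]'_ = t
    have h : ∀ Y : NC R, trace (word (l.take k) * Y * word (l.drop (k + 1))) =
        trace (word (l.drop (k + 1) ++ l.take k) * Y) := fun Y => by
      rw [trace_mul_comm, ← mul_assoc, word_append]
    fin_cases t <;> simp [h]
  | h0 => simp
  | hadd a b ha hb =>
    rw [map_add, trace_add, ha, hb, ← trace_add, map_add, map_add]
    congr 1
    noncomm_ring
  | hsmul r a ha =>
    rw [map_smul, trace_smul, ha, ← trace_smul, map_smul, map_smul]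
    simp

/-- The bracket is minus the trace of the Hamiltonian derivation. -/
theorem bracket_eq_neg_trace_derivation (a b : NC R) :
    bracket a b = -trace (derivation ![dV a, -dU a] b) := by
  rw [trace_derivation, bracket, ← trace_neg]
  simp only [Matrix.cons_val_zero, Matrix.cons_val_one, trace_add, trace_sub, trace_neg, mul_neg,
    neg_add, trace_mul_comm (dU b), trace_mul_comm (dV b)]
  abel

theorem bracket_congr_left {a a' : NC R} (h : trace a = trace a') (b : NC R) :
    bracket a b = bracket a' b := by
  have h0 := ncDeriv_eq_zero_of_mem_commutators 0 (trace_eq_trace_iff.1 h)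
  have h1 := ncDeriv_eq_zero_of_mem_commutators 1 (trace_eq_trace_iff.1 h)
  rw [map_sub, sub_eq_zero] at h0 h1
  simp only [bracket, dU, dV, h0, h1]

theorem bracket_add_left (a b c : NC R) : bracket (a + b) c = bracket a c + bracket b c := by
  simp only [bracket, map_add, ← trace_add]
  congr 1
  noncomm_ring

theorem bracket_smul_left (r : R) (a c : NC R) : bracket (r • a) c = r • bracket a c := by
  simp only [bracket, map_smul, ← trace_smul, smul_mul_assoc, smul_sub]

/-- A Lax equation for `w` makes the trace of `w ^ 2` a conserved quantity. -/
theorem bracket_sq_eq_zero_of_lax (a w n : NC R)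
    (h : derivation ![dV a, -dU a] w = w * n - n * w) : bracket a (w ^ 2) = 0 := by
  rw [bracket_eq_neg_trace_derivation, pow_two, derivation_mul, h, neg_eq_zero,
    ← trace_zero, trace_eq_trace_iff]
  convert commutator_mem (w * w) n using 1
  noncomm_ring

/-- An element whose partial derivatives are the commutators of `c` with the generators
Poisson commutes with everything. -/
theorem bracket_eq_zero_of_ncDeriv_eq_commutator (a b c : NC R) (hU : dU a = c * V - V * c)
    (hV : dV a = U * c - c * U) : bracket a b = 0 := by
  rw [bracket, ← trace_zero, trace_eq_trace_iff, hU, hV]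
  have h := sum_generator_commutator_ncDeriv b
  -- The remainder after splitting off two commutators is c times the expression of
  -- `sum_generator_commutator_ncDeriv`, which is zero.
  have h2 : (c * V - V * c) * dV b - (U * c - c * U) * dU b - 0 =
      (c * dV b * V - V * (c * dV b)) + (c * dU b * U - U * (c * dU b)) +
      c * (U * dU b - dU b * U + (V * dV b - dV b * V)) := by noncomm_ring
  rw [h2, h, mul_zero, add_zero]
  exact add_mem (commutator_mem _ _) (commutator_mem _ _)

end Derivations

/-! ### The Lax equation for Hamiltonians quadratic in v -/

section Lax

variable {R : Type*} [CommRing R]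

theorem dU_word (l : List (Fin 2)) : dU (word l : NC R) = wordDeriv 0 l := ncDeriv_word 0 l

theorem dV_word (l : List (Fin 2)) : dV (word l : NC R) = wordDeriv 1 l := ncDeriv_word 1 l

theorem U_eq_word : (U : NC R) = word [0] := by simp [word, U]

theorem V_eq_word : (V : NC R) = word [1] := by simp [word, V]

/-- The Lax operator of the Hamiltonians that are quadratic in `v`. -/
def lax (a b e q₂ q₁ q₀ κ : R) : NC R :=
  a • (U * U * V * U * V) + b • (U * V * U * V) + e • (V * U * V) + q₂ • (U * U * V) +
    q₁ • (U * V) + q₀ • V + κ • U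

theorem dV_lax (a b e q₂ q₁ q₀ κ : R) : dV (lax a b e q₂ q₁ q₀ κ) =
    a • (U * V * U * U + U * U * V * U) + (2 * b) • (U * V * U) + e • (U * V + V * U) +
      q₂ • (U * U) + q₁ • U + q₀ • 1 := by
  simp only [lax, U_eq_word, V_eq_word, ← word_append, map_add, map_smul, dV_word, List.cons_append,
    List.nil_append]
  simp [wordDeriv, Finset.sum_range_succ]
  module

theorem dU_lax (a b e q₂ q₁ q₀ κ : R) : dU (lax a b e q₂ q₁ q₀ κ) =
    a • (U * V * U * V + V * U * V * U + V * U * U * V) + (2 * b) • (V * U * V) + e • (V * V) +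
      q₂ • (U * V + V * U) + q₁ • V + κ • 1 := by
  simp only [lax, U_eq_word, V_eq_word, ← word_append, map_add, map_smul, dU_word, List.cons_append,
    List.nil_append]
  simp [wordDeriv, Finset.sum_range_succ]
  module

/-- The element `lax` is at once Hamiltonian and Lax operator. Only the terms a, b, q₂, with at
least two letters u, enter the second Lax matrix n; each contributes its cyclic derivative in v with
certain words left out. -/
theorem bracket_lax_sq (a b e q₂ q₁ q₀ κ : R) :
    bracket (lax a b e q₂ q₁ q₀ κ) (lax a b e q₂ q₁ q₀ κ ^ 2) = 0 := by
  refine bracket_sq_eq_zero_of_lax _ _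
    (-(a • (U * U * V + U * V * U) + b • (U * V) + q₂ • U)) ?_
  rw [dV_lax, dU_lax]
  simp only [lax, map_add, map_smul, derivation_mul, derivation_U, derivation_V,
    Matrix.cons_val_zero, Matrix.cons_val_one, mul_add, add_mul, smul_mul_assoc, mul_smul_comm,
    mul_assoc, mul_neg, neg_mul, mul_one, one_mul, smul_add, smul_neg]
  module

end Lax

/-! ### The listed systems and the role of β and γ -/

section Existence

variable {R : Type*} [CommRing R] [Algebra ℂ R]

theorem complex_smul_eq (r : ℂ) (a : NC R) : r • a = algebraMap ℂ R r • a :=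
  (algebraMap_smul R r a).symm

theorem two_mul_eq_smul (a : NC R) : 2 * a = (2 : R) • a := by
  rw [two_mul, two_smul]

theorem four_mul_eq_smul (a : NC R) : 4 * a = (4 : R) • a := by
  have h : (4 : NC R) = algebraMap R (NC R) 4 := (map_ofNat _ 4).symm
  rw [h, Algebra.smul_def]

theorem six_mul_eq_smul (a : NC R) : 6 * a = (6 : R) • a := by
  have h : (6 : NC R) = algebraMap R (NC R) 6 := (map_ofNat _ 6).symm
  rw [h, Algebra.smul_def]

theorem complex_algebraMap_eq (r : ℂ) : algebraMap ℂ (NC R) r = algebraMap ℂ R r • 1 := by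
  rw [Algebra.algebraMap_eq_smul_one, complex_smul_eq]

theorem algebraMap_eq_smul (r : R) : algebraMap R (NC R) r = r • 1 :=
  Algebra.algebraMap_eq_smul_one r

theorem complex_smul_coeff (r : ℂ) (z : R) : r • z = algebraMap ℂ R r * z :=
  Algebra.smul_def _ _

theorem half_mul_two : algebraMap ℂ R (1 / 2) * 2 = 1 := by
  rw [← map_ofNat (algebraMap ℂ R) 2, ← map_mul]
  norm_num

/-- The partial derivatives of the ansatzes with `α = 0` are the listed right-hand sides. -/
theorem dV_ham (k : PType) (c : Consts) (z : R) (hα : k = .P5 ∨ k = .P6 → c.α = 0) :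
    dV (ham k c z) = listU k c z := by
  cases k
  case P5 =>
    have h0 := hα (by simp)
    simp only [ham, h0, listU, comm, complex_smul_eq, two_mul_eq_smul, four_mul_eq_smul, neg_mul,
      complex_algebraMap_eq, pow_succ, pow_zero, one_mul, U_eq_word, V_eq_word, ← word_append,
      map_add, map_sub, map_neg, map_smul, dV_word, List.cons_append, List.nil_append, map_ofNat,
      map_one, map_zero, zero_smul, mul_sub, sub_mul]
    simp [wordDeriv, Finset.sum_range_succ]
    module
  case P6 =>
    have h0 := hα (by simp)
    simp only [ham, h0, listU, comm, complex_smul_eq, two_mul_eq_smul, four_mul_eq_smul, neg_mul,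
      complex_algebraMap_eq, pow_succ, pow_zero, one_mul, U_eq_word, V_eq_word, ← word_append,
      map_add, map_sub, map_neg, map_smul, dV_word, List.cons_append, List.nil_append, map_ofNat,
      map_one, map_zero, zero_smul, mul_sub, sub_mul]
    simp [wordDeriv, Finset.sum_range_succ]
    module
  all_goals
    have hh := half_mul_two (R := R)
    simp only [ham, listU, comm, complex_smul_eq, two_mul_eq_smul, four_mul_eq_smul, neg_mul,
      complex_algebraMap_eq, algebraMap_eq_smul, complex_smul_coeff,
      pow_succ, pow_zero, one_mul, U_eq_word, V_eq_word, ← word_append,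
      map_add, map_sub, map_neg, map_smul, dV_word, List.cons_append, List.nil_append, map_ofNat,
      map_one, map_zero, zero_smul, mul_sub, sub_mul]
    generalize algebraMap ℂ R (1 / 2) = t at *
    simp [wordDeriv, Finset.sum_range_succ]
  case P1 => linear_combination (norm := module) hh • (word [1] : NC R)
  case P2 => linear_combination (norm := module) hh • (word [1] : NC R)
  all_goals module

theorem neg_dU_ham (k : PType) (c : Consts) (z : R) (hα : k = .P5 ∨ k = .P6 → c.α = 0) :
    -dU (ham k c z) = listV k c z := by
  cases k
  case P5 =>
    have h0 := hα (by simp)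
    simp only [ham, h0, listV, comm, complex_smul_eq, two_mul_eq_smul, four_mul_eq_smul, neg_mul,
      complex_algebraMap_eq, pow_succ, pow_zero, one_mul, U_eq_word, V_eq_word, ← word_append,
      map_add, map_sub, map_neg, map_smul, dU_word, List.cons_append, List.nil_append, map_ofNat,
      map_one, map_zero, zero_smul, mul_sub, sub_mul]
    simp [wordDeriv, Finset.sum_range_succ]
    module
  case P6 =>
    have h0 := hα (by simp)
    simp only [ham, h0, listV, comm, complex_smul_eq, two_mul_eq_smul, four_mul_eq_smul, neg_mul,
      complex_algebraMap_eq, pow_succ, pow_zero, one_mul, U_eq_word, V_eq_word, ← word_append,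
      map_add, map_sub, map_neg, map_smul, dU_word, List.cons_append, List.nil_append, map_ofNat,
      map_one, map_zero, zero_smul, mul_sub, sub_mul]
    simp [wordDeriv, Finset.sum_range_succ]
    module
  all_goals
    simp only [ham, listV, comm, complex_smul_eq, two_mul_eq_smul, six_mul_eq_smul, neg_mul,
      complex_algebraMap_eq, algebraMap_eq_smul, complex_smul_coeff,
      pow_succ, pow_zero, one_mul, U_eq_word, V_eq_word, ← word_append,
      map_add, map_sub, map_neg, map_smul, dU_word, List.cons_append, List.nil_append, map_ofNat,
      map_one, map_zero, zero_smul, mul_sub, sub_mul]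
    generalize algebraMap ℂ R (1 / 2) = t at *
    simp [wordDeriv, Finset.sum_range_succ]
    module

/-- In every ansatz β and γ multiply u²v² - uvuv, and cyclicity gives trace [u,v]² = 2 trace (uvuv -
u²v²). -/
theorem trace_ham_eq (k : PType) (c : Consts) (z : R) :
    trace (ham k c z) = trace (ham k { c with β := 0, γ := 0 } z) -
      (1 / 2 : ℂ) • extra k c z • trace (comm U V ^ 2) := by
  have hh := half_mul_two (R := R)
  have hc : trace (comm U V ^ 2 : NC R) =
      trace ((2 : R) • (U * V * U * V) - (2 : R) • (U * U * V * V)) := by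
    rw [trace_eq_trace_iff]
    have h : (comm U V ^ 2 : NC R) - ((2 : R) • (U * V * U * V) - (2 : R) • (U * U * V * V)) =
        (V * (U * V * U) - U * V * U * V) + ((U * U * V) * V - V * (U * U * V)) +
        (U * (U * V * V) - (U * V * V) * U) := by
      simp only [comm, two_smul]
      noncomm_ring
    rw [h]
    exact add_mem (add_mem (commutator_mem _ _) (commutator_mem _ _)) (commutator_mem _ _)
  have hs : ∀ y : NC R ⧸ commutators R, (1 / 2 : ℂ) • y = algebraMap ℂ R (1 / 2) • y :=
    fun y => (algebraMap_smul R _ y).symm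
  rw [hc, hs, ← trace_smul, ← trace_smul, ← trace_sub]
  congr 1
  generalize algebraMap ℂ R (1 / 2) = t at *
  cases k <;>
    simp only [ham, extra, complex_smul_eq, map_add, map_sub, map_zero, map_one, zero_smul,
      smul_zero, sub_zero, smul_sub, smul_smul, pow_two, mul_assoc, map_ofNat]
  case P1 | P2 | P4 => module
  case P3' =>
    linear_combination (norm := module) (hh * algebraMap ℂ R c.β) • (U * (V * (U * V)) - U * (U * (V * V)) : NC R)
  case P5 =>
    linear_combination (norm := module) (hh * algebraMap ℂ R c.β) • (U * (V * (U * V)) - U * (U * (V * V)) : NC R)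
  case P6 =>
    linear_combination (norm := module) (hh * (algebraMap ℂ R c.β + z * algebraMap ℂ R c.γ)) • (U * (V * (U * V)) - U * (U * (V * V)) : NC R)

end Existence

/-! ### Construction of second polynomials -/

section Second

variable {R : Type*} [CommRing R]

/-- The Poisson square of the moment map is a Casimir element. -/
theorem bracket_casimir (b : NC R) : bracket (U * U * V * V - U * V * U * V) b = 0 := by
  refine bracket_eq_zero_of_ncDeriv_eq_commutator _ _ (comm U V) ?_ ?_
  · simp only [comm, U_eq_word, V_eq_word, ← word_append, map_sub, dU_word, List.cons_append,
      List.nil_append, mul_sub, sub_mul]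
    simp [wordDeriv, Finset.sum_range_succ]
    abel
  · simp only [comm, U_eq_word, V_eq_word, ← word_append, map_sub, dV_word, List.cons_append,
      List.nil_append, mul_sub, sub_mul]
    simp [wordDeriv, Finset.sum_range_succ]
    abel

/-- The g-term is a Casimir. The e-term is a commutator, and replaces uv², as written in the
ansatzes, by vuv, as the Lax equation requires. -/
theorem bracket_eq_zero_of_trace_eq_lax {h : NC R} (a b e g q₂ q₁ q₀ κ : R)
    (hh : h = lax a b e q₂ q₁ q₀ κ + (g • (U * U * V * V - U * V * U * V) +
      e • (U * V * V - V * U * V))) :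
    bracket h (lax a b e q₂ q₁ q₀ κ ^ 2) = 0 := by
  have ht : trace h = trace (lax a b e q₂ q₁ q₀ κ + g • (U * U * V * V - U * V * U * V)) := by
    rw [trace_eq_trace_iff, hh]
    have h1 : lax a b e q₂ q₁ q₀ κ + (g • (U * U * V * V - U * V * U * V) +
        e • (U * V * V - V * U * V)) - (lax a b e q₂ q₁ q₀ κ +
        g • (U * U * V * V - U * V * U * V)) = e • (U * V * V - V * (U * V) : NC R) := by
      rw [mul_assoc V]; abel
    rw [h1]
    exact Submodule.smul_mem _ _ (commutator_mem _ _)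
  rw [bracket_congr_left ht, bracket_add_left, bracket_smul_left, bracket_lax_sq, bracket_casimir,
    smul_zero, add_zero]

theorem scalarReduction_U : scalarReduction (U : NC R) = MvPolynomial.X 0 := by
  simp [scalarReduction, U]

theorem scalarReduction_V : scalarReduction (V : NC R) = MvPolynomial.X 1 := by
  simp [scalarReduction, V]

variable [Algebra ℂ R]

theorem complex_smul_eq_C_mul (r : ℂ) (p : MvPolynomial (Fin 2) R) :
    r • p = MvPolynomial.C (algebraMap ℂ R r) * p := by
  rw [← MvPolynomial.smul_eq_C_mul, algebraMap_smul]

theorem scalarReduction_ham (k : PType) (c : Consts) (z : R) :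
    scalarReduction (ham k c z) = scalarHam k c z := by
  cases k <;>
    simp only [ham, scalarHam, complex_smul_eq, complex_smul_eq_C_mul, map_add, map_sub, map_neg,
      map_smul, map_mul, map_pow, map_ofNat, map_one, scalarReduction_U, scalarReduction_V,
      MvPolynomial.smul_eq_C_mul] <;>
    ring

theorem hasSecond_of_eq_lax {k : PType} {c : Consts} {z : R} (a b e g q₂ q₁ q₀ κ : R)
    (hh : ham k c z = lax a b e q₂ q₁ q₀ κ + (g • (U * U * V * V - U * V * U * V) +
      e • (U * V * V - V * U * V))) : HasSecond k c z := by
  refine ⟨_, scalarReduction_ham k c z, ?_, bracket_eq_zero_of_trace_eq_lax a b e g q₂ q₁ q₀ κ hh⟩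
  rw [map_pow, ← scalarReduction_ham, hh]
  congr 1
  simp only [map_add, map_sub, map_smul, map_mul, scalarReduction_U, scalarReduction_V,
    MvPolynomial.smul_eq_C_mul]
  ring

/-- Put y = [u,v] and let D be the Hamiltonian derivation. Then Dy = 0, DH = [u,y] and 2[H,u] = -(vy
+ yv). Hence trace D(H²) = 2 trace H[u,y] = 2 trace [H,u]y = -2 trace vy², which D(2uy²) compensates
because Du = v. The correction is invisible in the scalar reduction. -/
theorem hasSecond_P1 (c : Consts) (z : R) : HasSecond .P1 c z := by
  refine ⟨ham .P1 c z ^ 2 + 2 * (U * comm U V ^ 2), scalarReduction_ham _ c z, ?_, ?_⟩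
  · simp [comm, scalarReduction_ham, mul_comm (scalarReduction U)]
  · have hV : dV (ham .P1 c z) = V := by
      rw [dV_ham _ _ _ (by simp)]; rfl
    have hU : -dU (ham .P1 c z) = (6 : R) • (U * U) + z • 1 := by
      rw [neg_dU_ham _ _ _ (by simp)]
      simp [listV, six_mul_eq_smul, Algebra.algebraMap_eq_smul_one, pow_two]
    have hh := half_mul_two (R := R)
    have hH : ham .P1 c z = -((2 : R) • (U * U * U)) + algebraMap ℂ R (1 / 2) • (V * V) - z • U := by
      simp only [ham, neg_mul, two_mul_eq_smul, complex_smul_eq, pow_succ, pow_zero, one_mul]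
    rw [bracket_eq_neg_trace_derivation, hV, hU]
    set d := derivation (R := R) ![V, (6 : R) • (U * U) + z • 1] with hd
    have dU' : d U = V := derivation_U _
    have dV' : d V = (6 : R) • (U * U) + z • 1 := derivation_V _
    have dmul : ∀ a b, d (a * b) = d a * b + a * d b := derivation_mul _
    have d1 : d (ham .P1 c z) = U * comm U V - comm U V * U := by
      rw [hH]
      generalize algebraMap ℂ R (1 / 2) = t at *
      simp only [comm, map_add, map_sub, map_neg, map_smul, dmul, dU', dV', mul_add, add_mul,
        smul_mul_assoc, mul_smul_comm, mul_assoc, mul_sub, sub_mul, mul_one, one_mul]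
      linear_combination (norm := module)
        hh • ((3 : R) • (V * (U * U)) + (3 : R) • (U * (U * V)) + z • V : NC R)
    have d2 : d (comm U V) = 0 := by
      simp only [comm, map_sub, dmul, dU', dV', mul_add, add_mul, smul_mul_assoc, mul_smul_comm,
        mul_assoc, mul_one, one_mul]
      abel
    have hc : ham .P1 c z * U - U * ham .P1 c z = -(algebraMap ℂ R (1 / 2) •
        (V * comm U V + comm U V * V)) := by
      rw [hH]
      generalize algebraMap ℂ R (1 / 2) = t at *
      simp only [comm, mul_add, add_mul, smul_mul_assoc, mul_smul_comm, mul_assoc, mul_sub, sub_mul,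
        neg_mul, mul_neg]
      module
    have h2 : (2 : R) • (ham .P1 c z * U - U * ham .P1 c z) =
        -(V * comm U V + comm U V * V) := by
      rw [hc, smul_neg, smul_smul, mul_comm, hh, one_smul]
    rw [neg_eq_zero, ← trace_zero, trace_eq_trace_iff, sub_zero, map_add, pow_two, dmul, d1,
      two_mul, map_add, dmul, pow_two, dmul, d2, dU']
    generalize ham .P1 c z = H at *
    generalize (comm U V : NC R) = y at *
    -- Here the trace computation is made explicit: the derivative of the second polynomial is
    -- written as a sum of commutators.
    have h3 : (U * y - y * U) * H + H * (U * y - y * U) +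
        (V * (y * y) + U * (0 * y + y * 0) + (V * (y * y) + U * (0 * y + y * 0))) =
        ((U * y - y * U) * H - H * (U * y - y * U)) +
        (2 : R) • (U * (H * y) - (H * y) * U) + (V * y * y - y * (V * y)) := by
      have h4 : (2 : R) • (H * (U * y)) = -(V * y + y * V) * y + (2 : R) • (U * (H * y)) := by
        rw [← h2, sub_eq_add_neg]
        simp only [add_mul, smul_mul_assoc, neg_mul, mul_assoc, smul_add, smul_neg]
        abel
      simp only [two_smul] at h4 ⊢
      have h5 : H * (U * y) + H * (U * y) = -(V * y + y * V) * y +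
        (U * (H * y) + U * (H * y)) := h4
      simp only [zero_mul, mul_zero, add_zero]
      have h6 : (U * y - y * U) * H + H * (U * y - y * U) + (V * (y * y) + V * (y * y)) =
        (U * y - y * U) * H - H * (U * y - y * U) + (H * (U * y) + H * (U * y)) -
        (H * y * U + H * y * U) + (V * (y * y) + V * (y * y)) := by noncomm_ring
      rw [h6, h5]
      noncomm_ring
    rw [h3]
    exact add_mem (add_mem (commutator_mem _ _) (Submodule.smul_mem _ _ (commutator_mem _ _)))
      (commutator_mem _ _)

theorem hasSecond_P2 (c : Consts) (z : R) : HasSecond .P2 c z := by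
  refine ⟨ham .P2 c z ^ 2, scalarReduction_ham _ c z, by rw [map_pow, scalarReduction_ham], ?_⟩
  refine bracket_sq_eq_zero_of_lax _ _ U ?_
  have hh := half_mul_two (R := R)
  rw [dV_ham _ _ _ (by simp), neg_dU_ham _ _ _ (by simp)]
  simp only [listU, listV, ham, complex_smul_eq, complex_algebraMap_eq, algebraMap_eq_smul,
    complex_smul_coeff]
  generalize algebraMap ℂ R (1 / 2) = t at *
  simp only [map_add, map_sub, map_neg, map_smul, derivation_mul, derivation_U, derivation_V,
    Matrix.cons_val_zero, Matrix.cons_val_one, mul_add, add_mul, smul_mul_assoc, mul_smul_comm,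
    mul_assoc, mul_neg, neg_mul, mul_one, one_mul, smul_add, smul_neg, pow_two, mul_sub, sub_mul]
  match_scalars <;> first
    | ring1
    | linear_combination hh
    | linear_combination (algebraMap ℂ R c.κ₃) * hh

/-- The witnesses are read off from the ansatz: e is the coefficient of uv², g that of u²v², and b
is the sum of the coefficients of u²v² and uvuv, so that β and γ occur in g only. -/
theorem hasSecond_of_α (k : PType) (c : Consts) (z : R) (hα : k = .P5 ∨ k = .P6 → c.α = 0) :
    HasSecond k c z := by
  cases k
  case P1 => exact hasSecond_P1 c z
  case P2 => exact hasSecond_P2 c z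
  case P3' =>
    refine hasSecond_of_eq_lax 0 1 0 (algebraMap ℂ R c.β) (algebraMap ℂ R c.κ₂)
      (algebraMap ℂ R c.κ₁) (z * algebraMap ℂ R c.κ₄) (algebraMap ℂ R c.κ₃) ?_
    simp only [ham, lax, complex_smul_eq, map_sub, map_one, pow_two, mul_assoc]
    module
  case P4 =>
    refine hasSecond_of_eq_lax 0 0 1 0 (-1) (-2 * z) (algebraMap ℂ R c.κ₂)
      (-algebraMap ℂ R c.κ₃) ?_
    simp only [ham, lax, complex_smul_eq, two_mul_eq_smul, pow_two, mul_assoc]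
    module
  case P5 =>
    have h0 := hα (by simp)
    refine hasSecond_of_eq_lax 1 (-2) 1 (algebraMap ℂ R c.β) (-algebraMap ℂ R c.κ₁)
      (algebraMap ℂ R c.κ₁ + algebraMap ℂ R c.κ₂ + z * algebraMap ℂ R c.κ₄)
      (-algebraMap ℂ R c.κ₂) (-algebraMap ℂ R c.κ₃) ?_
    simp only [ham, h0, lax, complex_smul_eq, map_sub, map_add, map_zero, map_one, map_ofNat,
      pow_two, mul_assoc]
    module
  case P6 =>
    have h0 := hα (by simp)
    refine hasSecond_of_eq_lax 1 (-1 - z) z (algebraMap ℂ R c.β + z * algebraMap ℂ R c.γ)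
      (-algebraMap ℂ R c.κ₁) (algebraMap ℂ R c.κ₂ + z * algebraMap ℂ R c.κ₄)
      (z * algebraMap ℂ R (c.κ₁ - c.κ₂ - c.κ₄)) (-algebraMap ℂ R c.κ₃) ?_
    simp only [ham, h0, lax, complex_smul_eq, map_sub, map_add, map_zero, map_one, pow_two,
      mul_assoc]
    module

end Second

/-! ### The bigrading and its compatibility with the bracket -/

section Homogeneous

variable {R : Type*} [CommRing R]

/-- The elements of bidegree `(i, j)` in `u` and `v`. -/
def homog (R : Type*) [CommRing R] (i j : ℕ) : Submodule R (NC R) :=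
  Submodule.span R (word '' {l | l.count 0 = i ∧ l.count 1 = j})

theorem word_mem_homog (l : List (Fin 2)) : (word l : NC R) ∈ homog R (l.count 0) (l.count 1) :=
  Submodule.subset_span ⟨l, ⟨rfl, rfl⟩, rfl⟩

theorem word_mem_homog_of_count {l : List (Fin 2)} {i j : ℕ} (hi : l.count 0 = i)
    (hj : l.count 1 = j) : (word l : NC R) ∈ homog R i j := hi ▸ hj ▸ word_mem_homog l

theorem homog_induction {i j : ℕ} {p : NC R → Prop}
    (hw : ∀ l : List (Fin 2), l.count 0 = i → l.count 1 = j → p (word l)) (h0 : p 0)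
    (hadd : ∀ a b, p a → p b → p (a + b)) (hsmul : ∀ (r : R) a, p a → p (r • a)) {a : NC R}
    (ha : a ∈ homog R i j) : p a := by
  induction ha using Submodule.span_induction with
  | mem x hx => obtain ⟨l, ⟨h1, h2⟩, rfl⟩ := hx; exact hw l h1 h2
  | zero => exact h0
  | add x y _ _ hx hy => exact hadd x y hx hy
  | smul r x _ hx => exact hsmul r x hx

theorem mul_mem_homog {i j i' j' : ℕ} {a b : NC R} (ha : a ∈ homog R i j)
    (hb : b ∈ homog R i' j') : a * b ∈ homog R (i + i') (j + j') := by
  refine homog_induction (p := fun a => a * b ∈ homog R (i + i') (j + j')) ?_ ?_ ?_ ?_ ha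
  · intro l h1 h2
    refine homog_induction (p := fun b => word l * b ∈ homog R (i + i') (j + j')) ?_ ?_ ?_ ?_ hb
    · intro m h3 h4
      rw [← word_append]
      exact word_mem_homog_of_count (by rw [List.count_append, h1, h3])
        (by rw [List.count_append, h2, h4])
    · simp
    · intro a b ha hb; rw [mul_add]; exact add_mem ha hb
    · intro r a ha; rw [mul_smul_comm]; exact Submodule.smul_mem _ _ ha
  · simp
  · intro a b ha hb; rw [add_mul]; exact add_mem ha hb
  · intro r a ha; rw [smul_mul_assoc]; exact Submodule.smul_mem _ _ ha

theorem count_drop_append_take {l : List (Fin 2)} {k : ℕ} {s : Fin 2} (h : l[k]? = some s)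
    (i : Fin 2) : (l.drop (k + 1) ++ l.take k).count i + (if s = i then 1 else 0) = l.count i := by
  obtain ⟨hk, hs⟩ := List.getElem?_eq_some_iff.1 h
  have h1 : l = l.take k ++ s :: l.drop (k + 1) := by
    rw [← hs, ← List.drop_eq_getElem_cons hk, List.take_append_drop]
  conv_rhs => rw [h1]
  rw [List.count_append, List.count_append, List.count_cons]
  simp only [beq_iff_eq]
  omega

theorem dU_mem_homog {i j : ℕ} {a : NC R} (ha : a ∈ homog R i j) : dU a ∈ homog R (i - 1) j := by
  refine homog_induction (p := fun a => dU a ∈ homog R (i - 1) j) ?_ ?_ ?_ ?_ ha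
  · intro l h1 h2
    rw [dU_word, wordDeriv]
    refine sum_mem fun k _ => ?_
    split_ifs with h
    · have h0 := count_drop_append_take h 0
      have h3 := count_drop_append_take h 1
      simp only [if_true, zero_ne_one, if_false] at h0 h3
      exact word_mem_homog_of_count (by omega) (by omega)
    · exact zero_mem _
  · simp
  · intro a b ha hb; rw [map_add]; exact add_mem ha hb
  · intro r a ha; rw [map_smul]; exact Submodule.smul_mem _ _ ha

theorem dV_mem_homog {i j : ℕ} {a : NC R} (ha : a ∈ homog R i j) : dV a ∈ homog R i (j - 1) := by
  refine homog_induction (p := fun a => dV a ∈ homog R i (j - 1)) ?_ ?_ ?_ ?_ ha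
  · intro l h1 h2
    rw [dV_word, wordDeriv]
    refine sum_mem fun k _ => ?_
    split_ifs with h
    · have h0 := count_drop_append_take h 0
      have h3 := count_drop_append_take h 1
      simp only [if_true, one_ne_zero, if_false] at h0 h3
      exact word_mem_homog_of_count (by omega) (by omega)
    · exact zero_mem _
  · simp
  · intro a b ha hb; rw [map_add]; exact add_mem ha hb
  · intro r a ha; rw [map_smul]; exact Submodule.smul_mem _ _ ha

theorem dU_eq_zero_of_homog_zero {j : ℕ} {a : NC R} (ha : a ∈ homog R 0 j) : dU a = 0 := by
  refine homog_induction (p := fun a => dU a = 0) ?_ ?_ ?_ ?_ ha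
  · intro l h1 h2
    rw [dU_word, wordDeriv]
    refine Finset.sum_eq_zero fun k _ => if_neg fun h => ?_
    have h0 := count_drop_append_take h 0
    simp only [if_true] at h0
    omega
  · simp
  · intro a b ha hb; rw [map_add, ha, hb, add_zero]
  · intro r a ha; rw [map_smul, ha, smul_zero]

theorem dV_eq_zero_of_homog_zero {i : ℕ} {a : NC R} (ha : a ∈ homog R i 0) : dV a = 0 := by
  refine homog_induction (p := fun a => dV a = 0) ?_ ?_ ?_ ?_ ha
  · intro l h1 h2
    rw [dV_word, wordDeriv]
    refine Finset.sum_eq_zero fun k _ => if_neg fun h => ?_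
    have h0 := count_drop_append_take h 1
    simp only [if_true] at h0
    omega
  · simp
  · intro a b ha hb; rw [map_add, ha, hb, add_zero]
  · intro r a ha; rw [map_smul, ha, smul_zero]

/-- The projection to the elements of bidegree `(i, j)`. -/
noncomputable def comp (i j : ℕ) : NC R →ₗ[R] NC R :=
  wordLin fun l => if l.count 0 = i ∧ l.count 1 = j then word l else 0

theorem comp_word (i j : ℕ) (l : List (Fin 2)) :
    comp i j (word l : NC R) = if l.count 0 = i ∧ l.count 1 = j then word l else 0 :=
  wordLin_word _ _

theorem comp_mem_homog (i j : ℕ) (a : NC R) : comp i j a ∈ homog R i j := by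
  induction a using word_induction with
  | hw l =>
    rw [comp_word]
    split_ifs with h
    · exact word_mem_homog_of_count h.1 h.2
    · exact zero_mem _
  | h0 => simp
  | hadd a b ha hb => rw [map_add]; exact add_mem ha hb
  | hsmul r a ha => rw [map_smul]; exact Submodule.smul_mem _ _ ha

theorem comp_of_mem_homog {i j : ℕ} {a : NC R} (i' j' : ℕ) (ha : a ∈ homog R i j) :
    comp i' j' a = if i = i' ∧ j = j' then a else 0 := by
  refine homog_induction (p := fun a => comp i' j' a = if i = i' ∧ j = j' then a else 0)
    ?_ ?_ ?_ ?_ ha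
  · rintro l rfl rfl
    exact comp_word i' j' l
  · simp
  · intro a b ha hb; rw [map_add, ha, hb]; split_ifs <;> simp
  · intro r a ha; rw [map_smul, ha]; split_ifs <;> simp

theorem comp_mem_commutators (i j : ℕ) {a : NC R} (ha : a ∈ commutators R) :
    comp i j a ∈ commutators R := by
  have h := apply_eq_zero_of_mem_commutators ((commutators R).mkQ ∘ₗ comp i j) (fun l m => by
    have h1 : (m ++ l).count 0 = (l ++ m).count 0 := by simp [add_comm]
    have h2 : (m ++ l).count 1 = (l ++ m).count 1 := by simp [add_comm]
    rw [LinearMap.comp_apply, LinearMap.comp_apply, comp_word, comp_word, h1, h2]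
    split_ifs
    · rw [word_append, word_append]
      exact trace_mul_comm _ _
    · rfl) ha
  exact (Submodule.Quotient.mk_eq_zero _).1 h

/-- The representative of the bracket in the free algebra. -/
noncomputable def poisson (a : NC R) : NC R →ₗ[R] NC R :=
  LinearMap.mulLeft R (dU a) ∘ₗ dV - LinearMap.mulLeft R (dV a) ∘ₗ dU

theorem poisson_apply (a b : NC R) : poisson a b = dU a * dV b - dV a * dU b := rfl

theorem poisson_add_left (a b c : NC R) : poisson (a + b) c = poisson a c + poisson b c := by
  simp only [poisson_apply, map_add]; noncomm_ring

theorem bracket_eq_zero_iff (a b : NC R) : bracket a b = 0 ↔ poisson a b ∈ commutators R :=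
  Submodule.Quotient.mk_eq_zero _

theorem poisson_mem_homog {p q i j : ℕ} {a b : NC R} (ha : a ∈ homog R p q)
    (hb : b ∈ homog R i j) : poisson a b ∈ homog R (p + i - 1) (q + j - 1) := by
  rw [poisson_apply]
  refine sub_mem ?_ ?_
  · rcases Nat.eq_zero_or_pos p with rfl | hp
    · rw [dU_eq_zero_of_homog_zero ha, zero_mul]; exact zero_mem _
    rcases Nat.eq_zero_or_pos j with rfl | hj
    · rw [dV_eq_zero_of_homog_zero hb, mul_zero]; exact zero_mem _
    have h := mul_mem_homog (dU_mem_homog ha) (dV_mem_homog hb)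
    rwa [show p - 1 + i = p + i - 1 by omega, show q + (j - 1) = q + j - 1 by omega] at h
  · rcases Nat.eq_zero_or_pos q with rfl | hq
    · rw [dV_eq_zero_of_homog_zero ha, zero_mul]; exact zero_mem _
    rcases Nat.eq_zero_or_pos i with rfl | hi
    · rw [dU_eq_zero_of_homog_zero hb, mul_zero]; exact zero_mem _
    have h := mul_mem_homog (dV_mem_homog ha) (dU_mem_homog hb)
    rwa [show p + (i - 1) = p + i - 1 by omega, show q - 1 + j = q + j - 1 by omega] at h

theorem comp_poisson {p q : ℕ} {a : NC R} (ha : a ∈ homog R p q) (I J : ℕ) (hp : p ≤ I + 1)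
    (hq : q ≤ J + 1) (b : NC R) :
    comp I J (poisson a b) = poisson a (comp (I + 1 - p) (J + 1 - q) b) := by
  induction b using word_induction with
  | hw l =>
    have hl := word_mem_homog (R := R) l
    rw [comp_of_mem_homog I J (poisson_mem_homog ha hl), comp_word]
    generalize l.count 0 = i at *
    generalize l.count 1 = j at *
    -- Truncated subtraction gives the wrong degree when no letter u (or, below, no letter v) is
    -- present, but then the bracket vanishes.
    by_cases h0 : p + i = 0
    · obtain ⟨rfl, rfl⟩ : p = 0 ∧ i = 0 := by omega
      have hz : poisson a (word l) = 0 := by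
        rw [poisson_apply, dU_eq_zero_of_homog_zero ha, dU_eq_zero_of_homog_zero hl]; simp
      rw [hz]
      split_ifs <;> simp [hz]
    by_cases h1 : q + j = 0
    · obtain ⟨rfl, rfl⟩ : q = 0 ∧ j = 0 := by omega
      have hz : poisson a (word l) = 0 := by
        rw [poisson_apply, dV_eq_zero_of_homog_zero ha, dV_eq_zero_of_homog_zero hl]; simp
      rw [hz]
      split_ifs <;> simp [hz]
    by_cases h : i = I + 1 - p ∧ j = J + 1 - q
    · rw [if_pos h, if_pos (by omega)]
    · rw [if_neg h, if_neg (by omega), map_zero]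
  | h0 => simp
  | hadd a b ha hb => rw [map_add, map_add, ha, hb, map_add, map_add]
  | hsmul r a ha => rw [map_smul, map_smul, ha, map_smul, map_smul]

/-- Euler's identity. -/
theorem trace_V_mul_dV {i j : ℕ} {a : NC R} (ha : a ∈ homog R i j) :
    trace (V * dV a) = (j : R) • trace a := by
  refine homog_induction (p := fun a => trace (V * dV a) = (j : R) • trace a) ?_ ?_ ?_ ?_ ha
  · rintro l - rfl
    rw [dV_word, wordDeriv, Finset.mul_sum, trace_sum]
    have h : ∀ k ∈ Finset.range l.length, trace (V * if l[k]? = some 1 then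
        (word (l.drop (k + 1) ++ l.take k) : NC R) else 0) =
        (if l[k]? = some 1 then 1 else 0 : R) • trace (word l : NC R) := by
      intro k hk
      have hk := Finset.mem_range.1 hk
      split_ifs with h
      · obtain ⟨hk, hs⟩ := List.getElem?_eq_some_iff.1 h
        rw [one_smul, word_append, ← mul_assoc, trace_mul_comm]
        conv_rhs => rw [← List.take_append_drop k l, List.drop_eq_getElem_cons hk, word_append,
          word_cons, hs]
        rfl
      · rw [mul_zero, zero_smul, trace_zero]
    rw [Finset.sum_congr rfl h, ← Finset.sum_smul]
    congr 1
    clear h ha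
    induction l with
    | nil => simp
    | cons s l ih =>
      rw [List.length_cons, Finset.sum_range_succ']
      simp only [List.getElem?_cons_succ, ih, List.getElem?_cons_zero, List.count_cons,
        Option.some.injEq, Nat.cast_add, beq_iff_eq]
      split_ifs <;> simp
  · simp [trace_zero]
  · intro a b ha hb; rw [map_add, mul_add, trace_add, ha, hb, trace_add, smul_add]
  · intro r a ha; rw [map_smul, mul_smul_comm, trace_smul, ha, trace_smul, smul_comm]

end Homogeneous

/-! ### Words as commutative monomials; evaluation along closed paths -/

section Evaluation

variable {R : Type*} [CommRing R] {L : Type*} [CommRing L] [Algebra R L]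

/-- The value of a word in which `y t` is substituted for `u` after the `t`-th letter `v`. -/
def evWord (y : ℕ → L) : List (Fin 2) → L
  | [] => 1
  | i :: l => if i = 0 then y 0 * evWord y l else evWord (fun t => y (t + 1)) l

/-- The linear extension of `evWord`. -/
noncomputable def ev (R : Type*) [CommRing R] {L : Type*} [CommRing L] [Algebra R L] (y : ℕ → L) :
    NC R →ₗ[R] L := wordLin (evWord y)

@[simp] theorem ev_word (y : ℕ → L) (l : List (Fin 2)) : ev R y (word l) = evWord y l :=
  wordLin_word _ _

theorem evWord_append (y : ℕ → L) (l m : List (Fin 2)) :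
    evWord y (l ++ m) = evWord y l * evWord (fun t => y (t + l.count 1)) m := by
  induction l generalizing y with
  | nil => simp [evWord]
  | cons i l ih =>
    fin_cases i
    · simp [evWord, ih, mul_assoc]
    · simp [evWord, ih, add_assoc]

/-- Concatenation becomes multiplication, except that the second factor starts after the j letters v
of the first. -/
theorem ev_mul (y : ℕ → L) {i j : ℕ} {a : NC R} (ha : a ∈ homog R i j) (b : NC R) :
    ev R y (a * b) = ev R y a * ev R (fun t => y (t + j)) b := by
  refine homog_induction
    (p := fun a => ev R y (a * b) = ev R y a * ev R (fun t => y (t + j)) b) ?_ ?_ ?_ ?_ ha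
  · rintro l - rfl
    induction b using word_induction with
    | hw m => rw [← word_append, ev_word, ev_word, ev_word, evWord_append]
    | h0 => simp
    | hadd a b ha hb => rw [mul_add, map_add, ha, hb, map_add, mul_add]
    | hsmul r a ha => rw [mul_smul_comm, map_smul, ha, map_smul, mul_smul_comm]
  · simp
  · intro a b ha hb; rw [add_mul, map_add, ha, hb, map_add, add_mul]
  · intro r a ha; rw [smul_mul_assoc, map_smul, ha, map_smul, smul_mul_assoc]

theorem evWord_congr {y y' : ℕ → L} (l : List (Fin 2)) (h : ∀ t ≤ l.count 1, y t = y' t) :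
    evWord y l = evWord y' l := by
  induction l generalizing y y' with
  | nil => rfl
  | cons i l ih =>
    fin_cases i
    · simp only [evWord, Fin.zero_eta, if_true]
      rw [h 0 (by simp), ih fun t ht => h t (by simpa using ht)]
    · simp only [evWord, Fin.mk_one, one_ne_zero, if_false]
      exact ih fun t ht => h (t + 1) (by simpa using ht)

theorem ev_congr {y y' : ℕ → L} {i j : ℕ} {a : NC R} (ha : a ∈ homog R i j)
    (h : ∀ t ≤ j, y t = y' t) : ev R y a = ev R y' a := by
  refine homog_induction (p := fun a => ev R y a = ev R y' a) ?_ ?_ ?_ ?_ ha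
  · rintro l - rfl
    rw [ev_word, ev_word, evWord_congr l h]
  · simp
  · intro a b ha hb; rw [map_add, map_add, ha, hb]
  · intro r a ha; rw [map_smul, map_smul, ha]

theorem map_ev {L' : Type*} [CommRing L'] [Algebra R L'] (ψ : L →ₐ[R] L') (y : ℕ → L) (a : NC R) :
    ψ (ev R y a) = ev R (fun t => ψ (y t)) a := by
  induction a using word_induction with
  | hw l =>
    rw [ev_word, ev_word]
    induction l generalizing y with
    | nil => simp [evWord]
    | cons i l ih =>
      simp only [evWord]
      split_ifs
      · rw [map_mul, ih]
      · rw [ih]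
  | h0 => simp
  | hadd a b ha hb => rw [map_add, map_add, ha, hb, map_add]
  | hsmul r a ha => rw [map_smul, map_smul, ha, map_smul]

theorem U_mem_homog : (U : NC R) ∈ homog R 1 0 := by
  rw [U_eq_word]; exact word_mem_homog_of_count rfl rfl

theorem V_mem_homog : (V : NC R) ∈ homog R 0 1 := by
  rw [V_eq_word]; exact word_mem_homog_of_count rfl rfl

theorem ev_U (y : ℕ → L) : ev R y U = y 0 := by simp [U_eq_word, evWord]

theorem ev_V (y : ℕ → L) : ev R y V = 1 := by simp [V_eq_word, evWord]

/-- This evaluates [u, ∂a/∂u] + [v, ∂a/∂v] = 0: a letter u on the left or right gives the first or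
last point, a letter v on the left shifts the points. It expresses ∂a/∂u through ∂a/∂v wherever the
two end points differ. -/
theorem ev_identity (y : ℕ → L) {i j : ℕ} {a : NC R} (ha : a ∈ homog R i (j + 1)) :
    (y 0 - y (j + 1)) * ev R y (dU a) + ev R (fun t => y (t + 1)) (dV a) - ev R y (dV a) = 0 := by
  have h := congrArg (ev R y) (sum_generator_commutator_ncDeriv a)
  rw [map_add, map_sub, map_sub, ev_mul y U_mem_homog, ev_mul y V_mem_homog,
    ev_mul y (dU_mem_homog ha), ev_mul y (dV_mem_homog ha), map_zero, ev_U, ev_U, ev_V, ev_V] at h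
  simp only [zero_add] at h
  change y 0 * ev R y (dU a) - ev R y (dU a) * y (j + 1) +
    (1 * ev R (fun t => y (t + 1)) (dV a) - ev R y (dV a) * 1) = 0 at h
  linear_combination h

theorem ev_dV_rotate {y : ℕ → L} {i j : ℕ} {a : NC R} (ha : a ∈ homog R i (j + 1))
    (hy : y (j + 1) = y 0) : ev R (fun t => y (t + 1)) (dV a) = ev R y (dV a) := by
  have h := ev_identity y ha
  rw [hy] at h
  linear_combination h

theorem sum_range_shift {M : Type*} [AddCommGroup M] (f : ℕ → M) (n : ℕ)
    (hf : ∀ k, f (k + n) = f k) (s : ℕ) :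
    ∑ k ∈ Finset.range n, f (k + s) = ∑ k ∈ Finset.range n, f k := by
  induction s with
  | zero => rfl
  | succ s ih =>
    rw [← ih]
    have h1 := Finset.sum_range_succ (fun k => f (k + s)) n
    rw [Finset.sum_range_succ'] at h1
    have h2 : f (n + s) = f (0 + s) := by rw [add_comm, hf, zero_add]
    rw [h2] at h1
    have h3 := add_right_cancel h1
    rw [← h3]
    exact Finset.sum_congr rfl fun k _ => by rw [add_right_comm, add_assoc]

/-- The trace of the product of a word along a closed path through `n` points. -/
noncomputable def cyclicEv (R : Type*) [CommRing R] {L : Type*} [CommRing L] [Algebra R L]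
    (n : ℕ) (x : ℕ → L) : NC R →ₗ[R] L :=
  wordLin fun l => if l.count 1 = n then
    ∑ k ∈ Finset.range n, evWord (fun t => x (t + k)) l else 0

/-- A rotation of the word only changes the starting point of the closed path, over which the sum is
taken. -/
theorem cyclicEv_of_mem_commutators {n : ℕ} {x : ℕ → L} (hx : ∀ k, x (k + n) = x k) {a : NC R}
    (ha : a ∈ commutators R) : cyclicEv R n x a = 0 := by
  refine apply_eq_zero_of_mem_commutators _ (fun l m => ?_) ha
  rw [cyclicEv, wordLin_word, wordLin_word]
  have h1 : (m ++ l).count 1 = (l ++ m).count 1 := by simp [add_comm]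
  rw [h1]
  split_ifs with h
  · rw [List.count_append] at h
    have h2 := sum_range_shift
      (fun k => evWord (fun t => x (t + k)) (l ++ m)) n (fun k => by
        simp only [← add_assoc, hx]) (m.count 1)
    rw [← h2]
    refine Finset.sum_congr rfl fun k _ => ?_
    rw [evWord_append, evWord_append, mul_comm]
    congr 2
    · funext t
      have h3 : t + l.count 1 + (k + m.count 1) = t + k + n := by omega
      rw [h3, hx]
    · funext t
      congr 1
      omega
  · rfl

theorem cyclicEv_of_mem_homog {i n : ℕ} (x : ℕ → L) {a : NC R} (ha : a ∈ homog R i n) :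
    cyclicEv R n x a = ∑ k ∈ Finset.range n, ev R (fun t => x (t + k)) a := by
  refine homog_induction
    (p := fun a => cyclicEv R n x a = ∑ k ∈ Finset.range n, ev R (fun t => x (t + k)) a)
    ?_ ?_ ?_ ?_ ha
  · rintro l - h
    rw [cyclicEv, wordLin_word, if_pos h]
    simp
  · simp
  · intro a b ha hb; simp only [map_add, ha, hb, Finset.sum_add_distrib]
  · intro r a ha; simp only [map_smul, ha, Finset.smul_sum]

end Evaluation

/-! ### The functional equation for the derivative in v -/

section KeyIdentity

variable {R : Type*} [CommRing R] {L : Type*} [CommRing L] [Algebra R L]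

/-- The component of bidegree `(3, 2)` of the ansatzes of types `P5` and `P6`. -/
def leadHam (α : R) : NC R := α • (U * U * U * V * V) + (1 - α) • (U * U * V * U * V)

theorem leadHam_mem_homog (α : R) : leadHam α ∈ homog R 3 2 := by
  simp only [leadHam, U_eq_word, V_eq_word, ← word_append]
  exact add_mem (Submodule.smul_mem _ _ (word_mem_homog_of_count rfl rfl))
    (Submodule.smul_mem _ _ (word_mem_homog_of_count rfl rfl))

theorem ev_dV_leadHam (α : R) (y : ℕ → L) : ev R y (dV (leadHam α)) =
    (y 0 + y 1) * (y 0 * y 1 + algebraMap R L α * (y 0 - y 1) ^ 2) := by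
  simp only [leadHam, U_eq_word, V_eq_word, ← word_append, map_add, map_smul, dV_word,
    List.cons_append, List.nil_append]
  simp [wordDeriv, Finset.sum_range_succ, evWord, Algebra.smul_def]
  ring

theorem ev_dU_leadHam (α : R) (y : ℕ → L) : ev R y (dU (leadHam α)) =
    algebraMap R L α * (y 0 ^ 2 + y 0 * y 2 + y 2 ^ 2) +
      (1 - algebraMap R L α) * (y 0 * y 1 + y 1 * y 2 + y 1 ^ 2) := by
  simp only [leadHam, U_eq_word, V_eq_word, ← word_append, map_add, map_smul, dU_word,
    List.cons_append, List.nil_append]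
  simp [wordDeriv, Finset.sum_range_succ, evWord, Algebra.smul_def]
  ring

/-- The functional equation satisfied by the derivative of a homogeneous element that commutes
with the leading part of the Hamiltonian. -/
theorem sum_ev_dV_eq_zero (α : R) {i j : ℕ} {a : NC R} (ha : a ∈ homog R i (j + 1))
    (hb : bracket (leadHam α) a = 0) {x κ : ℕ → L} (hx : ∀ k, x (k + (j + 2)) = x k)
    (hκ : ∀ k, κ (k + (j + 2)) = κ k)
    (hκx : ∀ k, κ k * (x k - x (k + 1)) = (x k + x (k + 1)) *
      (x k * x (k + 1) + algebraMap R L α * (x k - x (k + 1)) ^ 2)) :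
    ∑ k ∈ Finset.range (j + 2), (κ k - κ (k + 1) -
      (algebraMap R L α * (x k ^ 2 + x k * x (k + 2) + x (k + 2) ^ 2) +
      (1 - algebraMap R L α) * (x k * x (k + 1) + x (k + 1) * x (k + 2) + x (k + 1) ^ 2))) *
      ev R (fun t => x (k + 2 + t)) (dV a) = 0 := by
  set q : ℕ → L := fun k => algebraMap R L α * (x k ^ 2 + x k * x (k + 2) + x (k + 2) ^ 2) +
      (1 - algebraMap R L α) * (x k * x (k + 1) + x (k + 1) * x (k + 2) + x (k + 1) ^ 2) with hq
  set E : ℕ → L := fun k => ev R (fun t => x (k + t)) (dV a) with hE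
  have h0 := (bracket_eq_zero_iff _ _).1 hb
  have h1 := cyclicEv_of_mem_commutators hx h0
  have hH := leadHam_mem_homog α
  rw [cyclicEv_of_mem_homog x (i := 3 + i - 1) (by
    convert poisson_mem_homog hH ha using 2; omega)] at h1
  -- Since κ k is ∂H/∂v at two neighbouring points divided by their difference, `ev_identity` turns
  -- (∂H/∂v)(∂a/∂u) into κ k times a difference of values of ∂a/∂v. The value E (k + 2) uses every
  -- point of the cycle except x (k + 1).
  have h2 : ∀ k, ev R (fun t => x (t + k)) (poisson (leadHam α) a) =
      q k * E (k + 2) - κ k * (E (k + 2) - E (k + 1)) := by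
    intro k
    have h3 := ev_identity (fun t => x (t + k + 1)) ha
    rw [poisson_apply, map_sub, ev_mul _ (dU_mem_homog hH), ev_mul _ (dV_mem_homog hH),
      ev_dU_leadHam, ev_dV_leadHam]
    have h4 : x (j + 1 + k + 1) = x k := by rw [← hx k]; congr 1; omega
    have h5 : (ev R fun t => x (t + (2 - 1) + k)) (dU a) =
        ev R (fun t => x (t + k + 1)) (dU a) := by
      congr 2; funext t; congr 1; omega
    have h6 : (ev R fun t => x (t + 2 + k)) (dV a) = E (k + 2) := by
      simp only [hE]; congr 2; funext t; congr 1; omega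
    have h7 : (ev R fun t => x (t + 1 + k + 1)) (dV a) = E (k + 2) := by
      simp only [hE]; congr 2; funext t; congr 1; omega
    have h8 : (ev R fun t => x (t + k + 1)) (dV a) = E (k + 1) := by
      simp only [hE]; congr 2; funext t; congr 1; omega
    rw [h5, h6]
    rw [h7, h8, h4] at h3
    have h9 := hκx k
    simp only [hq, zero_add, add_comm 1 k, add_comm 2 k] at h3 ⊢
    linear_combination (ev R (fun t => x (t + k + 1)) (dU a)) * h9 + κ k * h3
  rw [Finset.sum_congr rfl fun k _ => h2 k] at h1
  have hEp : ∀ k, E (k + (j + 2)) = E k := by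
    intro k
    simp only [hE]
    congr 2
    funext t
    rw [← hx (k + t)]
    congr 1
    omega
  have h10 := sum_range_shift (fun k => κ k * E (k + 1)) (j + 2) (fun k => by
    rw [hκ, add_right_comm, hEp]) 1
  have h11 : ∑ k ∈ Finset.range (j + 2), (κ k - κ (k + 1) - q k) * E (k + 2) =
      -(∑ k ∈ Finset.range (j + 2), (q k * E (k + 2) - κ k * (E (k + 2) - E (k + 1)))) +
      (∑ k ∈ Finset.range (j + 2), κ k * E (k + 1) -
      ∑ k ∈ Finset.range (j + 2), κ (k + 1) * E (k + 1 + 1)) := by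
    rw [← Finset.sum_sub_distrib, ← Finset.sum_neg_distrib, ← Finset.sum_add_distrib]
    exact Finset.sum_congr rfl fun k _ => by ring
  rw [h11, h1, ← h10]
  ring

/-- The values of a cyclic derivative are invariant under rotations of a periodic argument. -/
theorem ev_dV_rotate_iterate {y : ℕ → L} {i j : ℕ} {a : NC R} (ha : a ∈ homog R i (j + 1))
    (hy : ∀ k, y (k + (j + 1)) = y k) (s : ℕ) :
    ev R (fun t => y (t + s)) (dV a) = ev R y (dV a) := by
  induction s with
  | zero => rfl
  | succ s ih =>
    rw [← ih, ← ev_dV_rotate (y := fun t => y (t + s)) ha (by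
      rw [← hy (0 + s)]; congr 1; omega)]
    congr 2
    funext t
    congr 1
    omega

end KeyIdentity

/-! ### Shift-invariant functions and sums over windows of a cycle -/

section CyclicSums

/-- The sequence `y` with its entry of index `s` removed. -/
def skip {M : Type*} (s : ℕ) (y : ℕ → M) (t : ℕ) : M := if t < s then y t else y (t + 1)

theorem skip_injOn {N s : ℕ} {y : ℕ → ℕ} (hy : Set.InjOn y (Set.Iio (N + 1))) :
    Set.InjOn (skip s y) (Set.Iio N) := by
  intro a ha b hb h
  simp only [Set.mem_Iio] at ha hb
  simp only [skip] at h
  split_ifs at h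
  · exact hy (by simp; omega) (by simp; omega) h
  · have := hy (by simp; omega) (by simp; omega) h; omega
  · have := hy (by simp; omega) (by simp; omega) h; omega
  · have := hy (by simp; omega) (by simp; omega) h; omega

theorem sum_skip {M : Type*} [AddCommGroup M] (y : ℕ → M) {N s : ℕ} (hs : s ≤ N) :
    ∑ t ∈ Finset.range N, skip s y t = ∑ t ∈ Finset.range (N + 1), y t - y s := by
  obtain ⟨r, rfl⟩ := Nat.exists_eq_add_of_le hs
  rw [Finset.sum_range_add, add_assoc, Finset.sum_range_add, Finset.sum_range_succ']
  have h1 : ∑ t ∈ Finset.range s, skip s y t = ∑ t ∈ Finset.range s, y t :=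
    Finset.sum_congr rfl fun t ht => if_pos (Finset.mem_range.1 ht)
  have h2 : ∑ t ∈ Finset.range r, skip s y (s + t) = ∑ t ∈ Finset.range r, y (s + (t + 1)) :=
    Finset.sum_congr rfl fun t _ => if_neg (by omega)
  rw [h1, h2, add_zero]
  abel

variable {R : Type*} [CommRing R]

/-- A function of the first `N` entries of a sequence that is invariant under the shift is
constant on injective sequences. -/
theorem eq_of_shift_invariant {M : Type*} {N : ℕ} {q : (ℕ → ℕ) → M}
    (hq : ∀ w w' : ℕ → ℕ, (∀ t < N, w t = w' t) → q w = q w')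
    (hs : ∀ y : ℕ → ℕ, Set.InjOn y (Set.Iio (N + 1)) → q (fun t => y (t + 1)) = q y)
    {w w' : ℕ → ℕ} (hw : Set.InjOn w (Set.Iio N)) (hw' : Set.InjOn w' (Set.Iio N)) :
    q w = q w' := by
  -- For disjoint w and w' the concatenation is injective, and a window of length N slides along it
  -- from w to w'.
  have key : ∀ w w' : ℕ → ℕ, Set.InjOn w (Set.Iio N) → Set.InjOn w' (Set.Iio N) →
      (∀ a < N, ∀ b < N, w a ≠ w' b) → q w = q w' := by
    intro w w' hw hw' hd
    set z : ℕ → ℕ := fun t => if t < N then w t else w' (t - N) with hz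
    have h : ∀ s ≤ N, q (fun t => z (t + s)) = q w := by
      intro s
      induction s with
      | zero => exact fun _ => hq _ _ fun t ht => if_pos ht
      | succ s ih =>
        intro hsN
        rw [← ih (by omega), ← hs (fun t => z (t + s))]
        · congr 1; funext t; congr 1; omega
        · intro a ha b hb hab
          simp only [Set.mem_Iio] at ha hb
          simp only [hz] at hab
          split_ifs at hab with h1 h2 h2
          · have := hw h1 h2 hab; omega
          · exact absurd hab (hd _ h1 _ (by omega))
          · exact absurd hab.symm (hd _ h2 _ (by omega))
          · have := hw' (by simp; omega) (by simp; omega) hab; omega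
    rw [← h N le_rfl]
    refine hq _ _ fun t ht => ?_
    simp [hz]
  -- In general, both sequences are compared with a third one beyond all their values.
  obtain ⟨K, hK⟩ : ∃ K, ∀ t < N, w t < K ∧ w' t < K := by
    refine ⟨(∑ t ∈ Finset.range N, (w t + w' t)) + 1, fun t ht => ?_⟩
    have := Finset.single_le_sum (f := fun t => w t + w' t) (fun i _ => Nat.zero_le _)
      (Finset.mem_range.2 ht)
    have h2 : w t + w' t ≤ ∑ t ∈ Finset.range N, (w t + w' t) := this
    omega
  have hc : Set.InjOn (fun t => t + K) (Set.Iio N) := fun a _ b _ h => by simpa using h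
  rw [key w _ hw hc fun a ha b hb => by have := hK a ha; omega,
    key w' _ hw' hc fun a ha b hb => by have := hK a ha; omega]

/-- The window of length `N + 1` that starts at `s` in the cyclic sequence `0, 1, …, N + 1`. -/
def window (N s t : ℕ) : ℕ := (s + t) % (N + 2)

theorem window_injOn (N s : ℕ) : Set.InjOn (window N s) (Set.Iio (N + 1)) := by
  intro a ha b hb h
  simp only [Set.mem_Iio] at ha hb
  have h1 : a ≡ b [MOD N + 2] := Nat.ModEq.add_left_cancel' s h
  exact Nat.ModEq.eq_of_lt_of_lt h1 (by omega) (by omega)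

theorem window_add (N s t r : ℕ) : window N s (t + r) = window N (s + r) t := by
  simp only [window]; congr 1; omega

theorem window_period (N s t : ℕ) : window N (s + (N + 2)) t = window N s t := by
  simp only [window]
  rw [add_right_comm, Nat.add_mod_right]

theorem sum_window_shift {M : Type*} [AddCommGroup M] (N : ℕ) (F : (ℕ → ℕ) → M) (r : ℕ) :
    ∑ s ∈ Finset.range (N + 2), F (fun t => window N s (t + r)) =
      ∑ s ∈ Finset.range (N + 2), F (window N s) := by
  rw [← sum_range_shift (fun s => F (window N s)) (N + 2)
    (fun k => by congr 1; funext t; exact window_period N k t) r]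
  exact Finset.sum_congr rfl fun s _ => by congr 1; funext t; exact window_add N s t r

theorem sum_window_apply {M : Type*} [AddCommGroup M] (N : ℕ) (f : ℕ → M) (r : ℕ) :
    ∑ s ∈ Finset.range (N + 2), f (window N s r) =
      ∑ s ∈ Finset.range (N + 2), f (window N s 0) := by
  rw [← sum_window_shift N (fun y => f (y 0)) r]
  simp

theorem sum_window_apply₂ {M : Type*} [AddCommGroup M] (N : ℕ) (f : ℕ → ℕ → M) (r : ℕ) :
    ∑ s ∈ Finset.range (N + 2), f (window N s r) (window N s (r + 1)) =
      ∑ s ∈ Finset.range (N + 2), f (window N s 0) (window N s 1) := by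
  rw [← sum_window_shift N (fun y => f (y 0) (y 1)) r]
  simp [add_comm]

/-- Both parts sum the products of entries at cyclic distance 1, ..., N; the reflection t ↦ N - 1 -
t matches equal distances. -/
theorem sum_window_quadratic (N : ℕ) :
    ∑ s ∈ Finset.range (N + 2), ((window N s 0 : R) *
      ∑ t ∈ Finset.range N, (window N s (t + 1) : R) -
      (window N s N : R) * ∑ t ∈ Finset.range N, (window N s t : R)) = 0 := by
  simp only [Finset.mul_sum, Finset.sum_sub_distrib]
  rw [Finset.sum_comm, Finset.sum_comm (γ := ℕ) (s := Finset.range (N + 2)), sub_eq_zero,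
    ← Finset.sum_range_reflect (fun t => ∑ s ∈ Finset.range (N + 2),
      (window N s N : R) * (window N s t : R))]
  refine Finset.sum_congr rfl fun t ht => ?_
  have ht := Finset.mem_range.1 ht
  rw [← sum_window_shift N (fun y => (y 0 : R) * (y (t + 1) : R)) (N - 1 - t)]
  refine Finset.sum_congr rfl fun s _ => ?_
  have h1 : t + 1 + (N - 1 - t) = N := by omega
  simp only [h1, zero_add]
  exact mul_comm _ _

end CyclicSums

/-! ### The pair potential and two nonvanishing cyclic sums -/

section Potential

variable {R : Type*} [CommRing R] [Algebra ℂ R]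

theorem eq_zero_of_complex_mul {r : ℂ} (hr : r ≠ 0) {a : R} (h : algebraMap ℂ R r * a = 0) :
    a = 0 := by
  have h1 : algebraMap ℂ R r⁻¹ * (algebraMap ℂ R r * a) = a := by
    rw [← mul_assoc, ← map_mul, inv_mul_cancel₀ hr, map_one, one_mul]
  rw [← h1, h, mul_zero]

theorem eq_zero_of_natCast_mul {n : ℕ} (hn : n ≠ 0) {a : R} (h : (n : R) * a = 0) : a = 0 :=
  eq_zero_of_complex_mul (r := n) (by exact_mod_cast hn) (by simpa using h)

/-- The inverse of the difference of two natural numbers. -/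
noncomputable def invDiff (R : Type*) [CommRing R] [Algebra ℂ R] (a b : ℕ) : R :=
  algebraMap ℂ R ((a : ℂ) - b)⁻¹

theorem sub_mul_invDiff {a b : ℕ} (h : a ≠ b) : ((a : R) - b) * invDiff R a b = 1 := by
  have h1 : (a : ℂ) - b ≠ 0 := sub_ne_zero.2 (by exact_mod_cast h)
  rw [invDiff, ← map_natCast (algebraMap ℂ R) a, ← map_natCast (algebraMap ℂ R) b, ← map_sub,
    ← map_mul, mul_inv_cancel₀ h1, map_one]

/-- The pair potential. -/
noncomputable def pairPotential (α : R) (a b : ℕ) : R :=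
  a * b * (a + b) * invDiff R a b ^ 2 + α * (a + b)

theorem pairPotential_mul_sub (α : R) {a b : ℕ} (h : a ≠ b) :
    pairPotential α a b * (a - b) = a * b * (a + b) * invDiff R a b +
      α * ((a : R) ^ 2 - (b : R) ^ 2) := by
  rw [pairPotential]
  linear_combination (a * b * (a + b) * invDiff R a b) * sub_mul_invDiff (R := R) h

theorem window_zero_ne_one (N s : ℕ) : window N s 0 ≠ window N s 1 := fun h => by
  simp only [window, add_zero] at h
  have h1 : 0 ≡ 1 [MOD N + 2] := Nat.ModEq.add_left_cancel' s h
  have := Nat.ModEq.eq_of_lt_of_lt h1 (by omega) (by omega)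
  omega

theorem window_zero_of_lt {N s : ℕ} (h : s < N + 2) : window N s 0 = s := Nat.mod_eq_of_lt h

theorem window_one_of_lt {N s : ℕ} (h : s < N + 1) : window N s 1 = s + 1 :=
  Nat.mod_eq_of_lt (by omega)

theorem window_one_last (N : ℕ) : window N (N + 1) 1 = 0 := Nat.mod_self (N + 2)

theorem invDiff_succ (s : ℕ) : invDiff R s (s + 1) = -1 := by
  rw [invDiff]
  have : ((s : ℂ) - (s + 1 : ℕ))⁻¹ = -1 := by push_cast; norm_num
  rw [this, map_neg, map_one]

/-- The part with α telescopes around the cycle, and the closing pair (N + 1, 0) contributes nothing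
to the rest. What remains is minus a sum of natural numbers whose term s = 1 is positive, and a
nonzero integer is invertible in R. -/
theorem sum_pairPotential_mul_sub_ne_zero (α : R) {N : ℕ} (hN : 1 ≤ N) {C : R}
    (h : (∑ s ∈ Finset.range (N + 2), pairPotential α (window N s 0) (window N s 1) *
      ((window N s 0 : R) - (window N s 1 : R))) * C = 0) : C = 0 := by
  have h1 : ∑ s ∈ Finset.range (N + 2), pairPotential α (window N s 0) (window N s 1) *
      ((window N s 0 : R) - (window N s 1 : R)) =
      -((∑ s ∈ Finset.range (N + 1), s * (s + 1) * (2 * s + 1) : ℕ) : R) := by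
    have h2 : ∀ s, pairPotential α (window N s 0) (window N s 1) *
      ((window N s 0 : R) - (window N s 1 : R)) = window N s 0 * window N s 1 *
      (window N s 0 + window N s 1) * invDiff R (window N s 0) (window N s 1) +
      (α * (window N s 0 : R) ^ 2 - α * (window N s 1 : R) ^ 2) := fun s => by
      rw [pairPotential_mul_sub α (window_zero_ne_one N s)]; ring
    simp only [h2]
    rw [Finset.sum_add_distrib, Finset.sum_sub_distrib,
      sum_window_apply N (fun a => α * (a : R) ^ 2) 1, sub_self, add_zero, Finset.sum_range_succ,
      window_one_last, Nat.cast_sum, ← Finset.sum_neg_distrib]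
    simp only [Nat.cast_zero, mul_zero, zero_mul, add_zero]
    refine Finset.sum_congr rfl fun s hs => ?_
    have hs := Finset.mem_range.1 hs
    rw [window_zero_of_lt (by omega), window_one_of_lt hs, invDiff_succ]
    push_cast
    ring
  rw [h1, neg_mul, neg_eq_zero] at h
  refine eq_zero_of_natCast_mul ?_ h
  have := Finset.single_le_sum (f := fun s => s * (s + 1) * (2 * s + 1))
    (fun i _ => Nat.zero_le _) (Finset.mem_range.2 (show 1 < N + 1 by omega))
  intro h0
  rw [h0] at this
  omega

/-- Consecutive pairs contribute -(2s + 1)²(s² + s - 1), with the wrong sign only for s = 0, where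
the value is 1. The closing pair contributes -(n + 2)³ and outweighs it: (n + 2)³ - 1 = n³ + 6n² +
12n + 7. -/
theorem sum_pairPotential_mul_sq_sub_sq_ne_zero {N : ℕ} (hN : 1 ≤ N) {C : R}
    (h : (∑ s ∈ Finset.range (N + 2), pairPotential (-1) (window N s 0) (window N s 1) *
      ((window N s 0 : R) ^ 2 - (window N s 1 : R) ^ 2)) * C = 0) : C = 0 := by
  obtain ⟨n, rfl⟩ : ∃ n, N = n + 1 := ⟨N - 1, by omega⟩
  have h1 : ∑ s ∈ Finset.range (n + 1 + 2),
      pairPotential (-1) (window (n + 1) s 0) (window (n + 1) s 1) *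
      ((window (n + 1) s 0 : R) ^ 2 - (window (n + 1) s 1 : R) ^ 2) =
      -((n ^ 3 + 6 * n ^ 2 + 12 * n + 7 + ∑ s ∈ Finset.range (n + 1),
        (2 * s + 3) ^ 2 * (s ^ 2 + 3 * s + 1) : ℕ) : R) := by
    rw [Finset.sum_range_succ, window_one_last, window_zero_of_lt (by omega)]
    have h2 : ∀ s ∈ Finset.range (n + 1 + 1),
        pairPotential (-1) (window (n + 1) s 0) (window (n + 1) s 1) *
        ((window (n + 1) s 0 : R) ^ 2 - (window (n + 1) s 1 : R) ^ 2) =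
        -((2 * s + 1) ^ 2 * (s ^ 2 + s - 1)) := fun s hs => by
      have hs := Finset.mem_range.1 hs
      rw [window_zero_of_lt (by omega), window_one_of_lt hs, pairPotential, invDiff_succ]
      push_cast
      ring
    rw [Finset.sum_congr rfl h2, Finset.sum_range_succ']
    simp only [pairPotential]
    push_cast
    have h3 : ∀ s ∈ Finset.range (n + 1), (2 * ((s : R) + 1) + 1) ^ 2 * ((s + 1) ^ 2 + (s + 1) - 1) =
        (2 * s + 3) ^ 2 * (s ^ 2 + 3 * s + 1) := fun s _ => by ring
    rw [Finset.sum_neg_distrib, Finset.sum_congr rfl h3]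
    ring
  rw [h1, neg_mul, neg_eq_zero] at h
  exact eq_zero_of_natCast_mul (by omega) h

end Potential

/-! ### Vanishing of the leading coefficient in the exceptional order -/

section Extremal

variable {R : Type*} [CommRing R] [Algebra ℂ R]

/-- Subtracting the sum of the values of f makes q shift invariant, hence constant on injective
sequences. -/
theorem const_of_affine_shift {N : ℕ} {q : (ℕ → ℕ) → R} {f : ℕ → R}
    (hq : ∀ w w' : ℕ → ℕ, (∀ t < N, w t = w' t) → q w = q w')
    (hs : ∀ y : ℕ → ℕ, Set.InjOn y (Set.Iio (N + 1)) →
      q (fun t => y (t + 1)) - q y = f (y N) - f (y 0)) :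
    ∃ K, ∀ w : ℕ → ℕ, Set.InjOn w (Set.Iio N) → q w = ∑ t ∈ Finset.range N, f (w t) + K := by
  have h := fun w => eq_of_shift_invariant (N := N)
    (q := fun w => q w - ∑ t ∈ Finset.range N, f (w t))
    (fun w w' h => by
      simp only [hq w w' h]
      congr 1
      exact Finset.sum_congr rfl fun t ht => by rw [h t (Finset.mem_range.1 ht)])
    (fun y hy => by
      have h1 := hs y hy
      have h2 := Finset.sum_range_succ (fun t => f (y t)) N
      rw [Finset.sum_range_succ'] at h2
      linear_combination h1 - h2) (w := w) (w' := fun t => t)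
  refine ⟨q (fun t => t) - ∑ t ∈ Finset.range N, f t, fun w hw => ?_⟩
  have := h w hw (fun a _ b _ h => h)
  linear_combination this

/-- The first coefficients of the functional equation force its leading term to vanish. -/
theorem leading_eq_zero {α : ℂ} {N : ℕ} (hN : 1 ≤ N)
    {q₀ q₁ q₂ q₃ : (ℕ → ℕ) → R} {C : R}
    (hq₁ : ∀ w w' : ℕ → ℕ, (∀ t < N, w t = w' t) → q₁ w = q₁ w')
    (hq₂ : ∀ w w' : ℕ → ℕ, (∀ t < N, w t = w' t) → q₂ w = q₂ w')
    (h₀ : ∀ w, Set.InjOn w (Set.Iio N) → q₀ w = C)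
    (h₁ : ∀ y : ℕ → ℕ, Set.InjOn y (Set.Iio (N + 1)) →
      algebraMap ℂ R α * (q₁ (fun t => y (t + 1)) - q₁ y) + (1 + algebraMap ℂ R α) *
      (y 0 * q₀ (fun t => y (t + 1)) - y N * q₀ y) = 0)
    (h₂ : ∀ y : ℕ → ℕ, Set.InjOn y (Set.Iio (N + 1)) →
      algebraMap ℂ R α * (q₂ (fun t => y (t + 1)) - q₂ y) + (1 + algebraMap ℂ R α) *
      (y 0 * q₁ (fun t => y (t + 1)) - y N * q₁ y) +
      3 * ((y 0 : R) ^ 2 * q₀ (fun t => y (t + 1)) - (y N : R) ^ 2 * q₀ y) +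
      ∑ k ∈ Finset.range N, pairPotential (algebraMap ℂ R α) (y k) (y (k + 1)) *
        (q₁ (skip (k + 1) y) - q₁ (skip k y)) = 0)
    (h₃ : α = -1 → ∀ y : ℕ → ℕ, Set.InjOn y (Set.Iio (N + 1)) →
      algebraMap ℂ R α * (q₃ (fun t => y (t + 1)) - q₃ y) + (1 + algebraMap ℂ R α) *
      (y 0 * q₂ (fun t => y (t + 1)) - y N * q₂ y) +
      3 * ((y 0 : R) ^ 2 * q₁ (fun t => y (t + 1)) - (y N : R) ^ 2 * q₁ y) +
      5 * ((y 0 : R) ^ 3 * q₀ (fun t => y (t + 1)) - (y N : R) ^ 3 * q₀ y) +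
      ∑ k ∈ Finset.range N, pairPotential (algebraMap ℂ R α) (y k) (y (k + 1)) *
        (q₂ (skip (k + 1) y) - q₂ (skip k y)) = 0) : C = 0 := by
  set A : R := algebraMap ℂ R α with hA
  have hinj : ∀ y : ℕ → ℕ, Set.InjOn y (Set.Iio (N + 1)) →
      Set.InjOn y (Set.Iio N) ∧ Set.InjOn (fun t => y (t + 1)) (Set.Iio N) := fun y hy =>
    ⟨hy.mono (Set.Iio_subset_Iio (by omega)), fun a ha b hb h => by
      have := hy (Set.mem_Iio.2 (Nat.succ_lt_succ ha)) (Set.mem_Iio.2 (Nat.succ_lt_succ hb)) h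
      omega⟩
  obtain ⟨K, hK⟩ := const_of_affine_shift (q := fun w => A * q₁ w)
    (f := fun a => (1 + A) * C * a) (fun w w' h => by rw [hq₁ w w' h]) (fun y hy => by
      have h := h₁ y hy
      rw [h₀ _ (hinj y hy).1, h₀ _ (hinj y hy).2] at h
      linear_combination h)
  -- For α = -1 the factor 1 + α removes the obstruction found at second order, so the third
  -- coefficient is needed.
  by_cases hα1 : α = -1
  · have hA1 : A = -1 := by rw [hA, hα1, map_neg, map_one]
    have hK1 : ∀ w, Set.InjOn w (Set.Iio N) → q₁ w = -K := fun w hw => by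
      have h := hK w hw
      simp only [hA1, add_neg_cancel, zero_mul, Finset.sum_const_zero] at h
      linear_combination -h
    obtain ⟨K', hK'⟩ := const_of_affine_shift (q := q₂) (f := fun a => -3 * C * (a : R) ^ 2) hq₂
      (fun y hy => by
        have h := h₂ y hy
        rw [h₀ _ (hinj y hy).1, h₀ _ (hinj y hy).2, Finset.sum_eq_zero fun k _ => by
          rw [hK1 _ (skip_injOn hy), hK1 _ (skip_injOn hy), sub_self, mul_zero], hA1] at h
        linear_combination -h)
    have h4 : ∀ y : ℕ → ℕ, Set.InjOn y (Set.Iio (N + 1)) →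
        (q₃ y - q₃ (fun t => y (t + 1))) - 3 * K * (y 0 : R) ^ 2 + 3 * K * (y N : R) ^ 2 +
        5 * C * (y 0 : R) ^ 3 - 5 * C * (y N : R) ^ 3 - 3 * C *
        ∑ k ∈ Finset.range N, pairPotential (-1) (y k) (y (k + 1)) *
        ((y k : R) ^ 2 - (y (k + 1) : R) ^ 2) = 0 := by
      intro y hy
      have h := h₃ hα1 y hy
      rw [h₀ _ (hinj y hy).1, h₀ _ (hinj y hy).2, hK1 _ (hinj y hy).1, hK1 _ (hinj y hy).2,
        hA1] at h
      have h5 : ∀ k ∈ Finset.range N, pairPotential (-1) (y k) (y (k + 1)) *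
          (q₂ (skip (k + 1) y) - q₂ (skip k y)) = -3 * C *
          (pairPotential (-1) (y k) (y (k + 1)) * ((y k : R) ^ 2 - (y (k + 1) : R) ^ 2)) := by
        intro k hk
        have hk := Finset.mem_range.1 hk
        rw [hK' _ (skip_injOn hy), hK' _ (skip_injOn hy)]
        have h6 := sum_skip (fun t => -3 * C * (y t : R) ^ 2) (show k ≤ N by omega)
        have h7 := sum_skip (fun t => -3 * C * (y t : R) ^ 2) (show k + 1 ≤ N by omega)
        have h8 : ∀ s t, skip s (fun t => -3 * C * (y t : R) ^ 2) t =
            -3 * C * ((skip s y t : ℕ) : R) ^ 2 := fun s t => by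
          simp only [skip]; split_ifs <;> rfl
        simp only [h8] at h6 h7
        rw [h6, h7]
        ring
      rw [Finset.sum_congr rfl h5, ← Finset.mul_sum] at h
      linear_combination h
    -- Summed over all windows, the q₃ terms and the powers of the end points cancel. Only 3N times
    -- C times the cyclic sum of W(a, b)(a² - b²) is left.
    have h9 := Finset.sum_congr (rfl : Finset.range (N + 2) = _) fun s _ => h4 _ (window_injOn N s)
    simp only [Finset.sum_sub_distrib, Finset.sum_add_distrib, Finset.sum_const_zero,
      ← Finset.mul_sum] at h9
    rw [sum_window_shift N q₃ 1, sum_window_apply N (fun a => (a : R) ^ 2) N,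
      sum_window_apply N (fun a => (a : R) ^ 3) N, Finset.sum_comm,
      Finset.sum_congr rfl fun k _ => sum_window_apply₂ N
        (fun a b => pairPotential (-1) a b * ((a : R) ^ 2 - (b : R) ^ 2)) k,
      Finset.sum_const, Finset.card_range, nsmul_eq_mul] at h9
    refine sum_pairPotential_mul_sq_sub_sq_ne_zero hN
      (eq_zero_of_natCast_mul (n := 3 * N) (by omega) ?_)
    push_cast
    linear_combination -h9
  -- The second equation is multiplied by A because the first one determines A q₁ as an affine
  -- function of the sum of the entries.
  · have h4 : ∀ y : ℕ → ℕ, Set.InjOn y (Set.Iio (N + 1)) →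
        A ^ 2 * (q₂ (fun t => y (t + 1)) - q₂ y) + (1 + A) ^ 2 * C *
        (y 0 * ∑ t ∈ Finset.range N, (y (t + 1) : R) - y N * ∑ t ∈ Finset.range N, (y t : R)) +
        (1 + A) * K * y 0 - (1 + A) * K * y N +
        3 * A * C * (y 0 : R) ^ 2 - 3 * A * C * (y N : R) ^ 2 + (1 + A) * C *
        ∑ k ∈ Finset.range N, pairPotential A (y k) (y (k + 1)) *
        ((y k : R) - (y (k + 1) : R)) = 0 := by
      intro y hy
      have h := h₂ y hy
      rw [h₀ _ (hinj y hy).1, h₀ _ (hinj y hy).2] at h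
      have h5 : ∀ k ∈ Finset.range N, A * (pairPotential A (y k) (y (k + 1)) *
          (q₁ (skip (k + 1) y) - q₁ (skip k y))) = (1 + A) * C *
          (pairPotential A (y k) (y (k + 1)) * ((y k : R) - (y (k + 1) : R))) := by
        intro k hk
        have hk := Finset.mem_range.1 hk
        have h10 := hK _ (skip_injOn (s := k) hy)
        have h11 := hK _ (skip_injOn (s := k + 1) hy)
        have h6 := sum_skip (fun t => (1 + A) * C * (y t : R)) (show k ≤ N by omega)
        have h7 := sum_skip (fun t => (1 + A) * C * (y t : R)) (show k + 1 ≤ N by omega)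
        have h8 : ∀ s t, skip s (fun t => (1 + A) * C * (y t : R)) t =
            (1 + A) * C * ((skip s y t : ℕ) : R) := fun s t => by
          simp only [skip]; split_ifs <;> rfl
        simp only [h8] at h6 h7
        rw [h6] at h10
        rw [h7] at h11
        linear_combination (pairPotential A (y k) (y (k + 1))) * (h11 - h10)
      have h12 := Finset.sum_congr rfl h5
      rw [← Finset.mul_sum, ← Finset.mul_sum] at h12
      have h13 := hK _ (hinj y hy).1
      have h14 := hK _ (hinj y hy).2
      rw [← Finset.mul_sum] at h13 h14
      linear_combination A * h - h12 - (1 + A) * y 0 * h14 + (1 + A) * y N * h13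
    -- Summation over the windows leaves N (1 + A) C times the cyclic sum of W(a, b)(a - b).
    have h9 := Finset.sum_congr (rfl : Finset.range (N + 2) = _) fun s _ => h4 _ (window_injOn N s)
    simp only [Finset.sum_sub_distrib, Finset.sum_add_distrib, Finset.sum_const_zero,
      ← Finset.mul_sum] at h9
    have h15 := sum_window_quadratic (R := R) N
    rw [Finset.sum_sub_distrib] at h15
    rw [sum_window_shift N q₂ 1, h15, sum_window_apply N (fun a => (a : R)) N,
      sum_window_apply N (fun a => (a : R) ^ 2) N, Finset.sum_comm,
      Finset.sum_congr rfl fun k _ => sum_window_apply₂ N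
        (fun a b => pairPotential A a b * ((a : R) - (b : R))) k,
      Finset.sum_const, Finset.card_range, nsmul_eq_mul] at h9
    refine sum_pairPotential_mul_sub_ne_zero A hN (eq_zero_of_natCast_mul (n := N) (by omega) ?_)
    refine eq_zero_of_complex_mul (r := 1 + α) (fun h => hα1 (by linear_combination h)) ?_
    rw [map_add, map_one, ← hA]
    linear_combination h9

end Extremal

/-! ### Algebraic identities behind the normalization -/

section Expansion

open PowerSeries

variable {R : Type*} [CommRing R]

/-- The geometric series `1 / (1 - n X)`. -/
noncomputable def geom (R : Type*) [CommRing R] (n : ℕ) : PowerSeries R :=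
  PowerSeries.mk fun r => (n : R) ^ r

theorem one_sub_mul_geom (n : ℕ) : (1 - X * (n : PowerSeries R)) * geom R n = 1 := by
  ext r
  rw [sub_mul, one_mul, mul_assoc, mul_comm X, map_sub, ← map_natCast (PowerSeries.C (R := R)),
    mul_assoc, PowerSeries.coeff_C_mul]
  cases r with
  | zero => simp [geom]
  | succ r => simp [geom, PowerSeries.coeff_succ_mul_X, PowerSeries.coeff_one, pow_succ']

/-- This is `middle_identity` for the points 1, xb, xc, with I and p as inverses of the differences;
`last_identity` has the point 1 on the other side. -/
theorem first_identity (A x b c I p : R) (h1 : (1 - x * b) * I = 1) (h2 : (b - c) * p = 1) :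
    ((1 + x * b) * (x * b * I + A * (1 - x * b)) -
      x ^ 2 * ((b + c) * (b * c * p + A * (b - c))) -
      (A * (1 + x * c + (x * c) ^ 2) + (1 - A) * (x * b + x * b * (x * c) + (x * b) ^ 2))) *
      (I * p * (1 - x * c)) =
      x * (x * b * (1 + x * b) * I ^ 2 + A * (1 + x * b) -
        x * (b * c * (b + c) * p ^ 2 + A * (b + c))) := by
  grind

theorem last_identity (A x b c I p : R) (h1 : (1 - x * c) * I = 1) (h2 : (b - c) * p = 1) :
    (x ^ 2 * ((b + c) * (b * c * p + A * (b - c))) +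
      (1 + x * c) * (x * c * I + A * (1 - x * c)) -
      (A * ((x * b) ^ 2 + x * b + 1) + (1 - A) * (x * b * (x * c) + x * c + (x * c) ^ 2))) *
      (p * I * (1 - x * b)) =
      x * (x * (b * c * (b + c) * p ^ 2 + A * (b + c)) -
        (x * c * (1 + x * c) * I ^ 2 + A * (1 + x * c))) := by
  grind

variable [Algebra ℂ R]

/-- This is the reason for the normalization: after division by (a - b)(b - c), the coefficient of
the term omitting b becomes a difference of potentials over a - c, the new difference created by the
omission. -/
theorem middle_identity (A : R) {a b c : ℕ} (hab : a ≠ b) (hbc : b ≠ c) (hac : a ≠ c) :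
    ((a + b : R) * (a * b * invDiff R a b + A * (a - b)) -
      (b + c) * (b * c * invDiff R b c + A * (b - c)) -
      (A * ((a : R) ^ 2 + a * c + (c : R) ^ 2) + (1 - A) * (a * b + b * c + (b : R) ^ 2))) *
      (invDiff R a b * invDiff R b c) =
      (pairPotential A a b - pairPotential A b c) * invDiff R a c := by
  have h1 := sub_mul_invDiff (R := R) hab
  have h2 := sub_mul_invDiff (R := R) hbc
  have h3 := sub_mul_invDiff (R := R) hac
  simp only [pairPotential]
  generalize invDiff R a b = p at *
  generalize invDiff R b c = q at *
  generalize invDiff R a c = r at *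
  generalize (a : R) = a at *
  generalize (b : R) = b at *
  generalize (c : R) = c at *
  grind

theorem prod_skip {M : Type*} [CommMonoid M] (d : ℕ → ℕ → M) (y : ℕ → ℕ) {N s : ℕ} (hs : s < N) :
    (∏ t ∈ Finset.range (N + 1), d (y t) (y (t + 1))) * d (y s) (y (s + 2)) =
      (∏ t ∈ Finset.range N, d (skip (s + 1) y t) (skip (s + 1) y (t + 1))) *
        (d (y s) (y (s + 1)) * d (y (s + 1)) (y (s + 2))) := by
  obtain ⟨r, rfl⟩ : ∃ r, N = s + 1 + r := ⟨N - s - 1, by omega⟩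
  rw [show s + 1 + r + 1 = s + 2 + r by ring, Finset.prod_range_add _ (s + 2) r,
    Finset.prod_range_add _ (s + 1) r, Finset.prod_range_succ _ (s + 1), Finset.prod_range_succ _ s,
    Finset.prod_range_succ _ s]
  have h1 : ∏ t ∈ Finset.range s, d (skip (s + 1) y t) (skip (s + 1) y (t + 1)) =
      ∏ t ∈ Finset.range s, d (y t) (y (t + 1)) := Finset.prod_congr rfl fun t ht => by
    have ht := Finset.mem_range.1 ht
    simp only [skip]
    rw [if_pos (by omega), if_pos (by omega)]
  have h2 : ∏ t ∈ Finset.range r, d (skip (s + 1) y (s + 1 + t)) (skip (s + 1) y (s + 1 + t + 1)) =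
      ∏ t ∈ Finset.range r, d (y (s + 2 + t)) (y (s + 2 + t + 1)) :=
    Finset.prod_congr rfl fun t ht => by
      simp only [skip]
      rw [if_neg (by omega), if_neg (by omega)]
      congr 2 <;> ring
  rw [h1, h2]
  simp only [skip, lt_add_iff_pos_right, zero_lt_one, if_true, lt_self_iff_false, if_false]
  ac_rfl

theorem prod_skip_zero {M : Type*} [CommMonoid M] (d : ℕ → ℕ → M) (y : ℕ → ℕ) (N : ℕ) :
    ∏ t ∈ Finset.range (N + 1), d (y t) (y (t + 1)) =
      (∏ t ∈ Finset.range N, d (skip 0 y t) (skip 0 y (t + 1))) * d (y 0) (y 1) := by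
  rw [Finset.prod_range_succ']
  simp [skip]

theorem prod_skip_last {M : Type*} [CommMonoid M] (d : ℕ → ℕ → M) (y : ℕ → ℕ) (N : ℕ) :
    ∏ t ∈ Finset.range (N + 1), d (y t) (y (t + 1)) =
      (∏ t ∈ Finset.range N, d (skip (N + 1) y t) (skip (N + 1) y (t + 1))) *
        d (y N) (y (N + 1)) := by
  rw [Finset.prod_range_succ]
  congr 1
  refine Finset.prod_congr rfl fun t ht => ?_
  have ht := Finset.mem_range.1 ht
  simp only [skip]
  rw [if_pos (by omega), if_pos (by omega)]

end Expansion

/-! ### Evaluation at the points 1, w 0 X, w 1 X, ... -/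

section Star

open PowerSeries

variable {R : Type*} [CommRing R] [Algebra ℂ R]

/-- The sequence `1, w 0 * X, w 1 * X, …`. -/
noncomputable def points (R : Type*) [CommRing R] (w : ℕ → ℕ) : ℕ → PowerSeries R
  | 0 => 1
  | t + 1 => X * (w t : PowerSeries R)

/-- The normalized value of an element with `M + 1` factors `V` at the points
`1, w 0 * X, …, w M * X`. -/
noncomputable def normEv (M : ℕ) (b : NC R) (w : ℕ → ℕ) : PowerSeries R :=
  geom R (w 0) * geom R (w M) *
    (∏ t ∈ Finset.range M, invDiff (PowerSeries R) (w t) (w (t + 1))) * ev R (points R w) b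

theorem normEv_congr {M i : ℕ} {b : NC R} (hb : b ∈ homog R i (M + 1)) {w w' : ℕ → ℕ}
    (h : ∀ t < M + 1, w t = w' t) : normEv M b w = normEv M b w' := by
  rw [normEv, normEv, h 0 (by omega), h M (by omega)]
  congr 1
  · congr 1
    refine Finset.prod_congr rfl fun t ht => ?_
    have ht := Finset.mem_range.1 ht
    rw [h t (by omega), h (t + 1) (by omega)]
  · refine ev_congr hb fun t ht => ?_
    cases t with
    | zero => rfl
    | succ t => simp only [points]; rw [h t (by omega)]

/-- The potential at the end points. -/
noncomputable def endPotential (A : R) (a : ℕ) : PowerSeries R :=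
  let x : PowerSeries R := X * (a : PowerSeries R)
  x * (1 + x) * geom R a ^ 2 + PowerSeries.C A * (1 + x)

/-- The quotient `κ` at the end points. -/
noncomputable def endSlope (A : R) (a : ℕ) : PowerSeries R :=
  let x : PowerSeries R := X * (a : PowerSeries R)
  (1 + x) * (x * geom R a + PowerSeries.C A * (1 - x))

/-- The quotient `κ` at two inner points. -/
noncomputable def innerSlope (A : R) (a b : ℕ) : PowerSeries R :=
  let x : PowerSeries R := a
  let y : PowerSeries R := b
  X ^ 2 * ((x + y) * (x * y * invDiff (PowerSeries R) a b + PowerSeries.C A * (x - y)))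

/-- The values of `κ` along the cyclic sequence of points. -/
noncomputable def slopes (A : R) (M : ℕ) (y : ℕ → ℕ) : ℕ → PowerSeries R
  | 0 => endSlope A (y 0)
  | r + 1 => if r = M + 1 then -endSlope A (y (M + 1)) else innerSlope A (y r) (y (r + 1))

theorem endSlope_mul (A : R) (a : ℕ) :
    endSlope A a * (1 - (X : PowerSeries R) * (a : PowerSeries R)) =
    (1 + (X : PowerSeries R) * (a : PowerSeries R)) * (1 * (X * (a : PowerSeries R)) +
      PowerSeries.C A * (1 - (X : PowerSeries R) * (a : PowerSeries R)) ^ 2) := by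
  simp only [endSlope]
  linear_combination (1 + (X : PowerSeries R) * (a : PowerSeries R)) *
    (X * (a : PowerSeries R)) * one_sub_mul_geom (R := R) a

theorem innerSlope_mul (A : R) {a b : ℕ} (h : a ≠ b) :
    innerSlope A a b * ((X : PowerSeries R) * (a : PowerSeries R) - X * (b : PowerSeries R)) =
    ((X : PowerSeries R) * (a : PowerSeries R) + X * (b : PowerSeries R)) *
      ((X : PowerSeries R) * (a : PowerSeries R) * (X * (b : PowerSeries R)) + PowerSeries.C A *
        ((X : PowerSeries R) * (a : PowerSeries R) - X * (b : PowerSeries R)) ^ 2) := by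
  simp only [innerSlope]
  linear_combination X ^ 3 * (a + b : PowerSeries R) * a * b *
    sub_mul_invDiff (R := PowerSeries R) h

theorem slopes_mul (A : R) {M : ℕ} {y : ℕ → ℕ} (hy : Set.InjOn y (Set.Iio (M + 2))) {r : ℕ}
    (hr : r < M + 3) : slopes A M y r * (points R y r - points R y ((r + 1) % (M + 3))) =
    (points R y r + points R y ((r + 1) % (M + 3))) *
      (points R y r * points R y ((r + 1) % (M + 3)) +
        PowerSeries.C A * (points R y r - points R y ((r + 1) % (M + 3))) ^ 2) := by
  rcases r with _ | r
  · rw [Nat.mod_eq_of_lt (by omega)]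
    simp only [points, slopes]
    exact endSlope_mul A _
  · by_cases h : r = M + 1
    · subst h
      rw [Nat.mod_self]
      simp only [points, slopes, if_true]
      have h1 := endSlope_mul A (y (M + 1))
      linear_combination h1
    · rw [Nat.mod_eq_of_lt (by omega)]
      simp only [points, slopes, if_neg h]
      refine innerSlope_mul A fun h1 => ?_
      have := hy (by simp; omega) (by simp; omega) h1
      omega

/-- The cycle with one point omitted is read from the successor of that point; cyclic invariance of
∂a/∂v allows the reading to start at the point 1. -/
theorem ev_points_skip {M i : ℕ} {a : NC R} (ha : a ∈ homog R i (M + 2)) (y : ℕ → ℕ) {s : ℕ}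
    (hs : s < M + 2) :
    ev R (fun t => points R y ((s + 2 + t) % (M + 3))) (dV a) =
      ev R (points R (skip s y)) (dV a) := by
  have hb := dV_mem_homog ha
  set Y : ℕ → PowerSeries R := fun t => points R (skip s y) (t % (M + 2)) with hY
  have h1 : ev R (points R (skip s y)) (dV a) = ev R Y (dV a) := ev_congr hb fun t ht => by
    simp only [hY]; rw [Nat.mod_eq_of_lt (by omega)]
  rw [h1, ← ev_dV_rotate_iterate ha (y := Y) (fun k => by simp [hY]) (s + 1)]
  refine ev_congr hb fun t ht => ?_
  simp only [hY]
  by_cases h : s + t < M + 1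
  · rw [Nat.mod_eq_of_lt (show s + 2 + t < M + 3 by omega),
      Nat.mod_eq_of_lt (show t + (s + 1) < M + 2 by omega),
      show s + 2 + t = s + t + 1 + 1 by ring, show t + (s + 1) = s + t + 1 by ring]
    simp only [points, skip]
    rw [if_neg (by omega)]
  · obtain ⟨e, he⟩ := Nat.exists_eq_add_of_le (show M + 1 ≤ s + t by omega)
    rw [show s + 2 + t = e + (M + 3) by omega, show t + (s + 1) = e + (M + 2) by omega,
      Nat.add_mod_right, Nat.add_mod_right, Nat.mod_eq_of_lt (by omega),
      Nat.mod_eq_of_lt (by omega)]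
    cases e with
    | zero => rfl
    | succ e =>
      simp only [points, skip]
      rw [if_pos (by omega)]

end Star

/-! ### The functional equation for the normalized values -/

section Star

open PowerSeries

variable {R : Type*} [CommRing R]

theorem ev_mul_left {L : Type*} [CommRing L] [Algebra R L] (x : L) (y : ℕ → L) {i j : ℕ} {a : NC R}
    (ha : a ∈ homog R i j) : ev R (fun t => x * y t) a = x ^ i * ev R y a := by
  refine homog_induction (p := fun a => ev R (fun t => x * y t) a = x ^ i * ev R y a) ?_ ?_ ?_ ?_ ha
  · rintro l rfl -
    rw [ev_word, ev_word]
    clear ha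
    induction l generalizing y with
    | nil => simp [evWord]
    | cons k l ih =>
      fin_cases k
      · simp only [evWord, Fin.zero_eta, if_true, List.count_cons_self, pow_succ,
          ih y]
        ring
      · simp only [evWord, Fin.mk_one, one_ne_zero, if_false]
        rw [ih]
        simp
  · simp
  · intro a b ha hb; rw [map_add, ha, hb, map_add, mul_add]
  · intro r a ha; rw [map_smul, ha, map_smul, mul_smul_comm]

variable [Algebra ℂ R]

theorem pairPotential_C (A : R) (a b : ℕ) :
    pairPotential (PowerSeries.C A) a b = PowerSeries.C (pairPotential A a b) := by
  have h : invDiff (PowerSeries R) a b = PowerSeries.C (invDiff R a b) :=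
    PowerSeries.algebraMap_apply
  simp only [pairPotential, h, map_add, map_mul, map_pow, map_natCast]

/-- The potentials along the cyclic sequence of points. -/
noncomputable def potentials (A : R) (M : ℕ) (y : ℕ → ℕ) : ℕ → PowerSeries R
  | 0 => endPotential A (y 0)
  | r + 1 => if r = M + 1 then endPotential A (y (M + 1)) else
      X * PowerSeries.C (pairPotential A (y r) (y (r + 1)))

/-- The second difference of the Hamiltonian at three consecutive points. -/
noncomputable def bend (A : R) (x y z : PowerSeries R) : PowerSeries R :=
  PowerSeries.C A * (x ^ 2 + x * z + z ^ 2) + (1 - PowerSeries.C A) * (x * y + y * z + y ^ 2)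

theorem mul_eq_mul_of_first {L : Type*} [CommRing L] {K I₀ I₁ P p E d g Z : L}
    (h₁ : K * (I₀ * p * d) = Z) (h₂ : d * g = 1) :
    K * (I₀ * I₁ * (P * p)) * E = Z * (g * I₁ * P * E) := by
  linear_combination (g * I₁ * P * E) * h₁ - K * I₀ * I₁ * P * p * E * h₂

theorem mul_eq_mul_of_last {L : Type*} [CommRing L] {K I₀ I₁ P p E d g Z : L}
    (h₁ : K * (p * I₁ * d) = Z) (h₂ : d * g = 1) :
    K * (I₀ * I₁ * (P * p)) * E = Z * (I₀ * g * P * E) := by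
  linear_combination (I₀ * g * P * E) * h₁ - K * I₀ * I₁ * P * p * E * h₂

theorem mul_eq_mul_of_middle {L : Type*} [CommRing L] {K I₀ I₁ P P' p q r d E Z : L}
    (h₁ : K * (p * q) = Z * r) (h₂ : P * r = P' * (p * q)) (h₃ : d * r = 1) :
    K * (I₀ * I₁ * P) * E = Z * (I₀ * I₁ * P' * E) := by
  linear_combination -K * I₀ * I₁ * P * E * h₃ + d * K * I₀ * I₁ * E * h₂ +
    d * I₀ * I₁ * P' * E * h₁ + Z * I₀ * I₁ * P' * E * h₃

/-- Omitting y s replaces two factors of the product of inverse differences by one, which the three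
identities above account for; the cases are s first, last and in between. -/
theorem slopes_sub_mul_normEv (A : R) {M : ℕ} {y : ℕ → ℕ} (hy : Set.InjOn y (Set.Iio (M + 2)))
    (b : NC R) {s : ℕ} (hs : s < M + 2) :
    (slopes A M y s - slopes A M y (s + 1) - bend A (points R y s)
      (points R y (s + 1)) (points R y ((s + 2) % (M + 3)))) *
      (geom R (y 0) * geom R (y (M + 1)) *
        ∏ t ∈ Finset.range (M + 1), invDiff (PowerSeries R) (y t) (y (t + 1))) *
      ev R (points R (skip s y)) b =
    X * ((potentials A M y s - potentials A M y (s + 1)) * normEv M b (skip s y)) := by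
  have hne : ∀ p q, p < M + 2 → q < M + 2 → p ≠ q → y p ≠ y q := fun p q hp hq h h1 =>
    h (hy (Set.mem_Iio.2 hp) (Set.mem_Iio.2 hq) h1)
  rw [normEv]
  rcases s with _ | s
  · have h1 := first_identity (PowerSeries.C A) X (y 0 : PowerSeries R) (y 1)
      (geom R (y 0)) (invDiff _ (y 0) (y 1)) (one_sub_mul_geom _)
      (sub_mul_invDiff (hne 0 1 (by omega) (by omega) (by omega)))
    have h2 := one_sub_mul_geom (R := R) (y 1)
    rw [Nat.mod_eq_of_lt (by omega), prod_skip_zero (invDiff (PowerSeries R)) y M]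
    simp only [slopes, potentials, points, endSlope, innerSlope, endPotential, bend]
    rw [if_neg (by omega), if_neg (by omega), ← pairPotential_C, pairPotential,
      show skip 0 y 0 = y 1 from rfl, show skip 0 y M = y (M + 1) from rfl]
    generalize ∏ t ∈ Finset.range M,
      invDiff (PowerSeries R) (skip 0 y t) (skip 0 y (t + 1)) = P
    have h3 := mul_eq_mul_of_first (I₁ := geom R (y (M + 1))) (P := P)
      (E := ev R (points R (skip 0 y)) b) h1 h2
    simp only [zero_add] at h3 ⊢
    linear_combination h3
  by_cases hsM : s = M
  · subst hsM
    have h1 := last_identity (PowerSeries.C A) X (y s : PowerSeries R) (y (s + 1))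
      (geom R (y (s + 1))) (invDiff _ (y s) (y (s + 1))) (one_sub_mul_geom _)
      (sub_mul_invDiff (hne s (s + 1) (by omega) (by omega) (by omega)))
    have h2 := one_sub_mul_geom (R := R) (y s)
    rw [Nat.mod_self, prod_skip_last (invDiff (PowerSeries R)) y s]
    simp only [slopes, potentials, points, endSlope, innerSlope, endPotential, bend, if_true]
    rw [if_neg (by omega), if_neg (by omega), ← pairPotential_C, pairPotential,
      show skip (s + 1) y 0 = y 0 from rfl, show skip (s + 1) y s = y s from if_pos (by omega)]
    generalize ∏ t ∈ Finset.range s,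
      invDiff (PowerSeries R) (skip (s + 1) y t) (skip (s + 1) y (t + 1)) = P
    have h3 := mul_eq_mul_of_last (I₀ := geom R (y 0)) (P := P)
      (E := ev R (points R (skip (s + 1) y)) b) h1 h2
    linear_combination h3
  · have h1 := middle_identity (PowerSeries.C A)
      (hne s (s + 1) (by omega) (by omega) (by omega))
      (hne (s + 1) (s + 2) (by omega) (by omega) (by omega))
      (hne s (s + 2) (by omega) (by omega) (by omega))
    have h2 := prod_skip (invDiff (PowerSeries R)) y (show s < M by omega)
    have h4 := sub_mul_invDiff (R := PowerSeries R)
      (hne s (s + 2) (by omega) (by omega) (by omega))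
    rw [Nat.mod_eq_of_lt (by omega)]
    simp only [slopes, potentials, points, innerSlope, bend]
    rw [if_neg (by omega), if_neg (by omega), if_neg (by omega), if_neg (by omega),
      ← pairPotential_C, ← pairPotential_C,
      show skip (s + 1) y 0 = y 0 from rfl, show skip (s + 1) y M = y (M + 1) from if_neg (by omega)]
    have h3 := mul_eq_mul_of_middle (I₀ := geom R (y 0)) (I₁ := geom R (y (M + 1)))
      (E := ev R (points R (skip (s + 1) y)) b) h1 h2 h4
    linear_combination X ^ 2 * h3

/-- Summation by parts: the differences pass from the potentials to G. -/
theorem sum_potentials (A : R) (M : ℕ) (y : ℕ → ℕ) (G : ℕ → PowerSeries R) :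
    ∑ s ∈ Finset.range (M + 2), (potentials A M y s - potentials A M y (s + 1)) * G s =
      endPotential A (y 0) * G 0 - endPotential A (y (M + 1)) * G (M + 1) +
      X * ∑ k ∈ Finset.range (M + 1), PowerSeries.C (pairPotential A (y k) (y (k + 1))) *
        (G (k + 1) - G k) := by
  have h1 : ∀ k ∈ Finset.range (M + 1), potentials A M y (k + 1) * G (k + 1) -
      potentials A M y (k + 1) * G k = X * (PowerSeries.C (pairPotential A (y k) (y (k + 1))) *
        (G (k + 1) - G k)) := fun k hk => by
    have hk := Finset.mem_range.1 hk
    simp only [potentials]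
    rw [if_neg (by omega)]
    ring
  rw [Finset.mul_sum, ← Finset.sum_congr rfl h1]
  simp only [sub_mul, Finset.sum_sub_distrib]
  rw [Finset.sum_range_succ', Finset.sum_range_succ
    (fun s => potentials A M y (s + 1) * G s)]
  simp only [potentials, if_true]
  ring

/-- The functional equation for the normalized values. -/
theorem normEv_equation (A : R) {M i : ℕ} {a : NC R} (ha : a ∈ homog R (i + 1) (M + 2))
    (hb : bracket (leadHam A) a = 0) {y : ℕ → ℕ} (hy : Set.InjOn y (Set.Iio (M + 2))) :
    ∃ c c' : PowerSeries R,
      endPotential A (y 0) * normEv M (dV a) (fun t => y (t + 1)) -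
      endPotential A (y (M + 1)) * normEv M (dV a) y +
      X * ∑ k ∈ Finset.range (M + 1), PowerSeries.C (pairPotential A (y k) (y (k + 1))) *
        (normEv M (dV a) (skip (k + 1) y) - normEv M (dV a) (skip k y)) =
      X ^ i * (PowerSeries.C (1 + A) * c + X * c') := by
  have hd := dV_mem_homog ha
  set x : ℕ → PowerSeries R := fun k => points R y (k % (M + 3)) with hx
  have hper : ∀ (k r : ℕ), (k % (M + 3) + r) % (M + 3) = (k + r) % (M + 3) := fun k r => by simp
  have key := sum_ev_dV_eq_zero A ha hb (x := x)
    (κ := fun k => slopes A M y (k % (M + 3))) (fun k => by simp [hx]) (fun k => by simp)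
    (fun k => by
      have h := slopes_mul A hy (Nat.mod_lt k (show 0 < M + 3 by omega))
      rw [hper] at h
      exact h)
  set P : PowerSeries R := geom R (y 0) * geom R (y (M + 1)) *
    ∏ t ∈ Finset.range (M + 1), invDiff (PowerSeries R) (y t) (y (t + 1)) with hP
  set E : PowerSeries R := ev R (fun t => (y t : PowerSeries R)) (dV a) with hE
  rw [Finset.sum_range_succ] at key
  have h1 : ∀ s ∈ Finset.range (M + 2), _ := fun s hs =>
    slopes_sub_mul_normEv A hy (dV a) (Finset.mem_range.1 hs)
  have h2 := Finset.sum_congr rfl h1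
  rw [← Finset.mul_sum, sum_potentials A M y (fun s => normEv M (dV a) (skip s y))] at h2
  have h3 : normEv M (dV a) (skip (M + 1) y) = normEv M (dV a) y :=
    normEv_congr hd fun t ht => if_pos ht
  have h4 : skip 0 y = fun t => y (t + 1) := by funext t; simp [skip]
  rw [h3, h4] at h2
  -- In the one remaining term the omitted point is 1. All other points are multiples of X, and
  -- ∂a/∂v has degree i + 1 in u, so this term is of high order.
  have h5 : ev R (fun t => x (M + 2 + 2 + t)) (dV a) = X ^ (i + 1) * E := by
    rw [hE, ← ev_mul_left X _ hd]
    refine ev_congr hd fun t ht => ?_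
    simp only [hx]
    rw [show M + 2 + 2 + t = t + 1 + (M + 3) by ring, Nat.add_mod_right,
      Nat.mod_eq_of_lt (by omega)]
    rfl
  have h6 : ∀ k, x k = points R y (k % (M + 3)) := fun k => rfl
  have h7 : ∀ s ∈ Finset.range (M + 2), _ = _ := fun s hs => by
    have hs := Finset.mem_range.1 hs
    have h8 : (slopes A M y (s % (M + 3)) - slopes A M y ((s + 1) % (M + 3)) -
        bend A (x s) (x (s + 1)) (x (s + 2))) * ev R (fun t => x (s + 2 + t)) (dV a) =
        (slopes A M y s - slopes A M y (s + 1) - bend A (points R y s)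
        (points R y (s + 1)) (points R y ((s + 2) % (M + 3)))) *
        ev R (points R (skip s y)) (dV a) := by
      simp only [hx]
      rw [ev_points_skip ha y hs, Nat.mod_eq_of_lt (show s < M + 3 by omega),
        Nat.mod_eq_of_lt (show s + 1 < M + 3 by omega)]
    exact h8
  have h9 : ∀ r, algebraMap R (PowerSeries R) r = PowerSeries.C r := fun r => rfl
  simp only [h9] at key
  simp only [bend] at h7
  rw [Finset.sum_congr rfl h7, h5, h6, h6, h6,
    show (M + 2 + 1) % (M + 3) = 0 from Nat.mod_self (M + 3),
    show (M + 2 + 2) % (M + 3) = 1 by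
      rw [show M + 2 + 2 = 1 + (M + 3) by ring, Nat.add_mod_right, Nat.mod_eq_of_lt (by omega)],
    Nat.mod_eq_of_lt (show M + 2 < M + 3 by omega)] at key
  have h10 : ∀ s, (slopes A M y s - slopes A M y (s + 1) - bend A (points R y s)
        (points R y (s + 1)) (points R y ((s + 2) % (M + 3)))) * P *
        ev R (points R (skip s y)) (dV a) = P * ((slopes A M y s - slopes A M y (s + 1) -
        bend A (points R y s) (points R y (s + 1)) (points R y ((s + 2) % (M + 3)))) *
        ev R (points R (skip s y)) (dV a)) := fun s => by ring
  rw [← hP] at h2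
  simp only [h10] at h2
  rw [← Finset.mul_sum] at h2
  simp only [bend] at h2
  have h11 : slopes A M y (M + 2) = -endSlope A (y (M + 1)) := by simp [slopes]
  rw [h11] at key
  rw [eq_neg_of_add_eq_zero_left key] at h2
  simp only [points, slopes, endSlope] at h2
  set y0 : PowerSeries R := (y 0 : PowerSeries R)
  set y1 : PowerSeries R := (y (M + 1) : PowerSeries R)
  -- At X = 0 both end slopes equal A and the second difference equals 1 - A, so the lowest term
  -- carries the factor 2A + (1 - A) = 1 + A. This gains one order when A = -1.
  refine ⟨P * E, P * E * (y1 * geom R (y (M + 1)) * (1 + X * y1) - PowerSeries.C A * X * y1 ^ 2 +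
    (y0 * geom R (y 0) * (1 + X * y0) - PowerSeries.C A * X * y0 ^ 2) +
    PowerSeries.C A * X * (y1 ^ 2 + y1 * y0 + y0 ^ 2) + (1 - PowerSeries.C A) * (y1 + y0)),
    X_mul_cancel ?_⟩
  rw [← h2, map_add, map_one]
  ring

end Star

/-! ### Induction on the order in X -/

section Vanishing

open PowerSeries

variable {R : Type*} [CommRing R]

/-- Division of a power series by `X ^ r`, without remainder. -/
noncomputable def shiftDown (r : ℕ) (f : PowerSeries R) : PowerSeries R :=
  PowerSeries.mk fun n => PowerSeries.coeff (n + r) f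

theorem eq_X_pow_mul_shiftDown {r : ℕ} {f : PowerSeries R}
    (h : ∀ n < r, PowerSeries.coeff n f = 0) : f = X ^ r * shiftDown r f := by
  ext n
  rw [PowerSeries.coeff_X_pow_mul']
  split_ifs with hn
  · rw [shiftDown, PowerSeries.coeff_mk, Nat.sub_add_cancel hn]
  · exact h n (by omega)

theorem exists_endPotential_eq (A : R) (a : ℕ) : ∃ Z : PowerSeries R, endPotential A a =
    PowerSeries.C A + X * PowerSeries.C ((1 + A) * a) + X ^ 2 * PowerSeries.C (3 * (a : R) ^ 2) +
      X ^ 3 * PowerSeries.C (5 * (a : R) ^ 3) + X ^ 4 * Z := by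
  have h := one_sub_mul_geom (R := R) a
  refine ⟨(a : PowerSeries R) ^ 4 * (7 - 5 * (X * (a : PowerSeries R))) * geom R a ^ 2, ?_⟩
  simp only [endPotential, map_mul, map_add, map_pow, map_natCast, map_one, map_ofNat]
  generalize (a : PowerSeries R) = a at *
  generalize geom R _ = I at *
  generalize PowerSeries.C A = A
  generalize (X : PowerSeries R) = x at *
  grind

theorem coeff_endPotential_mul (A : R) (a : ℕ) (f : PowerSeries R) :
    coeff 0 (endPotential A a * f) = A * coeff 0 f ∧
    coeff 1 (endPotential A a * f) = A * coeff 1 f + (1 + A) * a * coeff 0 f ∧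
    coeff 2 (endPotential A a * f) = A * coeff 2 f + (1 + A) * a * coeff 1 f +
      3 * a ^ 2 * coeff 0 f ∧
    coeff 3 (endPotential A a * f) = A * coeff 3 f + (1 + A) * a * coeff 2 f +
      3 * a ^ 2 * coeff 1 f + 5 * a ^ 3 * coeff 0 f := by
  obtain ⟨Z, hZ⟩ := exists_endPotential_eq A a
  have h1 : endPotential A a * f = PowerSeries.C A * f +
      X ^ 1 * (PowerSeries.C ((1 + A) * a) * f) +
      X ^ 2 * (PowerSeries.C (3 * (a : R) ^ 2) * f) +
      X ^ 3 * (PowerSeries.C (5 * (a : R) ^ 3) * f) + X ^ 4 * (Z * f) := by rw [hZ]; ring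
  rw [h1]
  simp only [map_add, PowerSeries.coeff_X_pow_mul', PowerSeries.coeff_C_mul]
  norm_num

variable [Algebra ℂ R]

/-- Doubling w amounts to X ↦ 2X in the points, while the M inverse differences lose a factor 2^M. A
coefficient of order r that does not depend on w must therefore vanish unless r = M. -/
theorem normEv_two_mul (M : ℕ) (b : NC R) (w : ℕ → ℕ) :
    2 ^ M * normEv M b (fun t => 2 * w t) = rescale (2 : R) (normEv M b w) := by
  have h1 : ∀ n, geom R (2 * n) = rescale (2 : R) (geom R n) := fun n => by
    ext r; simp [geom, mul_pow]
  have h2 : ∀ a b, 2 * invDiff (PowerSeries R) (2 * a) (2 * b) =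
      rescale (2 : R) (invDiff (PowerSeries R) a b) := fun a b => by
    have h3 : invDiff (PowerSeries R) a b = PowerSeries.C (invDiff R a b) :=
      PowerSeries.algebraMap_apply
    have h5 : ∀ r : R, rescale (2 : R) (PowerSeries.C r) = PowerSeries.C r := fun r => by
      ext n; cases n <;> simp [coeff_rescale, coeff_C]
    rw [h3, h5, ← h3, invDiff, invDiff]
    have h4 : ((2 * a : ℕ) - (2 * b : ℕ) : ℂ)⁻¹ = 2⁻¹ * ((a : ℂ) - b)⁻¹ := by
      rw [← mul_inv]; push_cast; ring_nf
    rw [h4, map_mul, ← mul_assoc, ← map_ofNat (algebraMap ℂ (PowerSeries R)) 2, ← map_mul]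
    norm_num
  have h5 : ev R (points R fun t => 2 * w t) b = rescale (2 : R) (ev R (points R w) b) := by
    have h6 := map_ev (rescaleAlgHom (2 : R)) (points R w) b
    have h7 : ∀ f : PowerSeries R, rescaleAlgHom (2 : R) f = rescale (2 : R) f :=
      fun f => DFunLike.congr_fun (coe_rescaleAlgHom (2 : R)) f
    simp only [h7] at h6
    rw [h6]
    congr 2
    funext t
    cases t with
    | zero => simp [points]
    | succ t =>
      have h8 : PowerSeries.C (2 : R) = 2 := map_ofNat _ 2
      simp only [points, map_mul, rescale_X, h8, map_natCast, Nat.cast_mul, Nat.cast_ofNat]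
      ring
  simp only [normEv, map_mul, map_prod]
  rw [h1, h1, h5, ← Finset.prod_congr rfl fun t _ => h2 (w t) (w (t + 1)),
    Finset.prod_mul_distrib, Finset.prod_const, Finset.card_range]
  ring

theorem coeff_normEv_eq_zero {α : ℂ} (hα : α ≠ 0) {M i : ℕ} {a : NC R}
    (ha : a ∈ homog R (i + 1) (M + 2)) (hb : bracket (leadHam (algebraMap ℂ R α)) a = 0)
    (hi : M + 3 ≤ i) {r : ℕ} (hr : r < i) {w : ℕ → ℕ} (hw : Set.InjOn w (Set.Iio (M + 1))) :
    coeff r (normEv M (dV a) w) = 0 := by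
  set A := algebraMap ℂ R α with hA
  have hd := dV_mem_homog ha
  induction r using Nat.strong_induction_on generalizing w with
  | _ r ih =>
  set Q : (ℕ → ℕ) → PowerSeries R := fun w => shiftDown r (normEv M (dV a) w) with hQ
  have hQc : ∀ w w' : ℕ → ℕ, (∀ t < M + 1, w t = w' t) → Q w = Q w' := fun w w' h => by
    simp only [hQ, normEv_congr hd h]
  have hG : ∀ w, Set.InjOn w (Set.Iio (M + 1)) → normEv M (dV a) w = X ^ r * Q w := fun w hw =>
    eq_X_pow_mul_shiftDown fun n hn => ih n hn (by omega) hw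
  have hQ0 : ∀ w, coeff r (normEv M (dV a) w) = coeff 0 (Q w) := fun w => by
    simp [hQ, shiftDown]
  have hinj : ∀ y : ℕ → ℕ, Set.InjOn y (Set.Iio (M + 2)) →
      Set.InjOn y (Set.Iio (M + 1)) ∧ Set.InjOn (fun t => y (t + 1)) (Set.Iio (M + 1)) :=
    fun y hy => ⟨hy.mono (Set.Iio_subset_Iio (by omega)), fun a ha b hb h => by
      have := hy (Set.mem_Iio.2 (Nat.succ_lt_succ ha)) (Set.mem_Iio.2 (Nat.succ_lt_succ hb)) h
      omega⟩
  have hE : ∀ y : ℕ → ℕ, Set.InjOn y (Set.Iio (M + 2)) → ∃ c c' : PowerSeries R,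
      endPotential A (y 0) * Q (fun t => y (t + 1)) - endPotential A (y (M + 1)) * Q y +
      X ^ 1 * ∑ k ∈ Finset.range (M + 1), PowerSeries.C (pairPotential A (y k) (y (k + 1))) *
        (Q (skip (k + 1) y) - Q (skip k y)) =
      X ^ (i - r) * (PowerSeries.C (1 + A) * c) + X ^ (i - r + 1) * c' := by
    intro y hy
    obtain ⟨c, c', h⟩ := normEv_equation A ha hb hy
    refine ⟨c, c', ?_⟩
    have hinj2 : Function.Injective (fun f : PowerSeries R => X ^ r * f) := fun f g h => by
      clear * - h
      induction r with
      | zero => simpa using h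
      | succ r ih => exact ih (X_mul_cancel (by
          simp only [pow_succ] at h
          linear_combination h))
    apply hinj2
    have h2 : (X : PowerSeries R) ^ i = X ^ r * X ^ (i - r) := by
      rw [← pow_add]; congr 1; omega
    rw [hG _ (hinj y hy).1, hG _ (hinj y hy).2,
      Finset.sum_congr rfl fun k _ => by
        rw [hG _ (skip_injOn hy), hG _ (skip_injOn hy), ← mul_sub, mul_left_comm],
      ← Finset.mul_sum, h2] at h
    linear_combination h
  -- Coefficients below order i - r have no right-hand side; for A = -1 the one of order i - r has
  -- none either. With r = M and i ≥ M + 3 this yields orders 0, 1, 2, and order 3 exactly when it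
  -- is needed.
  have hE' : ∀ y : ℕ → ℕ, Set.InjOn y (Set.Iio (M + 2)) → ∀ n, n < i - r ∨ n = i - r ∧ A = -1 →
      coeff n (endPotential A (y 0) * Q (fun t => y (t + 1))) -
      coeff n (endPotential A (y (M + 1)) * Q y) + (if 1 ≤ n then
        ∑ k ∈ Finset.range (M + 1), pairPotential A (y k) (y (k + 1)) *
        (coeff (n - 1) (Q (skip (k + 1) y)) - coeff (n - 1) (Q (skip k y))) else 0) = 0 := by
    intro y hy n hn
    obtain ⟨c, c', h⟩ := hE y hy
    have h1 := congrArg (coeff n) h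
    simp only [map_add, map_sub, coeff_X_pow_mul', map_sum, coeff_C_mul] at h1
    rw [h1, if_neg (show ¬ (i - r + 1 ≤ n) by omega)]
    rcases hn with hn | ⟨-, hn⟩
    · rw [if_neg (by omega), add_zero]
    · rw [hn, map_one]; simp
  -- In order 0 the equation reads A (q(shift y) - q(y)) = 0; here α ≠ 0 enters.
  have h0 : ∀ w w' : ℕ → ℕ, Set.InjOn w (Set.Iio (M + 1)) → Set.InjOn w' (Set.Iio (M + 1)) →
      coeff 0 (Q w) = coeff 0 (Q w') := fun w w' hw hw' =>
    eq_of_shift_invariant (N := M + 1) (q := fun w => coeff 0 (Q w))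
      (fun w w' h => by simp only [hQc w w' h]) (fun y hy => by
        have h := hE' y hy 0 (Or.inl (by omega))
        rw [(coeff_endPotential_mul A _ _).1, (coeff_endPotential_mul A _ _).1, if_neg (by omega),
          add_zero, ← mul_sub] at h
        exact sub_eq_zero.1 (eq_zero_of_complex_mul hα h)) hw hw'
  have hid : Set.InjOn (fun t : ℕ => t) (Set.Iio (M + 1)) := fun a _ b _ h => h
  have hid2 : Set.InjOn (fun t : ℕ => 2 * t) (Set.Iio (M + 1)) := fun a _ b _ h => by
    simp only at h; omega
  rw [hQ0, h0 w _ hw hid]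
  by_cases hrM : r = M
  · refine leading_eq_zero (α := α) (N := M + 1) (by omega) (q₀ := fun w => coeff 0 (Q w))
      (q₁ := fun w => coeff 1 (Q w)) (q₂ := fun w => coeff 2 (Q w)) (q₃ := fun w => coeff 3 (Q w))
      (fun w w' h => by simp only [hQc w w' h]) (fun w w' h => by simp only [hQc w w' h])
      (fun w hw => h0 w _ hw hid) ?_ ?_ ?_
    · intro y hy
      have h := hE' y hy 1 (Or.inl (by omega))
      rw [(coeff_endPotential_mul A _ _).2.1, (coeff_endPotential_mul A _ _).2.1,
        if_pos le_rfl, Finset.sum_eq_zero fun k _ => by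
          rw [h0 _ _ (skip_injOn hy) (skip_injOn hy), sub_self, mul_zero]] at h
      linear_combination h
    · intro y hy
      have h := hE' y hy 2 (Or.inl (by omega))
      rw [(coeff_endPotential_mul A _ _).2.2.1, (coeff_endPotential_mul A _ _).2.2.1,
        if_pos (by omega)] at h
      linear_combination h
    · intro hα1 y hy
      have h := hE' y hy 3 (by
        rcases Nat.lt_or_ge 3 (i - r) with h | h
        · exact Or.inl h
        · exact Or.inr ⟨by omega, by rw [hA, hα1, map_neg, map_one]⟩)
      rw [(coeff_endPotential_mul A _ _).2.2.2, (coeff_endPotential_mul A _ _).2.2.2,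
        if_pos (by omega)] at h
      linear_combination h
  · have h1 := congrArg (coeff r) (normEv_two_mul (R := R) M (dV a) (fun t => t))
    rw [coeff_rescale, hQ0, ← h0 _ _ hid2 hid, ← hQ0, ← map_ofNat (PowerSeries.C (R := R)) 2,
      ← map_pow, coeff_C_mul] at h1
    rw [h0 _ _ hid hid2, ← hQ0]
    refine eq_zero_of_complex_mul (r := 2 ^ M - 2 ^ r) ?_ ?_
    · rw [sub_ne_zero]
      intro h
      have h2 : 2 ^ M = 2 ^ r := by exact_mod_cast h
      exact hrM (Nat.pow_right_injective le_rfl h2).symm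
    · rw [map_sub, map_pow, map_pow, map_ofNat]
      linear_combination h1

/-- The values at the points `1, w 0 * X, w 1 * X, …` vanish to high order. -/
theorem coeff_ev_points_eq_zero {α : ℂ} (hα : α ≠ 0) {M i : ℕ} {a : NC R}
    (ha : a ∈ homog R (i + 1) (M + 2)) (hb : bracket (leadHam (algebraMap ℂ R α)) a = 0)
    (hi : M + 3 ≤ i) {r : ℕ} (hr : r < i) {w : ℕ → ℕ} (hw : Set.InjOn w (Set.Iio (M + 1))) :
    coeff r (ev R (points R w) (dV a)) = 0 := by
  have h1 : (X : PowerSeries R) ^ i ∣ normEv M (dV a) w :=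
    X_pow_dvd_iff.2 fun m hm => coeff_normEv_eq_zero hα ha hb hi hm hw
  refine X_pow_dvd_iff.1 ?_ r hr
  have h2 : ev R (points R w) (dV a) = normEv M (dV a) w *
      ((1 - X * (w 0 : PowerSeries R)) * (1 - X * (w M : PowerSeries R)) *
        ∏ t ∈ Finset.range M, ((w t : PowerSeries R) - w (t + 1))) := by
    have h3 : (∏ t ∈ Finset.range M, ((w t : PowerSeries R) - w (t + 1))) *
        (∏ t ∈ Finset.range M, invDiff (PowerSeries R) (w t) (w (t + 1))) = 1 := by
      rw [← Finset.prod_mul_distrib]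
      refine Finset.prod_eq_one fun t ht => sub_mul_invDiff fun h => ?_
      have ht := Finset.mem_range.1 ht
      have := hw (Set.mem_Iio.2 (by omega)) (Set.mem_Iio.2 (by omega)) h
      omega
    have h4 := one_sub_mul_geom (R := R) (w 0)
    have h5 := one_sub_mul_geom (R := R) (w M)
    rw [normEv]
    have h6 : (1 - X * (w 0 : PowerSeries R)) * geom R (w 0) *
      ((1 - X * (w M : PowerSeries R)) * geom R (w M)) *
      ((∏ t ∈ Finset.range M, ((w t : PowerSeries R) - w (t + 1))) *
        (∏ t ∈ Finset.range M, invDiff (PowerSeries R) (w t) (w (t + 1)))) = 1 := by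
      rw [h3, h4, h5, one_mul, one_mul]
    linear_combination -(ev R (points R w) (dV a)) * h6
  rw [h2]
  exact h1.mul_right _

end Vanishing

/-! ### Recovering a word from its monomial -/

section Gaps

/-- The numbers of letters `u` between consecutive letters `v` of a word. -/
def gaps : List (Fin 2) → ℕ → ℕ
  | [] => fun _ => 0
  | i :: l => if i = 0 then fun t => if t = 0 then gaps l 0 + 1 else gaps l t
      else fun t => if t = 0 then 0 else gaps l (t - 1)

/-- The word with `n` letters `v` and with prescribed gaps. -/
def ofGaps : ℕ → (ℕ → ℕ) → List (Fin 2)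
  | 0, d => List.replicate (d 0) 0
  | n + 1, d => List.replicate (d 0) 0 ++ 1 :: ofGaps n fun t => d (t + 1)

theorem ofGaps_congr {n : ℕ} {d d' : ℕ → ℕ} (h : ∀ t ≤ n, d t = d' t) : ofGaps n d = ofGaps n d' := by
  induction n generalizing d d' with
  | zero => simp only [ofGaps, h 0 le_rfl]
  | succ n ih =>
    simp only [ofGaps, h 0 (by omega)]
    rw [ih fun t ht => h (t + 1) (by omega)]

theorem ofGaps_gaps (l : List (Fin 2)) : ofGaps (l.count 1) (gaps l) = l := by
  induction l with
  | nil => rfl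
  | cons i l ih =>
    fin_cases i
    · simp only [gaps, Fin.zero_eta, if_true]
      rw [List.count_cons_of_ne (by decide)]
      conv_rhs => rw [← ih]
      cases List.count 1 l with
      | zero => simp [ofGaps, List.replicate_succ]
      | succ n => simp [ofGaps, List.replicate_succ]
    · simp only [gaps, Fin.mk_one, one_ne_zero, if_false, List.count_cons_self, ofGaps, if_true,
        List.replicate_zero, List.nil_append]
      congr 1

theorem evWord_eq_prod {L : Type*} [CommRing L] (y : ℕ → L) {l : List (Fin 2)} {n : ℕ}
    (h : l.count 1 = n) : evWord y l = ∏ t ∈ Finset.range (n + 1), y t ^ gaps l t := by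
  subst h
  induction l generalizing y with
  | nil => simp [evWord, gaps]
  | cons i l ih =>
    fin_cases i
    · simp only [evWord, gaps, Fin.zero_eta, if_true]
      rw [List.count_cons_of_ne (by decide), ih, Finset.prod_range_succ', Finset.prod_range_succ']
      simp [pow_succ]
      ring
    · simp only [evWord, gaps, Fin.mk_one, one_ne_zero, if_false, List.count_cons_self]
      rw [ih, Finset.prod_range_succ' _ (List.count 1 l + 1)]
      simp

end Gaps

/-! ### Polynomials over R on grids of natural numbers -/

section Grid

variable {R : Type*} [CommRing R] [Algebra ℂ R]

/-- A polynomial that vanishes on an infinite grid of natural numbers is zero. -/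
theorem eq_zero_of_eval_natCast {σ : Type*} [Finite σ] {p : MvPolynomial σ R} (s : σ → Set ℕ)
    (hs : ∀ i, (s i).Infinite)
    (h : ∀ x : σ → ℕ, (∀ i, x i ∈ s i) → MvPolynomial.eval (fun i => (x i : R)) p = 0) :
    p = 0 := by
  have := Fintype.ofFinite σ
  ext d
  -- R may have zero divisors. As a complex vector space its elements are separated by linear
  -- functionals, which reduces the claim to complex coefficients.
  rw [MvPolynomial.coeff_zero, ← Module.forall_dual_apply_eq_zero_iff ℂ]
  intro φ
  set q : MvPolynomial σ ℂ := ∑ d ∈ p.support, MvPolynomial.monomial d (φ (p.coeff d)) with hq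
  have hq0 : q = 0 := by
    refine MvPolynomial.funext_set (fun i => (fun n : ℕ => (n : ℂ)) '' s i)
      (fun i => (hs i).image Nat.cast_injective.injOn) fun x hx => ?_
    choose y hy hyx using fun i => hx i (Set.mem_univ i)
    obtain rfl : (fun i => (y i : ℂ)) = x := funext hyx
    rw [map_zero, hq, map_sum]
    have h1 := congrArg φ (h y hy)
    rw [MvPolynomial.eval_eq', map_sum, map_zero] at h1
    rw [← h1]
    refine Finset.sum_congr rfl fun d _ => ?_
    rw [MvPolynomial.eval_monomial, Finsupp.prod_fintype _ _ (by simp)]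
    have h2 : p.coeff d * ∏ i, (y i : R) ^ d i = (∏ i, (y i : ℂ) ^ d i) • p.coeff d := by
      rw [Algebra.smul_def, map_prod, mul_comm]
      simp
    rw [h2, map_smul, smul_eq_mul, mul_comm]
  have h3 : q.coeff d = φ (p.coeff d) := by
    classical
    rw [hq, MvPolynomial.coeff_sum]
    simp only [MvPolynomial.coeff_monomial]
    rw [Finset.sum_ite_eq']
    split_ifs with h
    · rfl
    · rw [MvPolynomial.notMem_support_iff.1 h, map_zero]
  rw [← h3, hq0, MvPolynomial.coeff_zero]

/-- The low order terms of a homogeneous polynomial along a family of lines. -/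
theorem le_degree_sub_of_coeff_eq_zero {σ : Type*} [Fintype σ] [DecidableEq σ] (o : σ)
    {p : MvPolynomial σ R} {I K : ℕ} (hp : p.IsHomogeneous I) (s : σ → Set ℕ)
    (hs : ∀ i, (s i).Infinite)
    (h : ∀ w : σ → ℕ, (∀ i, w i ∈ s i) → ∀ r < K, PowerSeries.coeff r (MvPolynomial.aeval
      (fun i => if i = o then 1 else PowerSeries.X * (w i : PowerSeries R)) p) = 0)
    {d : σ →₀ ℕ} (hd : p.coeff d ≠ 0) : d o + K ≤ I := by
  have hdeg : ∀ d, p.coeff d ≠ 0 → ∑ i, d i = I := fun d hd => by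
    rw [← hp hd, Finsupp.weight_apply, Finsupp.sum_fintype _ _ (by simp)]
    simp
  by_contra! hlt
  set e := d o with he
  have heI : e ≤ I := by
    rw [← hdeg d hd]; exact Finset.single_le_sum (fun i _ => Nat.zero_le _) (Finset.mem_univ o)
  set q : MvPolynomial σ R :=
    ∑ d ∈ p.support with d o = e, MvPolynomial.monomial d (p.coeff d) with hq
  have hq0 : q = 0 := by
    refine eq_zero_of_eval_natCast s hs fun x hx => ?_
    have h1 := h x hx (I - e) (by omega)
    rw [MvPolynomial.aeval_def, MvPolynomial.eval₂_eq', map_sum] at h1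
    -- By homogeneity a monomial with exponent d o contributes exactly in order I - d o, so this
    -- coefficient isolates the monomials with d o = e.
    have h2 : ∀ d ∈ p.support, PowerSeries.coeff (I - e) (algebraMap R (PowerSeries R) (p.coeff d) *
        ∏ i, (if i = o then 1 else PowerSeries.X * (x i : PowerSeries R)) ^ d i) =
        if d o = e then p.coeff d * ∏ i ∈ Finset.univ.erase o, (x i : R) ^ d i else 0 := by
      intro d hd
      have h3 := hdeg d (MvPolynomial.mem_support_iff.1 hd)
      rw [← Finset.add_sum_erase _ _ (Finset.mem_univ o)] at h3
      rw [← Finset.mul_prod_erase _ _ (Finset.mem_univ o), if_pos rfl, one_pow, one_mul,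
        Finset.prod_congr rfl fun i hi => by rw [if_neg (Finset.ne_of_mem_erase hi), mul_pow],
        Finset.prod_mul_distrib, Finset.prod_pow_eq_pow_sum]
      have h4 : ∏ i ∈ Finset.univ.erase o, (x i : PowerSeries R) ^ d i =
          PowerSeries.C (∏ i ∈ Finset.univ.erase o, (x i : R) ^ d i) := by simp
      rw [h4, show algebraMap R (PowerSeries R) (p.coeff d) = PowerSeries.C (p.coeff d) from rfl,
        PowerSeries.coeff_C_mul, PowerSeries.coeff_X_pow_mul', PowerSeries.coeff_C]
      by_cases h5 : d o = e
      · rw [if_pos (by omega), if_pos (by omega), if_pos h5]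
      · rw [if_neg h5]
        by_cases h6 : ∑ i ∈ Finset.univ.erase o, d i ≤ I - e
        · rw [if_pos h6, if_neg (by omega), mul_zero]
        · rw [if_neg h6, mul_zero]
    rw [Finset.sum_congr rfl h2, ← Finset.sum_filter] at h1
    rw [hq, map_sum, ← mul_zero ((x o : R) ^ e), ← h1, Finset.mul_sum]
    refine Finset.sum_congr rfl fun d hd => ?_
    rw [MvPolynomial.eval_monomial, Finsupp.prod_fintype _ _ (by simp),
      ← Finset.mul_prod_erase _ _ (Finset.mem_univ o), (Finset.mem_filter.1 hd).2]
    ring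
  refine hd ?_
  have h3 : q.coeff d = p.coeff d := by
    rw [hq, MvPolynomial.coeff_sum]
    simp only [MvPolynomial.coeff_monomial]
    rw [Finset.sum_ite_eq', if_pos]
    exact Finset.mem_filter.2 ⟨MvPolynomial.mem_support_iff.2 hd, rfl⟩
  rw [← h3, hq0, MvPolynomial.coeff_zero]

end Grid

/-! ### Rigidity of elements commuting with the leading part -/

section Rigidity

variable {R : Type*} [CommRing R]

/-- The generic value of an element of degree `N` in `V`, with cyclically indexed variables. -/
noncomputable def genericEv (R : Type*) [CommRing R] (N : ℕ) :
    NC R →ₗ[R] MvPolynomial (ZMod (N + 1)) R :=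
  ev R fun t => MvPolynomial.X (t : ZMod (N + 1))

theorem isHomogeneous_genericEv {N i j : ℕ} {b : NC R} (hb : b ∈ homog R i j) :
    (genericEv R N b).IsHomogeneous i := by
  refine homog_induction (p := fun b => (genericEv R N b).IsHomogeneous i) ?_ ?_ ?_ ?_ hb
  · rintro l rfl -
    rw [genericEv, ev_word]
    clear hb
    have h : ∀ g : ℕ → ZMod (N + 1),
        (evWord (fun t => (MvPolynomial.X (g t) : MvPolynomial (ZMod (N + 1)) R)) l).IsHomogeneous
          (l.count 0) := by
      intro g
      induction l generalizing g with
      | nil => exact MvPolynomial.isHomogeneous_one _ _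
      | cons k l ih =>
        fin_cases k
        · simp only [evWord, Fin.zero_eta, if_true, List.count_cons_self]
          rw [add_comm (List.count 0 l) 1]
          exact (MvPolynomial.isHomogeneous_X _ _).mul (ih _)
        · simp only [evWord, Fin.mk_one, one_ne_zero, if_false]
          rw [List.count_cons_of_ne (by decide)]
          exact ih _
    exact h fun t => (t : ZMod (N + 1))
  · rw [map_zero]; exact MvPolynomial.isHomogeneous_zero _ _ _
  · intro a b ha hb; rw [map_add]; exact ha.add hb
  · intro r a ha
    rw [map_smul]
    exact (MvPolynomial.homogeneousSubmodule (ZMod (N + 1)) R i).smul_mem r ha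

/-- The exponents are the gaps between the letters v and determine the word, so reading a word off
each monomial is a left inverse on this degree. -/
theorem eq_zero_of_genericEv_eq_zero {N i : ℕ} {b : NC R} (hb : b ∈ homog R i N)
    (h : genericEv R N b = 0) : b = 0 := by
  set Ψ : MvPolynomial (ZMod (N + 1)) R →ₗ[R] NC R :=
    (MvPolynomial.basisMonomials (ZMod (N + 1)) R).constr R
      fun d => word (ofGaps N fun t => d (t : ZMod (N + 1))) with hΨ
  have h1 : Ψ (genericEv R N b) = b := by
    refine homog_induction (p := fun b => Ψ (genericEv R N b) = b) ?_ ?_ ?_ ?_ hb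
    · rintro l - hl
      rw [genericEv, ev_word, evWord_eq_prod _ hl]
      set d : ZMod (N + 1) →₀ ℕ := ∑ t ∈ Finset.range (N + 1),
        Finsupp.single (t : ZMod (N + 1)) (gaps l t) with hd
      have h2 : ∏ t ∈ Finset.range (N + 1),
          (MvPolynomial.X (t : ZMod (N + 1)) : MvPolynomial (ZMod (N + 1)) R) ^ gaps l t =
          MvPolynomial.basisMonomials (ZMod (N + 1)) R d := by
        rw [MvPolynomial.coe_basisMonomials, hd]
        beta_reduce
        rw [MvPolynomial.monomial_sum_one]
        simp only [MvPolynomial.X_pow_eq_monomial]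
      rw [h2, hΨ, Module.Basis.constr_basis]
      congr 1
      conv_rhs => rw [← ofGaps_gaps l, hl]
      refine ofGaps_congr fun t ht => ?_
      rw [hd, Finsupp.finsetSum_apply, Finset.sum_eq_single t]
      · simp
      · intro t' ht' hne
        refine Finsupp.single_eq_of_ne fun h => hne ?_
        have ht' := Finset.mem_range.1 ht'
        rw [ZMod.natCast_eq_natCast_iff', Nat.mod_eq_of_lt (by omega), Nat.mod_eq_of_lt (by omega)] at h
        omega
      · intro h; exact absurd (Finset.mem_range.2 (by omega)) h
    · simp
    · intro a b ha hb; rw [map_add, map_add, ha, hb]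
    · intro r a ha; rw [map_smul, map_smul, ha]
  rw [← h1, h, map_zero]

theorem rename_genericEv {N i : ℕ} {a : NC R} (ha : a ∈ homog R i (N + 1)) (k : ZMod (N + 1)) :
    MvPolynomial.rename (· + k) (genericEv R N (dV a)) = genericEv R N (dV a) := by
  rw [genericEv, map_ev, ← ev_dV_rotate_iterate ha
    (y := fun t : ℕ => (MvPolynomial.X (t : ZMod (N + 1)) : MvPolynomial (ZMod (N + 1)) R))
    (fun t => by
      have h : ((t + (N + 1) : ℕ) : ZMod (N + 1)) = t := by
        rw [Nat.cast_add, ZMod.natCast_self, add_zero]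
      rw [h]) k.val]
  congr 2
  funext t
  rw [MvPolynomial.rename_X, Nat.cast_add, ZMod.natCast_zmod_val]

variable [Algebra ℂ R]

theorem dV_eq_zero_of_bracket_leadHam_eq_zero' {α : ℂ} (hα : α ≠ 0) {M i : ℕ} {a : NC R}
    (ha : a ∈ homog R (i + 1) (M + 2)) (hb : bracket (leadHam (algebraMap ℂ R α)) a = 0)
    (hi : M + 3 ≤ i) : dV a = 0 := by
  have hd := dV_mem_homog ha
  rw [show M + 2 - 1 = M + 1 from rfl] at hd
  refine eq_zero_of_genericEv_eq_zero hd ?_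
  set p := genericEv R (M + 1) (dV a) with hp
  have hhom : p.IsHomogeneous (i + 1) := isHomogeneous_genericEv hd
  have key : ∀ d, p.coeff d ≠ 0 → d 0 + i ≤ i + 1 := fun d hd0 => by
    -- The variable k takes values in the residue class of k, so different variables automatically
    -- get different values.
    refine le_degree_sub_of_coeff_eq_zero 0 hhom
      (fun k => {n : ℕ | (n : ZMod (M + 1 + 1)) = k}) (fun k => ?_) (fun w hw r hr => ?_) hd0
    · refine Set.infinite_of_injective_forall_mem (f := fun n => k.val + n * (M + 1 + 1))
        (fun a b h => by simpa using h) fun n => ?_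
      rw [Set.mem_ofPred_eq, Nat.cast_add, Nat.cast_mul, ZMod.natCast_self, mul_zero, add_zero,
        ZMod.natCast_zmod_val]
    · rw [hp, genericEv, map_ev, ← coeff_ev_points_eq_zero (R := R) hα ha hb hi hr
        (w := fun t => w ((t + 1 : ℕ) : ZMod (M + 1 + 1)))]
      · congr 1
        refine ev_congr hd fun t ht => ?_
        rw [MvPolynomial.aeval_X]
        cases t with
        | zero => simp [points]
        | succ t =>
          rw [if_neg]
          · rfl
          · rw [ZMod.natCast_eq_zero_iff]
            exact fun h => by have := Nat.le_of_dvd (by omega) h; omega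
      · intro t ht t' ht' h
        have h1 := hw ((t + 1 : ℕ) : ZMod (M + 1 + 1))
        have h2 := hw ((t' + 1 : ℕ) : ZMod (M + 1 + 1))
        simp only [Set.mem_ofPred_eq, Set.mem_Iio] at h1 h2 ht ht' h
        rw [h, h2, ZMod.natCast_eq_natCast_iff', Nat.mod_eq_of_lt (by omega),
          Nat.mod_eq_of_lt (by omega)] at h1
        omega
  ext d
  rw [MvPolynomial.coeff_zero]
  by_contra hd0
  -- The bound on the exponent of the variable 0 is carried to the variable k by cyclic invariance.
  have h1 : ∀ k, d k ≤ 1 := fun k => by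
    have h2 := MvPolynomial.coeff_rename_mapDomain (· + -k) (add_left_injective (-k)) p d
    rw [hp, rename_genericEv ha, ← hp] at h2
    have h3 := key _ (h2.trans_ne hd0)
    have h4 : Finsupp.mapDomain (· + -k) d 0 = d k := by
      rw [← Finsupp.mapDomain_apply (add_left_injective (-k)) d k]
      simp
    omega
  have h2 : ∑ k, d k = i + 1 := by
    rw [← hhom hd0, Finsupp.weight_apply, Finsupp.sum_fintype _ _ (by simp)]
    simp
  have h3 := Finset.sum_le_sum fun (k : ZMod (M + 1 + 1)) (_ : k ∈ Finset.univ) => h1 k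
  rw [h2, Finset.sum_const, Finset.card_univ, ZMod.card, smul_eq_mul] at h3
  omega

/-- Homogeneous elements that commute with the leading part of the Hamiltonian and whose degree in
`U` is large are independent of `V`. -/
theorem dV_eq_zero_of_bracket_leadHam_eq_zero {α : ℂ} (hα : α ≠ 0) {i j : ℕ} {a : NC R}
    (ha : a ∈ homog R i j) (hb : bracket (leadHam (algebraMap ℂ R α)) a = 0)
    (hij : j + 2 ≤ i) : dV a = 0 := by
  obtain ⟨i, rfl⟩ : ∃ i', i = i' + 1 := ⟨i - 1, by omega⟩
  rcases j with _ | _ | M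
  · exact dV_eq_zero_of_homog_zero ha
  · have hd := dV_mem_homog ha
    rw [show 0 + 1 - 1 = 0 from rfl] at hd
    -- With a single letter v, ∂a/∂v is a multiple of a power of u. The closed path through 1 and 0
    -- suffices: the value at 0 is zero, and the value at 1 has coefficient 2α - 3α = -α.
    set x : ℕ → R := fun k => if k % 2 = 0 then 1 else 0 with hx
    set κ : ℕ → R := fun k => if k % 2 = 0 then algebraMap ℂ R α else -algebraMap ℂ R α with hκ
    have h := sum_ev_dV_eq_zero (algebraMap ℂ R α) ha hb (x := x) (κ := κ)
      (fun k => by simp [hx]) (fun k => by simp [hκ]) (fun k => by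
        rcases Nat.mod_two_eq_zero_or_one k with h | h
        · simp [hx, hκ, h, Nat.add_mod]
        · simp [hx, hκ, h, Nat.add_mod])
    have h0 : ev R (fun t => x (1 + 2 + t)) (dV a) = 0 := by
      rw [ev_congr hd (y' := fun t => 0 * x t) fun t ht => by
        obtain rfl : t = 0 := by omega
        simp [hx], ev_mul_left 0 x hd]
      simp
    have h1 : ev R (fun t => x (0 + 2 + t)) (dV a) = ev R (fun _ => (1 : R)) (dV a) :=
      ev_congr hd fun t ht => by
        obtain rfl : t = 0 := by omega
        simp [hx]
    rw [Finset.sum_range_succ, Finset.sum_range_one, h0, h1] at h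
    have h2 : ev R (fun _ => (1 : R)) (dV a) = 0 := by
      refine eq_zero_of_complex_mul hα ?_
      simp [hx, hκ] at h
      linear_combination -h
    refine eq_zero_of_genericEv_eq_zero hd ?_
    have h3 := map_ev (Algebra.ofId R (MvPolynomial (ZMod (0 + 1)) R)) (fun _ => (1 : R)) (dV a)
    rw [h2, map_zero] at h3
    rw [genericEv, ev_congr hd (y' := fun t => MvPolynomial.X 0 * Algebra.ofId R
      (MvPolynomial (ZMod (0 + 1)) R) 1) fun t ht => by
        obtain rfl : t = 0 := by omega
        simp, ev_mul_left _ _ hd, ← h3, mul_zero]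
  · exact dV_eq_zero_of_bracket_leadHam_eq_zero' hα ha hb (by omega)

end Rigidity

/-! ### Reduction of non-existence to the leading part -/

section Nonexistence

variable {R : Type*} [CommRing R]

theorem exists_comp_eq_zero (a : NC R) : ∃ K, ∀ i j, K ≤ i ∨ K ≤ j → comp i j a = 0 := by
  induction a using word_induction with
  | hw l =>
    refine ⟨l.count 0 + l.count 1 + 1, fun i j h => ?_⟩
    rw [comp_word, if_neg (by omega)]
  | h0 => exact ⟨0, fun i j _ => map_zero _⟩
  | hadd a b ha hb =>
    obtain ⟨K, hK⟩ := ha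
    obtain ⟨L, hL⟩ := hb
    exact ⟨max K L, fun i j h => by rw [map_add, hK i j (by omega), hL i j (by omega), add_zero]⟩
  | hsmul r a ha =>
    obtain ⟨K, hK⟩ := ha
    exact ⟨K, fun i j h => by rw [map_smul, hK i j h, smul_zero]⟩

/-- The specialization `u = T ^ 5`, `v = T ^ 7`. -/
noncomputable def weightEval : NC R →ₐ[R] Polynomial R :=
  (MvPolynomial.aeval ![Polynomial.X ^ 5, Polynomial.X ^ 7]).comp scalarReduction

theorem weightEval_U : weightEval (U : NC R) = Polynomial.X ^ 5 := by
  simp [weightEval, scalarReduction_U]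

theorem weightEval_V : weightEval (V : NC R) = Polynomial.X ^ 7 := by
  simp [weightEval, scalarReduction_V]

theorem weightEval_word (l : List (Fin 2)) :
    weightEval (word l : NC R) = Polynomial.X ^ (5 * l.count 0 + 7 * l.count 1) := by
  induction l with
  | nil => simp [word]
  | cons i l ih =>
    rw [word_cons, map_mul, ih]
    fin_cases i
    · have h := weightEval_U (R := R)
      rw [U] at h
      simp only [Fin.zero_eta, h, ← pow_add, List.count_cons_self]
      rw [List.count_cons_of_ne (by decide)]
      congr 1
      ring
    · have h := weightEval_V (R := R)
      rw [V] at h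
      simp only [Fin.mk_one, h, ← pow_add, List.count_cons_self]
      rw [List.count_cons_of_ne (by decide)]
      congr 1
      ring

/-- The only solution of 5m + 7n = 58 in natural numbers is (6, 4), so the weights 5 and 7 isolate
this bidegree. It is twice the bidegree (3, 2), whose weight 29 is the largest in the Hamiltonian.
-/
theorem coeff_weightEval_comp (a : NC R) :
    (weightEval (comp 6 4 a)).coeff 58 = (weightEval a).coeff 58 := by
  induction a using word_induction with
  | hw l =>
    rw [comp_word]
    split_ifs with h
    · rfl
    · rw [map_zero, Polynomial.coeff_zero, weightEval_word, Polynomial.coeff_X_pow, if_neg]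
      omega
  | h0 => simp
  | hadd a b ha hb => simp only [map_add, Polynomial.coeff_add, ha, hb]
  | hsmul r a ha => simp only [map_smul, Polynomial.coeff_smul, ha]

theorem weightEval_eq_zero_of_mem_commutators {a : NC R} (ha : a ∈ commutators R) :
    weightEval a = 0 :=
  apply_eq_zero_of_mem_commutators weightEval.toLinearMap (fun l m => by
    simp only [AlgHom.toLinearMap_apply, word_append, map_mul, mul_comm]) ha

theorem poisson_eq_zero_of_mem_commutators (a : NC R) {b : NC R} (hb : b ∈ commutators R) :
    poisson a b = 0 := by
  have h0 : dU b = 0 := ncDeriv_eq_zero_of_mem_commutators 0 hb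
  have h1 : dV b = 0 := ncDeriv_eq_zero_of_mem_commutators 1 hb
  rw [poisson_apply, h0, h1, mul_zero, mul_zero, sub_zero]

/-- The Hamiltonians with leading part `leadHam`. -/
noncomputable def quinticHam (A b b' e q₂ q₁ q₀ κ : R) : NC R :=
  leadHam A + (b • (U * U * V * V) + b' • (U * V * U * V)) + e • (U * V * V) +
    q₂ • (U * U * V) + q₁ • (U * V) + q₀ • V + κ • U

theorem coeff_weightEval_quinticHam_sq (A b b' e q₂ q₁ q₀ κ : R) :
    (weightEval (quinticHam A b b' e q₂ q₁ q₀ κ) ^ 2).coeff 58 = 1 := by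
  have h : weightEval (quinticHam A b b' e q₂ q₁ q₀ κ) = Polynomial.X ^ 29 +
      Polynomial.C (b + b') * Polynomial.X ^ 24 + Polynomial.C e * Polynomial.X ^ 19 +
      Polynomial.C q₂ * Polynomial.X ^ 17 + Polynomial.C q₁ * Polynomial.X ^ 12 +
      Polynomial.C q₀ * Polynomial.X ^ 7 + Polynomial.C κ * Polynomial.X ^ 5 := by
    simp only [quinticHam, leadHam, map_add, map_smul, map_mul, weightEval_U, weightEval_V,
      Polynomial.smul_eq_C_mul, map_sub, map_one]
    ring
  rw [h, Polynomial.coeff_pow_of_natDegree_le (n := 29) (m := 2) (by compute_degree)]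
  simp only [Polynomial.coeff_add, Polynomial.coeff_C_mul, Polynomial.coeff_X_pow]
  norm_num

variable [Algebra ℂ R]

/-- By Euler's identity j times the trace vanishes, and j is invertible. -/
theorem mem_commutators_of_dV_eq_zero {i j : ℕ} (hj : j ≠ 0) {a : NC R} (ha : a ∈ homog R i j)
    (h : dV a = 0) : a ∈ commutators R := by
  have h1 := trace_V_mul_dV ha
  rw [h, mul_zero, ← trace_smul, trace_eq_trace_iff, zero_sub, neg_mem_iff] at h1
  have h2 := (commutators R).smul_mem (algebraMap ℂ R (j : ℂ)⁻¹) h1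
  rwa [smul_smul, ← map_natCast (algebraMap ℂ R), ← map_mul,
    inv_mul_cancel₀ (by exact_mod_cast hj), map_one, one_smul] at h2

theorem bracket_quinticHam_ne_zero [Nontrivial R] {α : ℂ} (hα : α ≠ 0)
    (b b' e q₂ q₁ q₀ κ : R) {S : NC R}
    (hS : weightEval S = weightEval (quinticHam (algebraMap ℂ R α) b b' e q₂ q₁ q₀ κ) ^ 2) :
    bracket (quinticHam (algebraMap ℂ R α) b b' e q₂ q₁ q₀ κ) S ≠ 0 := by
  intro h0
  classical
  obtain ⟨K, hK⟩ := exists_comp_eq_zero S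
  set B : Finset (ℕ × ℕ) := (Finset.range K ×ˢ Finset.range K).filter
    fun x => x.2 + 2 ≤ x.1 ∧ dV (comp x.1 x.2 S) ≠ 0 with hB
  have hmemB : ∀ i j, (i, j) ∈ B ↔ j + 2 ≤ i ∧ dV (comp i j S) ≠ 0 := fun i j => by
    simp only [hB, Finset.mem_filter, Finset.mem_product, Finset.mem_range, and_iff_right_iff_imp]
    rintro ⟨-, h⟩
    by_contra hlt
    exact h (by rw [hK i j (by omega), map_zero])
  have hlt : ∀ i j, (i, j) ∈ B → j < K := fun i j h => by
    simp only [hB, Finset.mem_filter, Finset.mem_product, Finset.mem_range] at h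
    exact h.1.2
  have h64 : (6, 4) ∈ B := by
    refine (hmemB 6 4).2 ⟨by omega, fun h => ?_⟩
    have h1 := coeff_weightEval_comp S
    rw [weightEval_eq_zero_of_mem_commutators
      (mem_commutators_of_dV_eq_zero (by omega) (comp_mem_homog 6 4 S) h), hS,
      coeff_weightEval_quinticHam_sq, Polynomial.coeff_zero] at h1
    exact zero_ne_one h1
  -- Since j < K on B, this weight orders lexicographically by i - j and then by j.
  obtain ⟨⟨i, j⟩, hij, hmax⟩ := B.exists_max_image (fun x => (x.1 - x.2) * K + x.2) ⟨_, h64⟩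
  obtain ⟨hij2, hdV⟩ := (hmemB i j).1 hij
  have hj : j ≠ 0 := by
    rintro rfl
    exact hdV (dV_eq_zero_of_homog_zero (comp_mem_homog i 0 S))
  have hgood : ∀ i' j', j ≤ j' → j' + 2 ≤ i' →
      (i - j < i' - j' ∨ i - j = i' - j' ∧ j < j') → comp i' j' S ∈ commutators R := by
    intro i' j' hj' hij' hlt'
    refine mem_commutators_of_dV_eq_zero (by omega) (comp_mem_homog i' j' S) ?_
    by_contra hne
    have h1 := hmax (i', j') ((hmemB i' j').2 ⟨hij', hne⟩)
    have h2 := hlt i j hij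
    simp only at h1
    rcases hlt' with h3 | ⟨h3, h4⟩
    · have h5 : (i - j + 1) * K ≤ (i' - j') * K := Nat.mul_le_mul_right K h3
      rw [add_mul] at h5
      omega
    · rw [h3] at h1
      omega
  refine hdV (dV_eq_zero_of_bracket_leadHam_eq_zero hα (comp_mem_homog i j S) ?_ hij2)
  rw [bracket_eq_zero_iff] at h0 ⊢
  -- In bidegree (i + 2, j + 1) a term of H of bidegree (p, q) meets the component (i + 3 - p, j + 2
  -- - q) of S. For all terms but the leading one, p - q ≤ 0, or p - q = 1 with q < 2; the component
  -- met is then larger in the chosen order and is a sum of commutators.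
  have h1 := comp_mem_commutators (i + 2) (j + 1) h0
  have hz : ∀ {p q : ℕ} {h : NC R}, h ∈ homog R p q → p ≤ i + 3 → q ≤ j + 2 →
      comp (i + 3 - p) (j + 2 - q) S ∈ commutators R →
      comp (i + 2) (j + 1) (poisson h S) = 0 := fun {p q h} hh hp hq hc => by
    rw [comp_poisson hh (i + 2) (j + 1) hp hq]
    exact poisson_eq_zero_of_mem_commutators h hc
  have hw : ∀ (r : R) (l : List (Fin 2)) {p q : ℕ}, l.count 0 = p → l.count 1 = q →
      r • (word l : NC R) ∈ homog R p q :=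
    fun r l _ _ hp hq => Submodule.smul_mem _ _ (word_mem_homog_of_count hp hq)
  simp only [quinticHam, poisson_add_left, map_add] at h1
  simp only [U_eq_word, V_eq_word, ← word_append, List.cons_append, List.nil_append] at h1
  rw [comp_poisson (leadHam_mem_homog _) (i + 2) (j + 1) (by omega) (by omega),
    hz (p := 2) (q := 2) (hw b [0, 0, 1, 1] rfl rfl) (by omega) (by omega)
      (hgood _ _ (by omega) (by omega) (by omega)),
    hz (p := 2) (q := 2) (hw b' [0, 1, 0, 1] rfl rfl) (by omega) (by omega)
      (hgood _ _ (by omega) (by omega) (by omega)),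
    hz (p := 1) (q := 2) (hw e [0, 1, 1] rfl rfl) (by omega) (by omega)
      (hgood _ _ (by omega) (by omega) (by omega)),
    hz (p := 2) (q := 1) (hw q₂ [0, 0, 1] rfl rfl) (by omega) (by omega)
      (hgood _ _ (by omega) (by omega) (by omega)),
    hz (p := 1) (q := 1) (hw q₁ [0, 1] rfl rfl) (by omega) (by omega)
      (hgood _ _ (by omega) (by omega) (by omega)),
    hz (p := 0) (q := 1) (hw q₀ [1] rfl rfl) (by omega) (by omega)
      (hgood _ _ (by omega) (by omega) (by omega)),
    hz (p := 1) (q := 0) (hw κ [0] rfl rfl) (by omega) (by omega)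
      (hgood _ _ (by omega) (by omega) (by omega))]
    at h1
  simpa using h1

theorem α_eq_zero_of_hasSecond [Nontrivial R] {k : PType} {c : Consts} {z : R}
    (h : HasSecond k c z) (hk : k = .P5 ∨ k = .P6) : c.α = 0 := by
  obtain ⟨S, -, hS, hb⟩ := h
  by_contra hα
  obtain ⟨b, b', e, q₂, q₁, q₀, κ, hH⟩ : ∃ b b' e q₂ q₁ q₀ κ : R,
      ham k c z = quinticHam (algebraMap ℂ R c.α) b b' e q₂ q₁ q₀ κ := by
    rcases hk with rfl | rfl
    · refine ⟨algebraMap ℂ R c.β, -algebraMap ℂ R (2 + c.β), 1, -algebraMap ℂ R c.κ₁,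
        algebraMap ℂ R (c.κ₁ + c.κ₂) + z * algebraMap ℂ R c.κ₄, -algebraMap ℂ R c.κ₂,
        -algebraMap ℂ R c.κ₃, ?_⟩
      simp only [ham, quinticHam, leadHam, complex_smul_eq, map_sub, map_one, pow_succ, pow_zero,
        one_mul, mul_assoc]
      module
    · refine ⟨algebraMap ℂ R c.β + z * algebraMap ℂ R c.γ,
        -algebraMap ℂ R (1 + c.β) - z * algebraMap ℂ R (1 + c.γ), z, -algebraMap ℂ R c.κ₁,
        algebraMap ℂ R c.κ₂ + z * algebraMap ℂ R c.κ₄, z * algebraMap ℂ R (c.κ₁ - c.κ₂ - c.κ₄),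
        -algebraMap ℂ R c.κ₃, ?_⟩
      simp only [ham, quinticHam, leadHam, complex_smul_eq, map_sub, map_one, pow_succ, pow_zero,
        one_mul, mul_assoc]
      module
  rw [hH] at hb
  refine bracket_quinticHam_ne_zero hα b b' e q₂ q₁ q₀ κ ?_ hb
  rw [← hH, weightEval, AlgHom.comp_apply, AlgHom.comp_apply, hS, scalarReduction_ham, map_pow]

theorem listU_α_zero (k : PType) (c : Consts) (z : R) :
    listU k { c with α := 0 } z = listU k c z := by cases k <;> rfl

theorem listV_α_zero (k : PType) (c : Consts) (z : R) :
    listV k { c with α := 0 } z = listV k c z := by cases k <;> rfl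

end Nonexistence

end NCPainleve

theorem mainTheorem1 {R : Type*} [CommRing R] [Algebra ℂ R] [Nontrivial R] (z : R)
    (k : NCPainleve.PType) :
    (∀ c : NCPainleve.Consts,
      NCPainleve.HasSecond k c z ↔
        ((k = NCPainleve.PType.P5 ∨ k = NCPainleve.PType.P6) → c.α = 0)) ∧
    (∀ F G : NCPainleve.NC R,
      (∃ c : NCPainleve.Consts, NCPainleve.HasSecond k c z ∧
        NCPainleve.IsHamiltonianSystem k z (NCPainleve.ham k c z) F G) ↔
      (∃ c : NCPainleve.Consts,
        NCPainleve.factor k z • F = NCPainleve.listU k c z ∧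
        NCPainleve.factor k z • G = NCPainleve.listV k c z)) ∧
    (∀ c : NCPainleve.Consts,
      NCPainleve.trace (NCPainleve.ham k c z) =
        NCPainleve.trace (NCPainleve.ham k { c with β := 0, γ := 0 } z) -
          (1 / 2 : ℂ) • NCPainleve.extra k c z •
            NCPainleve.trace (NCPainleve.comm NCPainleve.U NCPainleve.V ^ 2)) := by
  refine ⟨fun c => ⟨NCPainleve.α_eq_zero_of_hasSecond, NCPainleve.hasSecond_of_α k c z⟩,
    fun F G => ⟨?_, ?_⟩, fun c => NCPainleve.trace_ham_eq k c z⟩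
  · rintro ⟨c, hc, hF, hG⟩
    have hα := NCPainleve.α_eq_zero_of_hasSecond hc
    exact ⟨c, hF.trans (NCPainleve.dV_ham k c z hα), hG.trans (NCPainleve.neg_dU_ham k c z hα)⟩
  · rintro ⟨c, hF, hG⟩
    -- The listed systems do not contain α, so it may be reset to 0.
    refine ⟨{ c with α := 0 }, NCPainleve.hasSecond_of_α k _ z fun _ => rfl, ?_, ?_⟩
    · rw [NCPainleve.dV_ham k _ z fun _ => rfl, NCPainleve.listU_α_zero, hF]
    · rw [NCPainleve.neg_dU_ham k _ z fun _ => rfl, NCPainleve.listV_α_zero, hG]
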